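/- **Conventions.** Let $\mathcal S$ be the set of finite bipartite trivalent graphs (multiple edges allowed) with every edge oriented from the first part to the second, and let $\mathcal T=\{t_1,t_2,\dots\}$ be the set of isomorphism classes of connected graphs in $\mathcal S$ that have neither bigons nor quadrilaterals. Let $\mathcal M=\mathbb Z[A,A^{-1}][t_1,t_2,\dots]$. A *web* is a finite disjoint union of graphs in $\mathcal S$ and circles, considered as an abstract oriented graph (no cyclic order at the vertices). A *Kuperberg evaluation* is a map $f$ from webs, up to isomorphism, to $\mathcal M$ such that * $f(\emptyset)=1$, $f(\Gamma\sqcup\Gamma')=f(\Gamma)f(\Gamma')$, and $f(\Gamma)=t_i$ if $\Gamma$ is in the class $t_i\in\mathcal T$; * $f(\bigcirc)=A^6+1+A^{-6}$; * if $\Gamma$ contains a bigon and $\Gamma_1$ arises by replacing the bigon together with its two outer edges by a single edge, then $f(\Gamma)=(A^3+A^{-3})f(\Gamma_1)$; * if $\Gamma$ contains a quadrilateral with four distinct vertices and $\Gamma_1,\Gamma_2$ arise by deleting it and joining each of the two edges that enter it to one of the two edges that leave it, in the two possible ways, then $f(\Gamma)=f(\Gamma_1)+f(\Gamma_2)$.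 An *oriented virtual link diagram* is given by its combinatorial data: finitely many classical crossings (with sign) and virtual crossings, each with the cyclic order of its two incoming and two outgoing edges, joined by oriented edges, and possibly circles without crossings. Planarity of these data is not required; diagrams drawn in the plane are included. In a *state* every classical crossing is resolved either in the *oriented* way (each incoming edge is joined to the adjacent outgoing edge) or in the *unoriented* way (the two incoming edges end at a new sink, the two outgoing edges begin at a new source, and an edge from the source to the sink is added); virtual crossings are disregarded. A crossing of sign $\varepsilon=\pm1$ has weight $A^{2\varepsilon}$ if resolved in the oriented way and $-A^{-\varepsilon}$ otherwise; the weight $w(s)$ of a state $s$ is the product of these weights, and $K_s$ denotes the resulting web. The writhe $wr(K)$ is the sum of the signs of all classical crossings. **Theorem.** There is exactly one Kuperberg evaluation $f$. With this $f$, put $$[[K]]=\sum_s w(s)\,f(K_s)\in\mathcal M,\qquad P(K)=A^{-8\,wr(K)}[[K]]$$ for every oriented virtual link diagram $K$. Then $P(K)$ is invariant under all Reidemeister moves, classical, virtual and mixed, with all orientations of the strands, and under the virtualization move ($Z$-move), which interchanges a classical crossing with an adjacent virtual crossing of the same two strands. Moreover $P$ has the value $A^6+1+A^{-6}$ on a circle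 without crossings, and it satisfies the $sl(3)$ Homflypt skein relation $$A^{9}P(K_+)-A^{-9}P(K_-)=(A^{3}-A^{-3})P(K_0)$$ whenever $K_+,K_-,K_0$ differ only at one classical crossing, which is positive in $K_+$, negative in $K_-$, and resolved in the oriented way in $K_0$. -/

import Mathlib

/-!
Graphs and diagrams are encoded by naming their oriented edges by natural numbers and listing, for
every node, the edges that come in and the edges that go out.  A bivalent node (a *joint*) is a mere
point on an edge: it makes closed curves without vertices and crossingless arcs expressible.
-/

namespace KuperbergBracket

/-! ### Webs: trivalent bipartite oriented graphs together with circles -/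

/-- A node of a web: a source (first part of the bipartition) with its set of outgoing edges, a sink
(second part) with its set of incoming edges, or a point at which edge `a` continues as edge `b`. -/
inductive WNode where
  | source (s : Multiset ℕ)
  | sink (s : Multiset ℕ)
  | joint (a b : ℕ)

namespace WNode

/-- The edges that end at a node. -/
def ins : WNode → Multiset ℕ
  | source _ => 0
  | sink s => s
  | joint a _ => {a}

/-- The edges that begin at a node. -/
def outs : WNode → Multiset ℕ
  | source s => s
  | sink _ => 0
  | joint _ b => {b}

/-- Renaming of edges. -/
def relabel (σ : ℕ → ℕ) : WNode → WNode
  | source s => source (s.map σ)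
  | sink s => sink (s.map σ)
  | joint a b => joint (σ a) (σ b)

/-- Sources and sinks are trivalent. -/
def Trivalent : WNode → Prop
  | source s => s.card = 3
  | sink s => s.card = 3
  | joint _ _ => True

theorem relabel_id (n : WNode) : n.relabel (fun x => x) = n := by
  cases n <;> simp [relabel]

theorem relabel_relabel (σ τ : ℕ → ℕ) (n : WNode) :
    (n.relabel σ).relabel τ = n.relabel (fun x => τ (σ x)) := by
  cases n <;> simp [relabel, Multiset.map_map]

end WNode

/-- A web: a finite disjoint union of trivalent bipartite graphs (multiple edges allowed), every edge
oriented from the first part to the second, and of circles.  Every edge ends at exactly one node and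
begins at exactly one node. -/
@[ext]
structure Web where
  nodes : Multiset WNode
  nodup : (nodes.bind WNode.ins).Nodup
  balanced : nodes.bind WNode.ins = nodes.bind WNode.outs
  trivalent : ∀ n ∈ nodes, n.Trivalent

/-- A bigon: two edges `e`, `f` from a source to a sink; `x` is the third edge at the source, `y` the
third edge at the sink. -/
def bigon (e f x y : ℕ) : Multiset WNode :=
  {WNode.source {e, f, x}, WNode.sink {e, f, y}}

/-- A quadrilateral with two sources and two sinks as its vertices: `eᵢⱼ` joins source `i` to sink
`j`, `xᵢ` is the third edge at source `i`, and `yⱼ` the third edge at sink `j`. -/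
def quad (e₁₁ e₁₂ e₂₁ e₂₂ x₁ x₂ y₁ y₂ : ℕ) : Multiset WNode :=
  {WNode.source {e₁₁, e₁₂, x₁}, WNode.source {e₂₁, e₂₂, x₂},
    WNode.sink {e₁₁, e₂₁, y₁}, WNode.sink {e₁₂, e₂₂, y₂}}

namespace Web

/-- The web is not empty and not a disjoint union of two nonempty webs. -/
def Connected (G : Web) : Prop :=
  G.nodes ≠ 0 ∧ ∀ P Q : Web, G.nodes = P.nodes + Q.nodes → P.nodes = 0 ∨ Q.nodes = 0

/-- A connected trivalent bipartite graph (so there are no joints) that has neither bigons nor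
quadrilaterals. -/
structure Irreducible (G : Web) : Prop where
  connected : G.Connected
  noJoint : ∀ a b, WNode.joint a b ∉ G.nodes
  noBigon : ∀ e f x y, ¬ bigon e f x y ≤ G.nodes
  noQuad : ∀ e₁₁ e₁₂ e₂₁ e₂₂ x₁ x₂ y₁ y₂, ¬ quad e₁₁ e₁₂ e₂₁ e₂₂ x₁ x₂ y₁ y₂ ≤ G.nodes

/-- Isomorphism of encoded oriented graphs: a renaming of the edges. -/
def Iso (G H : Web) : Prop :=
  ∃ σ : Equiv.Perm ℕ, H.nodes = G.nodes.map (WNode.relabel σ)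

/-- `H` arises from `G` by erasing the joint from `a` to `b`; the two edges merge into one. -/
def EraseJoint (G H : Web) : Prop :=
  ∃ (N : Multiset WNode) (a b : ℕ), a ≠ b ∧ G.nodes = N + {WNode.joint a b} ∧
    H.nodes = N.map (WNode.relabel (Function.update id b a))

theorem iso_equivalence : Equivalence Iso where
  refl G := ⟨1, by
    have : WNode.relabel (⇑(1 : Equiv.Perm ℕ)) = id := by
      funext n; exact WNode.relabel_id n
    rw [this, Multiset.map_id]⟩
  symm := by
    rintro G H ⟨σ, h⟩
    refine ⟨σ.symm, ?_⟩
    rw [h, Multiset.map_map]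
    have : WNode.relabel ⇑σ.symm ∘ WNode.relabel ⇑σ = id := by
      funext n
      simp [WNode.relabel_relabel, WNode.relabel_id]
    rw [this, Multiset.map_id]
  trans := by
    rintro G H K ⟨σ, h⟩ ⟨τ, k⟩
    refine ⟨σ.trans τ, ?_⟩
    rw [k, h, Multiset.map_map]
    have : WNode.relabel ⇑τ ∘ WNode.relabel ⇑σ = WNode.relabel ⇑(σ.trans τ) := by
      funext n
      exact WNode.relabel_relabel _ _ n
    rw [this]

end Web

/-! ### The module of graph polynomials and the evaluation of webs -/

/-- Isomorphism of irreducible webs. -/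
instance irreducibleSetoid : Setoid {G : Web // G.Irreducible} where
  r G H := Web.Iso G.1 H.1
  iseqv :=
    ⟨fun G => Web.iso_equivalence.refl G.1, fun h => Web.iso_equivalence.symm h,
      fun h k => Web.iso_equivalence.trans h k⟩

/-- Isomorphism classes of connected trivalent bipartite oriented graphs that have neither bigons nor
quadrilaterals. -/
abbrev Generator : Type := Quotient irreducibleSetoid

/-- `ℤ[A, A⁻¹][t₁, t₂, …]`, with one variable for each irreducible graph. -/
abbrev GraphPoly : Type := MvPolynomial Generator (LaurentPolynomial ℤ)

/-- The scalar `A ^ n`. -/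
noncomputable def A (n : ℤ) : GraphPoly := MvPolynomial.C (LaurentPolynomial.T n)

/-- The Kuperberg relations for an evaluation `f` of webs. The first two fields say that `f` depends
only on the web as an abstract oriented graph with circles. -/
structure IsKuperbergEvaluation (f : Web → GraphPoly) : Prop where
  iso : ∀ G H : Web, G.Iso H → f H = f G
  eraseJoint : ∀ G H : Web, G.EraseJoint H → f G = f H
  empty : ∀ G : Web, G.nodes = 0 → f G = 1
  disjointUnion : ∀ G P Q : Web, G.nodes = P.nodes + Q.nodes → f G = f P * f Q
  irreducible : ∀ (G : Web) (h : G.Irreducible), f G = MvPolynomial.X (Quotient.mk _ ⟨G, h⟩)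
  circle : ∀ (G : Web) (a : ℕ), G.nodes = {WNode.joint a a} → f G = A 6 + 1 + A (-6)
  bigon : ∀ (G H : Web) (N : Multiset WNode) (e f' x y : ℕ),
    G.nodes = N + bigon e f' x y →
    H.nodes = N + {WNode.joint y x} →
    f G = (A 3 + A (-3)) * f H
  quad : ∀ (G H H' : Web) (N : Multiset WNode) (e₁₁ e₁₂ e₂₁ e₂₂ x₁ x₂ y₁ y₂ : ℕ),
    G.nodes = N + quad e₁₁ e₁₂ e₂₁ e₂₂ x₁ x₂ y₁ y₂ →
    H.nodes = N + {WNode.joint y₁ x₁, WNode.joint y₂ x₂} →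
    H'.nodes = N + {WNode.joint y₁ x₂, WNode.joint y₂ x₁} →
    f G = f H + f H'

/-! ### Oriented virtual link diagrams -/

/-- The kind of a crossing: classical of sign `+1`, classical of sign `-1`, or virtual. -/
inductive Kind where
  | positive
  | negative
  | virtual
  deriving DecidableEq

namespace Kind

/-- The sign of a crossing (zero for a virtual one). -/
def sign : Kind → ℤ
  | positive => 1
  | negative => -1
  | virtual => 0

/-- Exchange of over- and undercrossing. -/
def mirror : Kind → Kind
  | positive => negative
  | negative => positive
  | virtual => virtual

/-- The kind of a classical crossing whose strand `0` has height `p` and whose strand `1` has height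
`q`: by the convention in `DNode`, it is positive exactly if strand `0` is the upper one. -/
def ofHeights (p q : ℕ) : Kind := if q < p then positive else negative

end Kind

/-- A node of a diagram.

In `crossing k a b c d` strand `0` comes in along `a` and leaves along `c`, strand `1` comes in along
`b` and leaves along `d`. The strands are numbered so that (direction of strand `0`, direction of
strand `1`) is a positive basis of the plane; the counterclockwise order of the edges is thus
`c, d, a, b`, and strand `0` is the upper one at a positive crossing, strand `1` at a negative one.

`joint a b` is a point at which the edge `a` continues as the edge `b`. -/
inductive DNode where
  | crossing (k : Kind) (a b c d : ℕ)
  | joint (a b : ℕ)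
  deriving DecidableEq

namespace DNode

/-- The edges that end at a node. -/
def ins : DNode → Multiset ℕ
  | crossing _ a b _ _ => {a, b}
  | joint a _ => {a}

/-- The edges that begin at a node. -/
def outs : DNode → Multiset ℕ
  | crossing _ _ _ c d => {c, d}
  | joint _ b => {b}

/-- Renaming of edges. -/
def relabel (σ : ℕ → ℕ) : DNode → DNode
  | crossing k a b c d => crossing k (σ a) (σ b) (σ c) (σ d)
  | joint a b => joint (σ a) (σ b)

/-- The sign of a classical crossing; zero for virtual crossings and joints. -/
def sign : DNode → ℤ
  | crossing k _ _ _ _ => k.sign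
  | joint _ _ => 0

/-- The two local states. Edge `x` of the diagram becomes edge `2 * x` of the web; the edge that the
unoriented state adds at a crossing with first incoming edge `a` gets the new name `2 * a + 1`.
A virtual crossing is no node of the graph: its two strands just go on. -/
def resolve (oriented : Bool) : DNode → Multiset WNode
  | joint a b => {WNode.joint (2 * a) (2 * b)}
  | crossing Kind.virtual a b c d =>
      {WNode.joint (2 * a) (2 * c), WNode.joint (2 * b) (2 * d)}
  | crossing _ a b c d =>
      if oriented then {WNode.joint (2 * a) (2 * d), WNode.joint (2 * b) (2 * c)}
      else {WNode.source {2 * c, 2 * d, 2 * a + 1}, WNode.sink {2 * a, 2 * b, 2 * a + 1}}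

/-- The names of the new edges. -/
def added (oriented : Bool) : DNode → Multiset ℕ
  | joint _ _ => 0
  | crossing Kind.virtual _ _ _ _ => 0
  | crossing _ a _ _ _ => if oriented then 0 else {2 * a + 1}

theorem bind_ins_resolve (o : Bool) (n : DNode) :
    (n.resolve o).bind WNode.ins = n.ins.map (fun x => 2 * x) + n.added o := by
  rcases n with ⟨k, a, b, c, d⟩ | ⟨a, b⟩
  · cases k <;> cases o <;> simp [resolve, ins, added, WNode.ins]
  · simp [resolve, ins, added, WNode.ins]

theorem bind_outs_resolve (o : Bool) (n : DNode) :
    (n.resolve o).bind WNode.outs = n.outs.map (fun x => 2 * x) + n.added o := by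
  rcases n with ⟨k, a, b, c, d⟩ | ⟨a, b⟩
  · cases k <;> cases o <;> simp [resolve, outs, added, WNode.outs]
    all_goals exact Multiset.pair_comm _ _
  · simp [resolve, outs, added, WNode.outs]

theorem added_le (o : Bool) (n : DNode) : n.added o ≤ n.ins.map (fun x => 2 * x + 1) := by
  rcases n with ⟨k, a, b, c, d⟩ | ⟨a, b⟩
  · cases k <;> cases o <;> simp [ins, added]
  · simp [added]

theorem trivalent_of_mem_resolve (o : Bool) (n : DNode) (w : WNode) (h : w ∈ n.resolve o) :
    w.Trivalent := by
  rcases n with ⟨k, a, b, c, d⟩ | ⟨a, b⟩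
  · cases k <;> cases o <;> simp [resolve] at h <;> rcases h with rfl | rfl <;>
      simp [WNode.Trivalent]
  · simp [resolve] at h
    subst h
    simp [WNode.Trivalent]

end DNode

/-- An oriented virtual link diagram: every edge ends at exactly one node and begins at exactly one
node. The cyclic order of the edges at each crossing is part of the data. Diagrams drawn in the plane
are encoded in this way; the condition that the code be planar is not imposed. -/
@[ext]
structure Diagram where
  nodes : Multiset DNode
  nodup : (nodes.bind DNode.ins).Nodup
  balanced : nodes.bind DNode.ins = nodes.bind DNode.outs

namespace Diagram

/-- The set of classical crossings. -/
def classical (K : Diagram) : Finset DNode := K.nodes.toFinset.filter (fun n => n.sign ≠ 0)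

/-- The writhe: the sum of the signs of all classical crossings. -/
def writhe (K : Diagram) : ℤ := ∑ n ∈ K.classical, n.sign

/-- The graph of a state; `S` is the set of crossings that are resolved in the oriented way. -/
def state (K : Diagram) (S : Finset DNode) : Web where
  nodes := K.nodes.bind fun n => n.resolve (n ∈ S)
  nodup := by
    rw [Multiset.bind_assoc]
    simp only [DNode.bind_ins_resolve]
    rw [Multiset.bind_add, ← Multiset.map_bind]
    have hle : (K.nodes.bind fun n => n.added (n ∈ S)) ≤
        (K.nodes.bind DNode.ins).map (fun x => 2 * x + 1) := by
      rw [Multiset.map_bind]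
      generalize K.nodes = s
      induction s using Multiset.induction_on with
      | empty => simp
      | cons n s ih =>
        rw [Multiset.cons_bind, Multiset.cons_bind]
        exact add_le_add (DNode.added_le _ n) ih
    refine Multiset.nodup_add.2 ⟨?_, ?_, ?_⟩
    · exact K.nodup.map (fun x y h => by simpa using h)
    · exact Multiset.nodup_of_le hle (K.nodup.map (fun x y h => by simpa using h))
    · refine Multiset.disjoint_left.2 fun {x} hx hy => ?_
      obtain ⟨u, -, rfl⟩ := Multiset.mem_map.1 hx
      obtain ⟨v, -, hv⟩ := Multiset.mem_map.1 (Multiset.mem_of_le hle hy)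
      omega
  balanced := by
    rw [Multiset.bind_assoc, Multiset.bind_assoc]
    simp only [DNode.bind_ins_resolve, DNode.bind_outs_resolve]
    rw [Multiset.bind_add, Multiset.bind_add, ← Multiset.map_bind, ← Multiset.map_bind,
      K.balanced]
  trivalent := by
    intro w hw
    obtain ⟨n, -, h⟩ := Multiset.mem_bind.1 hw
    exact DNode.trivalent_of_mem_resolve _ n w h

/-- The weight of a state: a crossing of sign `ε` contributes `A ^ (2 * ε)` if it is resolved in the
oriented way and `-A ^ (-ε)` if not. -/
noncomputable def weight (K : Diagram) (S : Finset DNode) : GraphPoly :=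
  ∏ n ∈ K.classical, if n ∈ S then A (2 * n.sign) else -A (-n.sign)

/-- The generalized Kuperberg bracket `[[K]]` for an evaluation `f` of webs. -/
noncomputable def bracket (f : Web → GraphPoly) (K : Diagram) : GraphPoly :=
  ∑ S ∈ K.classical.powerset, K.weight S * f (K.state S)

/-- The normalized bracket `A ^ (-8 wr(K)) [[K]]`. -/
noncomputable def normalizedBracket (f : Web → GraphPoly) (K : Diagram) : GraphPoly :=
  A (-8 * K.writhe) * K.bracket f

end Diagram

/-! ### Moves -/

/-- Two strands, one from `a` to `b` and one from `c` to `d`, that run in the same direction and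
cross twice, first at a crossing of kind `k` and then at one of kind `l`. -/
def parallelTwist (k l : Kind) (a b c d i j : ℕ) : Multiset DNode :=
  {DNode.crossing k a c i j, DNode.crossing l j i d b}

/-- Two strands, one from `a` to `b` and one from `c` to `d`, that run in opposite directions and
cross twice; the first strand meets the crossing of kind `k` before the one of kind `l`, the second
strand meets `l` before `k`. The first strand is strand `0` at the crossing of kind `k`. -/
def antiparallelTwist (k l : Kind) (a b c d i j : ℕ) : Multiset DNode :=
  {DNode.crossing k a j i d, DNode.crossing l c i j b}

/-- The same as `antiparallelTwist`, but the bigon between the strands has the other orientation: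
the first strand is strand `1` at the crossing of kind `k`. -/
def antiparallelTwist' (k l : Kind) (a b c d i j : ℕ) : Multiset DNode :=
  {DNode.crossing k j a d i, DNode.crossing l i c b j}

/-- The kinds `k₁₂ k₁₃ k₂₃` of the crossings of three strands which admit a third Reidemeister move:
either the strands lie at three different heights, or one strand has virtual crossings only. The
kind `kᵢⱼ` is read with strand `i` as strand `0` of the crossing. -/
inductive TriangleKinds : Kind → Kind → Kind → Prop
  | heights (p₁ p₂ p₃ : ℕ) (h₁₂ : p₁ ≠ p₂) (h₁₃ : p₁ ≠ p₃) (h₂₃ : p₂ ≠ p₃) :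
      TriangleKinds (Kind.ofHeights p₁ p₂) (Kind.ofHeights p₁ p₃) (Kind.ofHeights p₂ p₃)
  | virtual₁ (k : Kind) : TriangleKinds Kind.virtual Kind.virtual k
  | virtual₂ (k : Kind) : TriangleKinds Kind.virtual k Kind.virtual
  | virtual₃ (k : Kind) : TriangleKinds k Kind.virtual Kind.virtual

/-- The local moves. A joint on the right-hand side stands for an arc without crossings. Classical,
virtual and mixed moves and all orientations of the strands are covered. -/
inductive LocalMove : Multiset DNode → Multiset DNode → Prop
  /-- First move (classical or virtual), for a strand from `a` to `b`. -/
  | kink (k : Kind) (a b i : ℕ) :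
      LocalMove {DNode.crossing k a i i b} {DNode.joint a b}
  | kink' (k : Kind) (a b i : ℕ) :
      LocalMove {DNode.crossing k i a b i} {DNode.joint a b}
  /-- Second move (classical or virtual). -/
  | parallel (k : Kind) (a b c d i j : ℕ) :
      LocalMove (parallelTwist k k.mirror a b c d i j) {DNode.joint a b, DNode.joint c d}
  | antiparallel (k : Kind) (a b c d i j : ℕ) :
      LocalMove (antiparallelTwist k k.mirror a b c d i j) {DNode.joint a b, DNode.joint c d}
  | antiparallel' (k : Kind) (a b c d i j : ℕ) :
      LocalMove (antiparallelTwist' k k.mirror a b c d i j) {DNode.joint a b, DNode.joint c d}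
  /-- Third move (classical, virtual or mixed): strand `r` runs from `aᵣ` to `bᵣ`, and every strand
  meets the other two in the opposite order after the move. Here the three directions lie in a half
  plane, in counterclockwise order. -/
  | triangle (k₁₂ k₁₃ k₂₃ : Kind) (h : TriangleKinds k₁₂ k₁₃ k₂₃)
      (a₁ a₂ a₃ b₁ b₂ b₃ i₁ i₂ i₃ j₁ j₂ j₃ : ℕ) :
      LocalMove
        {DNode.crossing k₁₂ a₁ a₂ i₁ i₂, DNode.crossing k₁₃ i₁ a₃ b₁ i₃,
          DNode.crossing k₂₃ i₂ i₃ b₂ b₃}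
        {DNode.crossing k₂₃ a₂ a₃ j₂ j₃, DNode.crossing k₁₃ a₁ j₃ j₁ b₃,
          DNode.crossing k₁₂ j₁ j₂ b₁ b₂}
  /-- Third move for three strands whose directions do not lie in a half plane; strand `3` is now
  strand `0` of its crossing with strand `1`. -/
  | cyclicTriangle (k₁₂ k₁₃ k₂₃ : Kind) (h : TriangleKinds k₁₂ k₁₃ k₂₃)
      (a₁ a₂ a₃ b₁ b₂ b₃ i₁ i₂ i₃ j₁ j₂ j₃ : ℕ) :
      LocalMove
        {DNode.crossing k₁₂ i₁ a₂ b₁ i₂, DNode.crossing k₂₃ i₂ a₃ b₂ i₃,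
          DNode.crossing k₁₃.mirror i₃ a₁ b₃ i₁}
        {DNode.crossing k₁₂ a₁ j₂ j₁ b₂, DNode.crossing k₂₃ a₂ j₃ j₂ b₃,
          DNode.crossing k₁₃.mirror a₃ j₁ j₃ b₁}
  /-- The virtualization move (Z-move): a classical crossing and an adjacent virtual crossing of the
  same two strands are interchanged. -/
  | zParallel (k : Kind) (a b c d i j i' j' : ℕ) :
      LocalMove (parallelTwist k Kind.virtual a b c d i j)
        (parallelTwist Kind.virtual k a b c d i' j')
  | zAntiparallel (k : Kind) (a b c d i j i' j' : ℕ) :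
      LocalMove (antiparallelTwist k Kind.virtual a b c d i j)
        (antiparallelTwist Kind.virtual k a b c d i' j')
  | zAntiparallel' (k : Kind) (a b c d i j i' j' : ℕ) :
      LocalMove (antiparallelTwist' k Kind.virtual a b c d i j)
        (antiparallelTwist' Kind.virtual k a b c d i' j')

namespace Diagram

/-- One step between diagrams: a renaming of edges, the erasure of a joint (both of which leave the
drawn diagram unchanged), or a local move inside an arbitrary diagram. -/
inductive Move : Diagram → Diagram → Prop
  | relabel (K L : Diagram) (σ : Equiv.Perm ℕ) (h : L.nodes = K.nodes.map (DNode.relabel σ)) :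
      Move K L
  | eraseJoint (K L : Diagram) (N : Multiset DNode) (a b : ℕ) (hab : a ≠ b)
      (hK : K.nodes = N + {DNode.joint a b})
      (hL : L.nodes = N.map (DNode.relabel (Function.update id b a))) : Move K L
  | replace (K L : Diagram) (N P Q : Multiset DNode) (h : LocalMove P Q)
      (hK : K.nodes = N + P) (hL : L.nodes = N + Q) : Move K L

/-- Equality of virtual link diagrams up to all Reidemeister moves, classical and virtual, and the
virtualization move. -/
def ZEquiv : Diagram → Diagram → Prop := Relation.EqvGen Move

end Diagram

end KuperbergBracket

/-! The defining relations are read as rewriting rules on webs: erase a joint, remove a circle, open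
a bigon, split a quadrilateral. Every rule lowers the number of nodes, so rewriting terminates, and
the existence of an evaluation becomes a question of local confluence, as in Newman's diamond lemma.
Write δ for `A 6 + 1 + A (-6)`. Reductions at disjoint places commute. Overlapping bigons and
quadrilaterals share an edge, because two pairs of edges at a trivalent vertex must meet. This
leaves three parallel edges, a bigon on one side of a quadrilateral, and two quadrilaterals with one
edge, a path of two edges, or all four vertices in common. The identity behind these cases is δ + 1
= (A^3 + A^(-3))^2. `Step.unique` collects them.

Confluence at n nodes needs an evaluation only on webs with fewer nodes (`RespectsBelow`), so
existence and uniqueness of values go up by induction on n (`UniqueBelow.succ`). A web without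
reductions is a disjoint union of irreducible graphs, and two decompositions of it have a common
refinement, so its value is well defined. `value_add` extends multiplicativity to all webs.
Conversely every Kuperberg evaluation obeys the clauses of `Value`, which gives uniqueness of f
(`IsKuperbergEvaluation.eq_of_value`).

For invariance the factor A^(-8 wr) is distributed over the crossings, so that `stateSum` is a local
expansion with weights A^(-6ε) and -A^(-9ε). It then suffices to expand the two tangles of a move
and to reduce their states to the same formal combination. For the first move this is A^(-6ε) δ -
A^(-9ε) (A^3 + A^(-3)) = 1. The Z-move holds because the edges at a source or sink are unordered and
because the oriented state joins the strands in the same way on either side of the virtual crossing.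
In the skein combination the unoriented states cancel.

Both the overlaps and the moves are finite checks on webs with symbolic edge names, done by the
kernel through `SLin.agree`; `SLin.eval_eq_of_agree` is its soundness. Symbols below 100 name legs
shared by the two sides, symbols from 100 on name internal edges, whose names are immaterial. -/

namespace KuperbergBracket

/-! ### Webs as multisets of nodes -/

namespace WNode

theorem ins_relabel (σ : ℕ → ℕ) (n : WNode) : (n.relabel σ).ins = n.ins.map σ := by
  cases n <;> simp [relabel, ins]

theorem outs_relabel (σ : ℕ → ℕ) (n : WNode) : (n.relabel σ).outs = n.outs.map σ := by
  cases n <;> simp [relabel, outs]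

theorem trivalent_relabel (σ : ℕ → ℕ) (n : WNode) : (n.relabel σ).Trivalent ↔ n.Trivalent := by
  cases n <;> simp [relabel, Trivalent]

theorem relabel_congr {σ τ : ℕ → ℕ} {n : WNode} (hi : ∀ x ∈ n.ins, σ x = τ x)
    (ho : ∀ x ∈ n.outs, σ x = τ x) : n.relabel σ = n.relabel τ := by
  cases n with
  | source s => exact congrArg source (Multiset.map_congr rfl ho)
  | sink s => exact congrArg sink (Multiset.map_congr rfl hi)
  | joint a b =>
    simp [ins, outs] at hi ho
    simp [relabel, hi, ho]

end WNode

/-- The edges that end at some node. -/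
abbrev insOf (s : Multiset WNode) : Multiset ℕ := s.bind WNode.ins

/-- The edges that begin at some node. -/
abbrev outsOf (s : Multiset WNode) : Multiset ℕ := s.bind WNode.outs

/-- Renaming of all edges. -/
abbrev relabelAll (σ : ℕ → ℕ) (s : Multiset WNode) : Multiset WNode := s.map (WNode.relabel σ)

theorem insOf_relabelAll (σ : ℕ → ℕ) (s : Multiset WNode) :
    insOf (relabelAll σ s) = (insOf s).map σ := by
  simp [insOf, relabelAll, Multiset.bind_map, Multiset.map_bind, WNode.ins_relabel]

theorem outsOf_relabelAll (σ : ℕ → ℕ) (s : Multiset WNode) :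
    outsOf (relabelAll σ s) = (outsOf s).map σ := by
  simp [outsOf, relabelAll, Multiset.bind_map, Multiset.map_bind, WNode.outs_relabel]

theorem relabelAll_relabelAll (σ τ : ℕ → ℕ) (s : Multiset WNode) :
    relabelAll τ (relabelAll σ s) = relabelAll (fun x => τ (σ x)) s := by
  simp [relabelAll, Multiset.map_map, WNode.relabel_relabel]

theorem relabelAll_congr {σ τ : ℕ → ℕ} {s : Multiset WNode} (hi : ∀ x ∈ insOf s, σ x = τ x)
    (ho : ∀ x ∈ outsOf s, σ x = τ x) : relabelAll σ s = relabelAll τ s :=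
  Multiset.map_congr rfl fun n hn => WNode.relabel_congr
    (fun x hx => hi x (Multiset.mem_bind.2 ⟨n, hn, hx⟩))
    (fun x hx => ho x (Multiset.mem_bind.2 ⟨n, hn, hx⟩))

theorem relabelAll_id (s : Multiset WNode) : relabelAll (fun x => x) s = s := by
  simp [relabelAll, WNode.relabel_id]

theorem relabelAll_eq_self {σ : ℕ → ℕ} {s : Multiset WNode} (hi : ∀ x ∈ insOf s, σ x = x)
    (ho : ∀ x ∈ outsOf s, σ x = x) : relabelAll σ s = s :=
  (relabelAll_congr hi ho).trans (relabelAll_id s)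

/-- A multiset of nodes is the set of nodes of a web. -/
structure IsWeb (s : Multiset WNode) : Prop where
  nodup : (insOf s).Nodup
  balanced : insOf s = outsOf s
  trivalent : ∀ n ∈ s, n.Trivalent

theorem Web.isWeb (G : Web) : IsWeb G.nodes := ⟨G.nodup, G.balanced, G.trivalent⟩

/-- The web with a given set of nodes. -/
def IsWeb.toWeb {s : Multiset WNode} (h : IsWeb s) : Web := ⟨s, h.nodup, h.balanced, h.trivalent⟩

theorem isWeb_zero : IsWeb 0 := ⟨by simp, by simp, by simp⟩

namespace IsWeb

variable {s N P Q M : Multiset WNode}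

theorem nodup_outs (h : IsWeb s) : (outsOf s).Nodup := h.balanced ▸ h.nodup

theorem relabelAll_of_injOn (h : IsWeb s) {σ : ℕ → ℕ} (hσ : ∀ x ∈ insOf s, ∀ y ∈ insOf s,
    σ x = σ y → x = y) : IsWeb (relabelAll σ s) where
  nodup := by
    rw [insOf_relabelAll]
    exact Multiset.Nodup.map_on hσ h.nodup
  balanced := by rw [insOf_relabelAll, outsOf_relabelAll, h.balanced]
  trivalent n hn := by
    obtain ⟨m, hm, rfl⟩ := Multiset.mem_map.1 hn
    exact (WNode.trivalent_relabel σ m).2 (h.trivalent m hm)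

theorem relabelAll (h : IsWeb s) (σ : Equiv.Perm ℕ) : IsWeb (relabelAll σ s) :=
  h.relabelAll_of_injOn fun _ _ _ _ e => σ.injective e

/-- `E` consists of the edges that vanish with both their ends. It is subtracted from the incoming
and from the outgoing edges alike, so balance survives by cancellation. -/
theorem replace (h : IsWeb (N + P)) (E : Multiset ℕ) (hi : insOf P = insOf Q + E)
    (ho : outsOf P = outsOf Q + E) (ht : ∀ n ∈ Q, n.Trivalent) : IsWeb (N + Q) where
  nodup := by
    have := h.nodup
    simp only [insOf, Multiset.add_bind] at this hi ⊢
    rw [hi, ← add_assoc] at this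
    exact (Multiset.nodup_add.1 this).1
  balanced := by
    have := h.balanced
    simp only [insOf, outsOf, Multiset.add_bind] at this hi ho ⊢
    rw [hi, ho, ← add_assoc, ← add_assoc] at this
    exact add_right_cancel this
  trivalent n hn := by
    rcases Multiset.mem_add.1 hn with hn | hn
    · exact h.trivalent n (Multiset.mem_add.2 (Or.inl hn))
    · exact ht n hn

theorem nodup_ins_of_mem (h : IsWeb s) {n : WNode} (hn : n ∈ s) : n.ins.Nodup :=
  (Multiset.nodup_bind.1 h.nodup).1 n hn

theorem nodup_outs_of_mem (h : IsWeb s) {n : WNode} (hn : n ∈ s) : n.outs.Nodup :=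
  (Multiset.nodup_bind.1 h.nodup_outs).1 n hn

theorem eq_of_mem_ins (h : IsWeb s) {n m : WNode} (hn : n ∈ s) (hm : m ∈ s) {e : ℕ}
    (hen : e ∈ n.ins) (hem : e ∈ m.ins) : n = m := by
  by_contra hne
  obtain ⟨t, rfl⟩ := Multiset.exists_cons_of_mem hn
  have := h.nodup
  simp only [insOf, Multiset.cons_bind] at this
  exact Multiset.disjoint_left.1 (Multiset.nodup_add.1 this).2.2 hen
    (Multiset.mem_bind.2 ⟨m, (Multiset.mem_cons.1 hm).resolve_left (Ne.symm hne), hem⟩)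

theorem eq_of_mem_outs (h : IsWeb s) {n m : WNode} (hn : n ∈ s) (hm : m ∈ s) {e : ℕ}
    (hen : e ∈ n.outs) (hem : e ∈ m.outs) : n = m := by
  by_contra hne
  obtain ⟨t, rfl⟩ := Multiset.exists_cons_of_mem hn
  have := h.nodup_outs
  simp only [outsOf, Multiset.cons_bind] at this
  exact Multiset.disjoint_left.1 (Multiset.nodup_add.1 this).2.2 hen
    (Multiset.mem_bind.2 ⟨m, (Multiset.mem_cons.1 hm).resolve_left (Ne.symm hne), hem⟩)

/-- A repeated node would repeat all its edges, and every node has one: a source or sink by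
trivalence, a joint by its form. -/
theorem nodup_nodes (h : IsWeb s) : s.Nodup := by
  rw [Multiset.nodup_iff_le]
  intro n hn
  obtain ⟨t, rfl⟩ := Multiset.le_iff_exists_add.1 hn
  have h1 := h.nodup
  have h2 := h.nodup_outs
  have ht := h.trivalent n (by simp)
  simp only [insOf, outsOf, Multiset.add_bind, Multiset.cons_bind] at h1 h2
  have h1 := (Multiset.nodup_add.1 (Multiset.nodup_add.1 h1).1).2.2
  have h2 := (Multiset.nodup_add.1 (Multiset.nodup_add.1 h2).1).2.2
  have key : ∀ u v : Multiset ℕ, Disjoint u (u + v) → u = 0 := fun u v hd =>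
    Multiset.eq_zero_of_forall_notMem fun x hx =>
      Multiset.disjoint_left.1 hd hx (Multiset.mem_add.2 (Or.inl hx))
  cases n with
  | source s => simp [WNode.Trivalent, show s = 0 from key _ _ h2] at ht
  | sink s => simp [WNode.Trivalent, show s = 0 from key _ _ h1] at ht
  | joint a b => simpa [WNode.ins] using key _ _ h1

theorem not_mem_ins_of_right (h : IsWeb (N + P)) {x : ℕ} (hx : x ∈ insOf P) : x ∉ insOf N := by
  have := h.nodup
  simp only [insOf, Multiset.add_bind] at this hx ⊢
  exact fun hN => Multiset.disjoint_left.1 (Multiset.nodup_add.1 this).2.2 hN hx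

theorem not_mem_outs_of_right (h : IsWeb (N + P)) {x : ℕ} (hx : x ∈ outsOf P) : x ∉ outsOf N := by
  have := h.nodup_outs
  simp only [outsOf, Multiset.add_bind] at this hx ⊢
  exact fun hN => Multiset.disjoint_left.1 (Multiset.nodup_add.1 this).2.2 hN hx

/-- Without the joint, `N` still contains the beginning of `a` and the end of `b`, each exactly
once. Renaming `b` to `a` glues these two half edges. -/
theorem eraseJoint {a b : ℕ} (hab : a ≠ b) (h : IsWeb (N + {WNode.joint a b})) :
    IsWeb (KuperbergBracket.relabelAll (Function.update id b a) N) := by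
  have ha : a ∉ insOf N := h.not_mem_ins_of_right (by simp [insOf, WNode.ins])
  have hb : b ∉ outsOf N := h.not_mem_outs_of_right (by simp [outsOf, WNode.outs])
  have hbal := h.balanced
  simp only [insOf, outsOf, Multiset.add_bind, Multiset.singleton_bind, WNode.ins,
    WNode.outs] at hbal
  have hbi : b ∈ insOf N := by
    have : b ∈ (N.bind WNode.ins) + {a} := by rw [hbal]; simp
    rcases Multiset.mem_add.1 this with h | h
    · exact h
    · simp [hab.symm] at h
  obtain ⟨t, ht⟩ := Multiset.exists_cons_of_mem hbi
  have hN : (insOf N).Nodup := by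
    have := h.nodup
    simp only [insOf, Multiset.add_bind] at this
    exact (Multiset.nodup_add.1 this).1
  have hbt : b ∉ t := by rw [ht] at hN; exact (Multiset.nodup_cons.1 hN).1
  have ho : outsOf N = a ::ₘ t := by
    rw [show N.bind WNode.ins = b ::ₘ t from ht] at hbal
    have : b ::ₘ (a ::ₘ t) = b ::ₘ (N.bind WNode.outs) := by
      rw [← Multiset.singleton_add b (N.bind _), add_comm _ (N.bind _), ← hbal,
        Multiset.cons_swap, ← Multiset.singleton_add a, add_comm]
    exact ((Multiset.cons_inj_right _).1 this).symm
  have htmap : t.map (Function.update id b a) = t := by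
    conv_rhs => rw [← Multiset.map_id t]
    refine Multiset.map_congr rfl fun x hx => ?_
    rw [Function.update_of_ne]
    rintro rfl
    exact hbt hx
  refine ⟨?_, ?_, ?_⟩
  · rw [insOf_relabelAll, ht, Multiset.map_cons, htmap, Function.update_self, Multiset.nodup_cons]
    rw [ht] at ha hN
    exact ⟨fun h => ha (Multiset.mem_cons_of_mem h), (Multiset.nodup_cons.1 hN).2⟩
  · rw [insOf_relabelAll, outsOf_relabelAll, ht, ho, Multiset.map_cons, Multiset.map_cons,
      Function.update_self, Function.update_of_ne hab, id]
  · intro n hn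
    obtain ⟨m, hm, rfl⟩ := Multiset.mem_map.1 hn
    exact (WNode.trivalent_relabel _ m).2 (h.trivalent m (by simp [hm]))

/-- The end of an edge of a subweb lies in the subweb. -/
theorem mem_of_mem_outs (h : IsWeb s) (hP : IsWeb P) (hPs : P ≤ s) {n m : WNode} {e : ℕ}
    (hn : n ∈ P) (hm : m ∈ s) (ho : e ∈ n.outs) (hi : e ∈ m.ins) : m ∈ P := by
  have : e ∈ insOf P := hP.balanced ▸ Multiset.mem_bind.2 ⟨n, hn, ho⟩
  obtain ⟨m', hm', hi'⟩ := Multiset.mem_bind.1 this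
  exact h.eq_of_mem_ins (Multiset.mem_of_le hPs hm') hm hi' hi ▸ hm'

/-- The beginning of an edge of a subweb lies in the subweb. -/
theorem mem_of_mem_ins (h : IsWeb s) (hP : IsWeb P) (hPs : P ≤ s) {n m : WNode} {e : ℕ}
    (hn : n ∈ P) (hm : m ∈ s) (hi : e ∈ n.ins) (ho : e ∈ m.outs) : m ∈ P := by
  have : e ∈ outsOf P := hP.balanced ▸ Multiset.mem_bind.2 ⟨n, hn, hi⟩
  obtain ⟨m', hm', hi'⟩ := Multiset.mem_bind.1 this
  exact h.eq_of_mem_outs (Multiset.mem_of_le hPs hm') hm hi' ho ▸ hm'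

theorem of_add_left (h : IsWeb (N + P)) (hP : IsWeb P) : IsWeb N where
  nodup := by
    have := h.nodup
    simp only [insOf, Multiset.add_bind] at this
    exact (Multiset.nodup_add.1 this).1
  balanced := by
    have := h.balanced
    have hb := hP.balanced
    simp only [insOf, outsOf, Multiset.add_bind] at this hb
    rw [hb] at this
    exact add_right_cancel this
  trivalent n hn := h.trivalent n (Multiset.mem_add.2 (Or.inl hn))

end IsWeb

/-! ### Reductions -/

/-- A circle, a bigon or a quadrilateral, together with the linear combination of multisets of nodes
that replaces it. -/
inductive LocalRule : Multiset WNode → List (GraphPoly × Multiset WNode) → Prop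
  | circle (a : ℕ) : LocalRule {WNode.joint a a} [(A 6 + 1 + A (-6), 0)]
  | bigon (e f x y : ℕ) : LocalRule (bigon e f x y) [(A 3 + A (-3), {WNode.joint y x})]
  | quad (e₁₁ e₁₂ e₂₁ e₂₂ x₁ x₂ y₁ y₂ : ℕ) : LocalRule (quad e₁₁ e₁₂ e₂₁ e₂₂ x₁ x₂ y₁ y₂)
      [(1, {WNode.joint y₁ x₁, WNode.joint y₂ x₂}), (1, {WNode.joint y₁ x₂, WNode.joint y₂ x₁})]

/-- The value of a linear combination of webs with the common part `N`. -/
noncomputable def combination (f : Multiset WNode → GraphPoly) (N : Multiset WNode)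
    (L : List (GraphPoly × Multiset WNode)) : GraphPoly :=
  (L.map fun p => p.1 * f (N + p.2)).sum

theorem LocalRule.relabel {P : Multiset WNode} {L : List (GraphPoly × Multiset WNode)}
    (h : LocalRule P L) (σ : ℕ → ℕ) :
    LocalRule (relabelAll σ P) (L.map fun p => (p.1, relabelAll σ p.2)) := by
  cases h with
  | circle a =>
    simpa [relabelAll, WNode.relabel] using LocalRule.circle (σ a)
  | bigon e f x y =>
    simpa [relabelAll, WNode.relabel, KuperbergBracket.bigon] using
      LocalRule.bigon (σ e) (σ f) (σ x) (σ y)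
  | quad e₁₁ e₁₂ e₂₁ e₂₂ x₁ x₂ y₁ y₂ =>
    simpa [relabelAll, WNode.relabel, KuperbergBracket.quad] using
      LocalRule.quad (σ e₁₁) (σ e₁₂) (σ e₂₁) (σ e₂₂) (σ x₁) (σ x₂) (σ y₁) (σ y₂)

theorem LocalRule.isWeb {N P : Multiset WNode} {L : List (GraphPoly × Multiset WNode)}
    (h : LocalRule P L) (hw : IsWeb (N + P)) : ∀ p ∈ L, IsWeb (N + p.2) := by
  cases h with
  | circle a =>
    intro p hp
    obtain rfl : p = _ := by simpa using hp
    exact hw.replace {a} (by simp [insOf, WNode.ins]) (by simp [outsOf, WNode.outs]) (by simp)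
  | bigon e f x y =>
    intro p hp
    obtain rfl : p = _ := by simpa using hp
    refine hw.replace {e, f} ?_ ?_ (by simp [WNode.Trivalent]) <;>
      simp [KuperbergBracket.bigon, insOf, outsOf, WNode.ins, WNode.outs,
        ← Multiset.singleton_add] <;> abel
  | quad e₁₁ e₁₂ e₂₁ e₂₂ x₁ x₂ y₁ y₂ =>
    intro p hp
    simp only [List.mem_cons, List.not_mem_nil, or_false] at hp
    rcases hp with rfl | rfl <;>
    refine hw.replace {e₁₁, e₁₂, e₂₁, e₂₂} ?_ ?_ (by simp [WNode.Trivalent]) <;>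
      simp [KuperbergBracket.quad, insOf, outsOf, WNode.ins, WNode.outs,
        ← Multiset.singleton_add] <;> abel

/-- The number of nodes is the termination measure for all inductions below. -/
theorem LocalRule.card_lt {P : Multiset WNode} {L : List (GraphPoly × Multiset WNode)}
    (h : LocalRule P L) : ∀ p ∈ L, p.2.card < P.card := by
  cases h <;> simp [KuperbergBracket.bigon, KuperbergBracket.quad]

/-- Hence the erasure of a joint with two different edges never overlaps a local rule. -/
theorem LocalRule.eq_of_joint_mem {P : Multiset WNode} {L : List (GraphPoly × Multiset WNode)}
    (h : LocalRule P L) {a b : ℕ} (hab : WNode.joint a b ∈ P) : a = b := by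
  cases h <;> simp [KuperbergBracket.bigon, KuperbergBracket.quad] at hab
  rw [hab.1, hab.2]

/-- `v` is the value that one reduction of the web `s`, followed by `f`, gives to `s`. -/
inductive Step (f : Multiset WNode → GraphPoly) (s : Multiset WNode) : GraphPoly → Prop
  | joint (N : Multiset WNode) (a b : ℕ) (hab : a ≠ b) (hs : s = N + {WNode.joint a b}) :
      Step f s (f (relabelAll (Function.update id b a) N))
  | rule (N P : Multiset WNode) (L : List (GraphPoly × Multiset WNode)) (h : LocalRule P L)
      (hs : s = N + P) : Step f s (combination f N L)

/-- `f` is invariant under isomorphisms and compatible with all reductions of webs with fewer than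
`n` nodes. -/
structure RespectsBelow (n : ℕ) (f : Multiset WNode → GraphPoly) : Prop where
  iso : ∀ s : Multiset WNode, IsWeb s → s.card < n → ∀ σ : Equiv.Perm ℕ, f (relabelAll σ s) = f s
  step : ∀ s : Multiset WNode, IsWeb s → s.card < n → ∀ v, Step f s v → f s = v

namespace RespectsBelow

variable {n : ℕ} {f : Multiset WNode → GraphPoly} {N : Multiset WNode}

theorem joint (hf : RespectsBelow n f) {a b : ℕ} (hw : IsWeb (N + {WNode.joint a b}))
    (hn : (N + {WNode.joint a b}).card < n) (hab : a ≠ b) :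
    f (N + {WNode.joint a b}) = f (relabelAll (Function.update id b a) N) :=
  hf.step _ hw hn _ (Step.joint N a b hab rfl)

theorem rule (hf : RespectsBelow n f) {P : Multiset WNode} {L : List (GraphPoly × Multiset WNode)}
    (h : LocalRule P L) (hw : IsWeb (N + P)) (hn : (N + P).card < n) :
    f (N + P) = combination f N L :=
  hf.step _ hw hn _ (Step.rule N P L h rfl)

end RespectsBelow

/-- A joint that continues an edge `x` can be absorbed at the node where `x` begins. -/
theorem absorb_out {N : Multiset WNode} {m : WNode} {x z : ℕ} (hx : x ∈ m.outs)
    (hw : IsWeb (N + {m, WNode.joint x z})) :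
    IsWeb (N + {m.relabel (Function.update id x z)}) ∧
      ∀ n f, RespectsBelow n f → N.card + 2 < n →
        f (N + {m, WNode.joint x z}) = f (N + {m.relabel (Function.update id x z)}) := by
  have hw' : IsWeb (N + {m} + {WNode.joint x z}) := by
    simpa [add_assoc, Multiset.singleton_add, Multiset.insert_eq_cons] using hw
  have hxz : x ≠ z := by
    rintro rfl
    exact hw'.not_mem_outs_of_right (x := x) (by simp [outsOf, WNode.outs])
      (by simp [outsOf, hx])
  have hN : relabelAll (Function.update id x z) N = N := by
    refine relabelAll_eq_self (fun y hy => ?_) fun y hy => ?_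
    · rw [Function.update_of_ne, id]
      rintro rfl
      exact hw.not_mem_ins_of_right (x := y) (by simp [insOf, WNode.ins]) hy
    · rw [Function.update_of_ne, id]
      rintro rfl
      exact hw.not_mem_outs_of_right (x := y) (by simp [outsOf, hx]) hy
  -- Erasing the joint keeps the name `x` and drops `z`, while the absorbed node should carry `z`.
  -- The exchange of the two names repairs this, which is why invariance under isomorphism is needed
  -- here.
  have hcomp : relabelAll (Equiv.swap x z) (relabelAll (Function.update id z x) (N + {m})) =
      N + {m.relabel (Function.update id x z)} := by
    rw [relabelAll_relabelAll, show (fun y => Equiv.swap x z (Function.update id z x y)) =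
      Function.update id x z from ?_]
    · rw [relabelAll, Multiset.map_add, ← relabelAll, hN, Multiset.map_singleton]
    · funext y
      by_cases h1 : y = z
      · subst h1
        simp [Function.update_of_ne hxz.symm]
      · by_cases h2 : y = x
        · subst h2
          simp [Function.update_of_ne h1]
        · simp [Function.update_of_ne h1, Function.update_of_ne h2,
            Equiv.swap_apply_of_ne_of_ne h2 h1]
  have hw1 := hw'.eraseJoint hxz
  refine ⟨hcomp ▸ hw1.relabelAll _, fun n f hf hn => ?_⟩
  have e : N + {m, WNode.joint x z} = N + {m} + {WNode.joint x z} := by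
    simp [add_assoc, Multiset.singleton_add, Multiset.insert_eq_cons]
  rw [e, hf.joint hw' (by simp; omega) hxz, ← hcomp, hf.iso _ hw1 (by simp; omega)]

/-- A joint that is continued by an edge `x` can be absorbed at the node where `x` ends. -/
theorem absorb_in {N : Multiset WNode} {m : WNode} {x z : ℕ} (hx : x ∈ m.ins)
    (hw : IsWeb (N + {m, WNode.joint z x})) :
    IsWeb (N + {m.relabel (Function.update id x z)}) ∧
      ∀ n f, RespectsBelow n f → N.card + 2 < n →
        f (N + {m, WNode.joint z x}) = f (N + {m.relabel (Function.update id x z)}) := by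
  have hw' : IsWeb (N + {m} + {WNode.joint z x}) := by
    simpa [add_assoc, Multiset.singleton_add, Multiset.insert_eq_cons] using hw
  have hxz : z ≠ x := by
    rintro rfl
    exact hw'.not_mem_ins_of_right (x := z) (by simp [insOf, WNode.ins])
      (by simp [insOf, hx])
  have hN : relabelAll (Function.update id x z) N = N := by
    refine relabelAll_eq_self (fun y hy => ?_) fun y hy => ?_
    · rw [Function.update_of_ne, id]
      rintro rfl
      exact hw.not_mem_ins_of_right (x := y) (by simp [insOf, hx]) hy
    · rw [Function.update_of_ne, id]
      rintro rfl
      exact hw.not_mem_outs_of_right (x := y) (by simp [outsOf, WNode.outs]) hy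
  have hcomp : relabelAll (Function.update id x z) (N + {m}) =
      N + {m.relabel (Function.update id x z)} := by
    rw [relabelAll, Multiset.map_add, ← relabelAll, hN, Multiset.map_singleton]
  have hw1 := hw'.eraseJoint hxz
  refine ⟨hcomp ▸ hw1, fun n f hf hn => ?_⟩
  have e : N + {m, WNode.joint z x} = N + {m} + {WNode.joint z x} := by
    simp [add_assoc, Multiset.singleton_add, Multiset.insert_eq_cons]
  rw [e, hf.joint hw' (by simp; omega) hxz, ← hcomp]

theorem A_add (m n : ℤ) : A (m + n) = A m * A n := by
  rw [A, LaurentPolynomial.T_add, map_mul, A, A]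

theorem A_zero : A 0 = 1 := by simp [A]


/-! ### Symbolic webs and their reduction -/

/-- A node with symbolic edge names. -/
inductive SNode where
  | source (a b c : ℕ)
  | sink (a b c : ℕ)
  | joint (a b : ℕ)
  deriving DecidableEq

/-- The three numbers in increasing order. -/
def sort3 (a b c : ℕ) : ℕ × ℕ × ℕ :=
  if a ≤ b then
    if b ≤ c then (a, b, c) else if a ≤ c then (a, c, b) else (c, a, b)
  else
    if a ≤ c then (b, a, c) else if b ≤ c then (b, c, a) else (c, b, a)

namespace SNode

/-- The node named by the values `σ` of the symbols. -/
def toNode (σ : ℕ → ℕ) : SNode → WNode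
  | source a b c => WNode.source {σ a, σ b, σ c}
  | sink a b c => WNode.sink {σ a, σ b, σ c}
  | joint a b => WNode.joint (σ a) (σ b)

/-- The symbols of the edges that end at a node. -/
def ins : SNode → List ℕ
  | source _ _ _ => []
  | sink a b c => [a, b, c]
  | joint a _ => [a]

/-- The symbols of the edges that begin at a node. -/
def outs : SNode → List ℕ
  | source a b c => [a, b, c]
  | sink _ _ _ => []
  | joint _ b => [b]

/-- Renaming of symbols. -/
def rename (ρ : ℕ → ℕ) : SNode → SNode
  | source a b c => source (ρ a) (ρ b) (ρ c)
  | sink a b c => sink (ρ a) (ρ b) (ρ c)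
  | joint a b => joint (ρ a) (ρ b)

/-- The same node with the edges listed in increasing order. -/
def normalize : SNode → SNode
  | source a b c => let t := sort3 a b c; source t.1 t.2.1 t.2.2
  | sink a b c => let t := sort3 a b c; sink t.1 t.2.1 t.2.2
  | joint a b => joint a b

/-- A number that determines a node with small symbols. -/
def code : SNode → ℕ
  | source a b c => ((a * 65536 + b) * 65536 + c) * 3
  | sink a b c => ((a * 65536 + b) * 65536 + c) * 3 + 1
  | joint a b => (a * 65536 + b) * 3 + 2

theorem triple_sort3 (σ : ℕ → ℕ) (a b c : ℕ) :
    ({σ (sort3 a b c).1, σ (sort3 a b c).2.1, σ (sort3 a b c).2.2} : Multiset ℕ) =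
      {σ a, σ b, σ c} := by
  unfold sort3
  split_ifs <;> simp only [Multiset.insert_eq_cons, ← Multiset.singleton_add] <;> abel

theorem toNode_normalize (σ : ℕ → ℕ) (n : SNode) : n.normalize.toNode σ = n.toNode σ := by
  cases n <;> simp only [normalize, toNode, triple_sort3]

theorem toNode_rename (σ ρ : ℕ → ℕ) (n : SNode) :
    (n.rename ρ).toNode σ = n.toNode (fun x => σ (ρ x)) := by
  cases n <;> rfl

theorem relabel_toNode (σ ρ : ℕ → ℕ) (n : SNode) :
    (n.toNode σ).relabel ρ = n.toNode (fun x => ρ (σ x)) := by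
  cases n <;> simp [toNode, WNode.relabel]

theorem ins_toNode (σ : ℕ → ℕ) (n : SNode) :
    (n.toNode σ).ins = ((n.ins : Multiset ℕ)).map σ := by
  cases n <;> rfl

theorem outs_toNode (σ : ℕ → ℕ) (n : SNode) :
    (n.toNode σ).outs = ((n.outs : Multiset ℕ)).map σ := by
  cases n <;> rfl

theorem toNode_congr {σ τ : ℕ → ℕ} {n : SNode} (hi : ∀ x ∈ n.ins, σ x = τ x)
    (ho : ∀ x ∈ n.outs, σ x = τ x) : n.toNode σ = n.toNode τ := by
  cases n <;> simp [ins, outs] at hi ho <;> simp [toNode, *]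

end SNode

/-- The nodes named by the values `σ` of the symbols. -/
def toNodes (σ : ℕ → ℕ) (L : List SNode) : Multiset WNode := ↑(L.map (SNode.toNode σ))

theorem toNodes_append (σ : ℕ → ℕ) (L M : List SNode) :
    toNodes σ (L ++ M) = toNodes σ L + toNodes σ M := by
  simp [toNodes]

theorem toNodes_cons (σ : ℕ → ℕ) (n : SNode) (M : List SNode) :
    toNodes σ (n :: M) = {n.toNode σ} + toNodes σ M := by
  simp [toNodes]

theorem toNodes_nil (σ : ℕ → ℕ) : toNodes σ [] = 0 := rfl

theorem card_toNodes (σ : ℕ → ℕ) (L : List SNode) : (toNodes σ L).card = L.length := by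
  simp [toNodes]

theorem toNodes_normalize (σ : ℕ → ℕ) (L : List SNode) :
    toNodes σ (L.map SNode.normalize) = toNodes σ L := by
  simp only [toNodes, List.map_map]
  congr 2
  funext n
  exact SNode.toNode_normalize σ n

theorem toNodes_perm (σ : ℕ → ℕ) {L M : List SNode} (h : L.Perm M) : toNodes σ L = toNodes σ M :=
  Multiset.coe_eq_coe.2 (h.map _)

theorem insOf_toNodes (σ : ℕ → ℕ) (L : List SNode) :
    insOf (toNodes σ L) = ((L.flatMap SNode.ins : List ℕ) : Multiset ℕ).map σ := by
  induction L with
  | nil => simp [toNodes]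
  | cons n L ih =>
    rw [toNodes_cons, insOf, Multiset.add_bind, ← insOf, ← insOf, ih]
    simp [insOf, SNode.ins_toNode]

theorem outsOf_toNodes (σ : ℕ → ℕ) (L : List SNode) :
    outsOf (toNodes σ L) = ((L.flatMap SNode.outs : List ℕ) : Multiset ℕ).map σ := by
  induction L with
  | nil => simp [toNodes]
  | cons n L ih =>
    rw [toNodes_cons, outsOf, Multiset.add_bind, ← outsOf, ← outsOf, ih]
    simp [outsOf, SNode.outs_toNode]

/-- A linear combination of symbolic webs: coefficient, exponent of `A`, web. -/
abbrev SLin : Type := List (ℤ × ℤ × List SNode)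

namespace SLin

/-- The value of a linear combination. -/
noncomputable def eval (F : List SNode → GraphPoly) (l : SLin) : GraphPoly :=
  (l.map fun t => (t.1 : GraphPoly) * A t.2.1 * F t.2.2).sum

/-- Multiplication by `c * A ^ e`. -/
def scale (c e : ℤ) (l : SLin) : SLin := l.map fun t => (c * t.1, e + t.2.1, t.2.2)

theorem eval_nil (F : List SNode → GraphPoly) : eval F [] = 0 := rfl

theorem eval_cons (F : List SNode → GraphPoly) (t : ℤ × ℤ × List SNode) (l : SLin) :
    eval F (t :: l) = (t.1 : GraphPoly) * A t.2.1 * F t.2.2 + eval F l := by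
  simp [eval]

theorem eval_append (F : List SNode → GraphPoly) (l m : SLin) :
    eval F (l ++ m) = eval F l + eval F m := by
  simp [eval]

theorem eval_scale (F : List SNode → GraphPoly) (c e : ℤ) (l : SLin) :
    eval F (scale c e l) = (c : GraphPoly) * A e * eval F l := by
  induction l with
  | nil => simp [scale, eval]
  | cons t l ih =>
    rw [scale, List.map_cons, ← scale, eval_cons, eval_cons, ih]
    simp only [A_add, Int.cast_mul]
    ring

theorem eval_map (F : List SNode → GraphPoly) (g : List SNode → List SNode) (l : SLin) :
    eval F (l.map fun t => (t.1, t.2.1, g t.2.2)) = eval (fun L => F (g L)) l := by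
  simp [eval, Function.comp_def]

theorem eval_congr {F G : List SNode → GraphPoly} {l : SLin} (h : ∀ t ∈ l, F t.2.2 = G t.2.2) :
    eval F l = eval G l := by
  unfold eval
  congr 1
  exact List.map_congr_left fun t ht => by rw [h t ht]

theorem eval_flatMap (F : List SNode → GraphPoly) (g : List SNode → SLin) (l : SLin) :
    eval F (l.flatMap fun t => scale t.1 t.2.1 (g t.2.2)) = eval (fun L => eval F (g L)) l := by
  induction l with
  | nil => simp only [List.flatMap_nil, eval_nil]
  | cons t l ih => rw [List.flatMap_cons, eval_append, eval_scale, ih, eval_cons]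

/-- Addition of one term. -/
def insertTerm (t : ℤ × ℤ × List SNode) : SLin → SLin
  | [] => [t]
  | u :: l => if u.2 = t.2 then (u.1 + t.1, u.2) :: l else u :: insertTerm t l

/-- Collection of equal terms. -/
def collect : SLin → SLin
  | [] => []
  | t :: l => insertTerm t (collect l)

theorem eval_insertTerm (F : List SNode → GraphPoly) (t : ℤ × ℤ × List SNode) (l : SLin) :
    eval F (insertTerm t l) = eval F (t :: l) := by
  induction l with
  | nil => rfl
  | cons u l ih =>
    rw [insertTerm]
    split_ifs with h
    · simp only [eval_cons, h, Int.cast_add]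
      ring
    · simp only [eval_cons, ih]
      ring

theorem eval_collect (F : List SNode → GraphPoly) (l : SLin) : eval F (collect l) = eval F l := by
  induction l with
  | nil => rfl
  | cons t l ih => rw [collect, eval_insertTerm, eval_cons, eval_cons, ih]

/-- The cancellation is purely formal: like terms are collected syntactically, so nothing about `F`
enters. -/
theorem eval_eq_zero (F : List SNode → GraphPoly) (l : SLin)
    (h : (collect l).all (fun t => t.1 = 0) = true) : eval F l = 0 := by
  rw [← eval_collect, eval]
  refine List.sum_eq_zero fun x hx => ?_
  obtain ⟨t, ht, rfl⟩ := List.mem_map.1 hx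
  have := List.all_eq_true.1 h t ht
  simp [of_decide_eq_true this]

end SLin

/-- The reductions of symbolic webs. -/
inductive SRule where
  | circle (a : ℕ)
  | fuse (a b c : ℕ)
  | absorbSource (x z u v : ℕ)
  | absorbSink (x z u v : ℕ)
  | bigon (e f x y : ℕ)
  | quad (e₁₁ e₁₂ e₂₁ e₂₂ x₁ x₂ y₁ y₂ : ℕ)

namespace SRule

open SNode

/-- The nodes to which a reduction applies. -/
def lhs : SRule → List SNode
  | circle a => [joint a a]
  | fuse a b c => [joint a b, joint b c]
  | absorbSource x z u v => [source x u v, joint x z]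
  | absorbSink x z u v => [sink x u v, joint z x]
  | bigon e f x y => [source e f x, sink e f y]
  | quad e₁₁ e₁₂ e₂₁ e₂₂ x₁ x₂ y₁ y₂ =>
      [source e₁₁ e₁₂ x₁, source e₂₁ e₂₂ x₂, sink e₁₁ e₂₁ y₁, sink e₁₂ e₂₂ y₂]

/-- The result of a reduction. -/
def rhs : SRule → SLin
  | circle _ => [(1, 6, []), (1, 0, []), (1, -6, [])]
  | fuse a _ c => [(1, 0, [joint a c])]
  | absorbSource _ z u v => [(1, 0, [source z u v])]
  | absorbSink _ z u v => [(1, 0, [sink z u v])]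
  | bigon _ _ x y => [(1, 3, [joint y x]), (1, -3, [joint y x])]
  | quad _ _ _ _ x₁ x₂ y₁ y₂ => [(1, 0, [joint y₁ x₁, joint y₂ x₂]), (1, 0, [joint y₁ x₂, joint y₂ x₁])]

/-- Joint rules come from `absorb_out` and `absorb_in`, the others from `LocalRule`. The first half
of the conclusion keeps the results webs of smaller size, so that reductions can be iterated below
the bound `n`. -/
theorem sound (r : SRule) (σ : ℕ → ℕ) (N : Multiset WNode) (hw : IsWeb (N + toNodes σ r.lhs)) :
    (∀ t ∈ r.rhs, IsWeb (N + toNodes σ t.2.2) ∧ t.2.2.length < r.lhs.length) ∧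
      ∀ n f, RespectsBelow n f → N.card + r.lhs.length < n →
        f (N + toNodes σ r.lhs) = SLin.eval (fun L => f (N + toNodes σ L)) r.rhs := by
  -- The other two edges at the absorbing vertex differ from the renamed one and therefore keep
  -- their names.
  have triple : ∀ {p q r : ℕ}, ({p, q, r} : Multiset ℕ).Nodup → q ≠ p ∧ r ≠ p := by
    intro p q r h
    have := Multiset.nodup_cons.1 h
    simp only [Multiset.insert_eq_cons, Multiset.mem_cons, Multiset.mem_singleton, not_or] at this
    exact ⟨Ne.symm this.1.1, Ne.symm this.1.2⟩
  cases r with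
  | circle a =>
    have e : toNodes σ [joint a a] = {WNode.joint (σ a) (σ a)} := rfl
    have h := LocalRule.circle (σ a)
    simp only [lhs, rhs, e] at hw ⊢
    refine ⟨fun t ht => ?_, fun n f hf hn => ?_⟩
    · have h0 := h.isWeb hw _ (List.mem_singleton_self _)
      simp only [List.mem_cons, List.not_mem_nil, or_false] at ht
      rcases ht with rfl | rfl | rfl <;> exact ⟨h0, by simp⟩
    · rw [hf.rule h hw (by simpa using hn)]
      simp [combination, SLin.eval, toNodes_nil, A_zero]
      ring
  | fuse a b c =>
    have e : toNodes σ [joint a b, joint b c] =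
      {WNode.joint (σ a) (σ b), WNode.joint (σ b) (σ c)} := rfl
    simp only [lhs, rhs, e] at hw ⊢
    have hab : σ a ≠ σ b := by
      have := hw.nodup
      simp only [insOf, Multiset.add_bind, Multiset.insert_eq_cons, Multiset.cons_bind,
        Multiset.singleton_bind, WNode.ins] at this
      simpa [Multiset.singleton_add] using (Multiset.nodup_add.1 this).2.1
    obtain ⟨h1, h2⟩ := absorb_out (by simp [WNode.outs]) hw
    have e' : (WNode.joint (σ a) (σ b)).relabel (Function.update id (σ b) (σ c)) =
        (joint a c).toNode σ := by
      simp [WNode.relabel, SNode.toNode, Function.update_of_ne hab]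
    rw [e'] at h1 h2
    refine ⟨fun t ht => ?_, fun n f hf hn => ?_⟩
    · obtain rfl := List.mem_singleton.1 ht
      exact ⟨h1, by simp⟩
    · rw [h2 n f hf hn]
      simp [SLin.eval, toNodes, A_zero]
  | absorbSource x z u v =>
    have e : toNodes σ [source x u v, joint x z] =
      {WNode.source {σ x, σ u, σ v}, WNode.joint (σ x) (σ z)} := rfl
    simp only [lhs, rhs, e] at hw ⊢
    have hne := triple (hw.nodup_outs_of_mem (n := WNode.source {σ x, σ u, σ v}) (by simp))
    obtain ⟨h1, h2⟩ := absorb_out (by simp [WNode.outs]) hw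
    have e' : (WNode.source {σ x, σ u, σ v}).relabel (Function.update id (σ x) (σ z)) =
        (source z u v).toNode σ := by
      simp [WNode.relabel, SNode.toNode, Function.update_of_ne hne.1, Function.update_of_ne hne.2]
    rw [e'] at h1 h2
    refine ⟨fun t ht => ?_, fun n f hf hn => ?_⟩
    · obtain rfl := List.mem_singleton.1 ht
      exact ⟨h1, by simp⟩
    · rw [h2 n f hf hn]
      simp [SLin.eval, toNodes, A_zero]
  | absorbSink x z u v =>
    have e : toNodes σ [sink x u v, joint z x] =
      {WNode.sink {σ x, σ u, σ v}, WNode.joint (σ z) (σ x)} := rfl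
    simp only [lhs, rhs, e] at hw ⊢
    have hne := triple (hw.nodup_ins_of_mem (n := WNode.sink {σ x, σ u, σ v}) (by simp))
    obtain ⟨h1, h2⟩ := absorb_in (by simp [WNode.ins]) hw
    have e' : (WNode.sink {σ x, σ u, σ v}).relabel (Function.update id (σ x) (σ z)) =
        (sink z u v).toNode σ := by
      simp [WNode.relabel, SNode.toNode, Function.update_of_ne hne.1, Function.update_of_ne hne.2]
    rw [e'] at h1 h2
    refine ⟨fun t ht => ?_, fun n f hf hn => ?_⟩
    · obtain rfl := List.mem_singleton.1 ht
      exact ⟨h1, by simp⟩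
    · rw [h2 n f hf hn]
      simp [SLin.eval, toNodes, A_zero]
  | bigon p q x y =>
    have e : toNodes σ [source p q x, sink p q y] =
      KuperbergBracket.bigon (σ p) (σ q) (σ x) (σ y) := rfl
    have h := LocalRule.bigon (σ p) (σ q) (σ x) (σ y)
    simp only [lhs, rhs, e] at hw ⊢
    refine ⟨fun t ht => ?_, fun n f hf hn => ?_⟩
    · have h0 := h.isWeb hw _ (List.mem_singleton_self _)
      simp only [List.mem_cons, List.not_mem_nil, or_false] at ht
      rcases ht with rfl | rfl <;> exact ⟨h0, by simp⟩
    · rw [hf.rule h hw (by simpa [KuperbergBracket.bigon] using hn)]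
      simp [combination, SLin.eval, toNodes, SNode.toNode]
      ring
  | quad e₁₁ e₁₂ e₂₁ e₂₂ x₁ x₂ y₁ y₂ =>
    have e : toNodes σ
        [source e₁₁ e₁₂ x₁, source e₂₁ e₂₂ x₂, sink e₁₁ e₂₁ y₁, sink e₁₂ e₂₂ y₂] =
      KuperbergBracket.quad (σ e₁₁) (σ e₁₂) (σ e₂₁) (σ e₂₂) (σ x₁) (σ x₂) (σ y₁) (σ y₂) := rfl
    have h := LocalRule.quad (σ e₁₁) (σ e₁₂) (σ e₂₁) (σ e₂₂) (σ x₁) (σ x₂) (σ y₁) (σ y₂)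
    simp only [lhs, rhs, e] at hw ⊢
    refine ⟨fun t ht => ?_, fun n f hf hn => ?_⟩
    · have h0 := h.isWeb hw
      simp only [List.mem_cons, List.not_mem_nil, or_false] at ht
      rcases ht with rfl | rfl
      · exact ⟨h0 _ List.mem_cons_self, by simp⟩
      · exact ⟨h0 _ (List.mem_cons_of_mem _ (List.mem_singleton_self _)), by simp⟩
    · rw [hf.rule h hw (by simpa [KuperbergBracket.quad] using hn)]
      have e' : ∀ a b c d, toNodes σ [joint a b, joint c d] =
        {WNode.joint (σ a) (σ b), WNode.joint (σ c) (σ d)} := fun _ _ _ _ => rfl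
      simp only [combination, SLin.eval, e', A_zero, List.map_cons, List.map_nil, Int.cast_one,
        one_mul]

end SRule

/-! ### Search for reductions and certified symbolic rewriting -/

/-- All ways to take one element out of a list. -/
def picks {α : Type*} : List α → List (α × List α)
  | [] => []
  | x :: l => (x, l) :: (picks l).map fun p => (p.1, x :: p.2)

/-- The orderings of three numbers. -/
def orderings (a b c : ℕ) : List (ℕ × ℕ × ℕ) :=
  [(a, b, c), (a, c, b), (b, a, c), (b, c, a), (c, a, b), (c, b, a)]

namespace SNode

/-- The orderings of the edges of a source. -/
def sourceOrderings : SNode → List (ℕ × ℕ × ℕ)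
  | source a b c => orderings a b c
  | _ => []

/-- The orderings of the edges of a sink. -/
def sinkOrderings : SNode → List (ℕ × ℕ × ℕ)
  | sink a b c => orderings a b c
  | _ => []

/-- The name of a node without its internal edges. -/
def boundaryCode (n : SNode) : ℕ :=
  ((n.ins ++ n.outs).map fun b => if b < 100 then 2 ^ b else 0).sum

end SNode

/-- A search for a joint that can be removed. -/
def findJoint (L : List SNode) : Option (SRule × List SNode) :=
  (picks L).findSome? fun p => match p.1 with
    | SNode.joint a b =>
      if a = b then some (SRule.circle a, p.2) else
      (picks p.2).findSome? fun q => match q.1 with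
        | SNode.joint c d =>
          if d = a then some (SRule.fuse c a b, q.2)
          else if c = b then some (SRule.fuse a b d, q.2) else none
        | SNode.source u v w => (orderings u v w).findSome? fun t =>
          if t.1 = a then some (SRule.absorbSource a b t.2.1 t.2.2, q.2) else none
        | SNode.sink u v w => (orderings u v w).findSome? fun t =>
          if t.1 = b then some (SRule.absorbSink b a t.2.1 t.2.2, q.2) else none
    | _ => none

/-- A search for a bigon. -/
def findBigon (L : List SNode) : Option (SRule × List SNode) :=
  (picks L).findSome? fun p => p.1.sourceOrderings.findSome? fun s =>
    (picks p.2).findSome? fun q => q.1.sinkOrderings.findSome? fun t =>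
      if s.1 = t.1 ∧ s.2.1 = t.2.1 then some (SRule.bigon s.1 s.2.1 s.2.2 t.2.2, q.2) else none

/-- A search for a quadrilateral. -/
def findQuad (L : List SNode) : Option (SRule × List SNode) :=
  (picks L).findSome? fun p => p.1.sourceOrderings.findSome? fun s =>
    (picks p.2).findSome? fun q => q.1.sinkOrderings.findSome? fun t =>
      if s.1 = t.1 then
        (picks q.2).findSome? fun q' => q'.1.sinkOrderings.findSome? fun t' =>
          if s.2.1 = t'.1 then
            (picks q'.2).findSome? fun p' => p'.1.sourceOrderings.findSome? fun s' =>
              if s'.1 = t.2.1 ∧ s'.2.1 = t'.2.1 then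
                some (SRule.quad s.1 s.2.1 s'.1 s'.2.1 s.2.2 s'.2.2 t.2.2 t'.2.2, p'.2)
              else none
          else none
      else none

/-- A search for a reduction. -/
def findRule (L : List SNode) : Option (SRule × List SNode) :=
  match findJoint L with
  | some r => some r
  | none => match findBigon L with
    | some r => some r
    | none => findQuad L

/-- One reduction of a symbolic web. -/
def reduceOnce (L : List SNode) : Option SLin :=
  match findRule L with
  | none => none
  | some (r, rest) =>
    -- The search is not trusted: its answer counts only if the pattern and the remaining nodes
    -- together are a permutation of `L`. No correctness proof for the search is therefore required.
    if ((r.lhs ++ rest).map SNode.normalize).isPerm (L.map SNode.normalize) then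
      some (r.rhs.map fun t => (t.1, t.2.1, t.2.2 ++ rest))
    else none

/-- At most `k` consecutive reductions of a symbolic web. -/
def reduce : ℕ → List SNode → SLin
  | 0, L => [(1, 0, L)]
  | k + 1, L => match reduceOnce L with
    | none => [(1, 0, L)]
    | some l => l.flatMap fun t => SLin.scale t.1 t.2.1 (reduce k t.2.2)

theorem reduceOnce_sound {L : List SNode} {l : SLin} (h : reduceOnce L = some l) (σ : ℕ → ℕ)
    (N : Multiset WNode) (hw : IsWeb (N + toNodes σ L)) :
    (∀ t ∈ l, IsWeb (N + toNodes σ t.2.2) ∧ t.2.2.length < L.length) ∧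
      ∀ n f, RespectsBelow n f → N.card + L.length < n →
        f (N + toNodes σ L) = SLin.eval (fun L => f (N + toNodes σ L)) l := by
  unfold reduceOnce at h
  split at h
  · simp at h
  · rename_i r rest _
    split_ifs at h with hp
    obtain rfl := Option.some.inj h
    have hp := List.isPerm_iff.1 hp
    have hlen : r.lhs.length + rest.length = L.length := by simpa using hp.length_eq
    have hL : toNodes σ L = toNodes σ rest + toNodes σ r.lhs := by
      rw [← toNodes_normalize σ L, ← toNodes_perm σ hp, toNodes_normalize, toNodes_append, add_comm]
    have key : ∀ M, N + toNodes σ rest + toNodes σ M = N + toNodes σ (M ++ rest) := fun M => by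
      rw [toNodes_append, add_assoc, add_comm (toNodes σ M)]
    rw [hL, ← add_assoc] at hw ⊢
    obtain ⟨h1, h2⟩ := r.sound σ _ hw
    refine ⟨fun t ht => ?_, fun n f hf hn => ?_⟩
    · obtain ⟨u, hu, rfl⟩ := List.mem_map.1 ht
      have := h1 u hu
      rw [key] at this
      exact ⟨this.1, by simp only [List.length_append]; omega⟩
    · rw [h2 n f hf (by rw [Multiset.card_add, card_toNodes]; omega),
        SLin.eval_map (fun L => f (N + toNodes σ L)) (fun M => M ++ rest)]
      simp only [key]

/-- Valid for every fuel `k`: stopping early leaves a term unreduced but does not change the sum. -/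
theorem reduce_sound (k : ℕ) {L : List SNode} (σ : ℕ → ℕ) (N : Multiset WNode)
    (hw : IsWeb (N + toNodes σ L)) :
    (∀ t ∈ reduce k L, IsWeb (N + toNodes σ t.2.2) ∧ t.2.2.length ≤ L.length) ∧
      ∀ n f, RespectsBelow n f → N.card + L.length < n →
        f (N + toNodes σ L) = SLin.eval (fun L => f (N + toNodes σ L)) (reduce k L) := by
  have base : ∀ {M : List SNode}, IsWeb (N + toNodes σ M) → (∀ t ∈ [((1 : ℤ), (0 : ℤ), M)],
      IsWeb (N + toNodes σ t.2.2) ∧ t.2.2.length ≤ M.length) ∧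
      ∀ n f, RespectsBelow n f → N.card + M.length < n →
        f (N + toNodes σ M) = SLin.eval (fun L => f (N + toNodes σ L)) [(1, 0, M)] :=
    fun hM => ⟨fun t ht => by obtain rfl := List.mem_singleton.1 ht; exact ⟨hM, le_rfl⟩,
      fun n f _ _ => by simp [SLin.eval, A_zero]⟩
  induction k generalizing L with
  | zero => exact base hw
  | succ k ih =>
    rw [reduce]
    split
    · exact base hw
    · rename_i l hl
      obtain ⟨h1, h2⟩ := reduceOnce_sound hl σ N hw
      refine ⟨fun t ht => ?_, fun n f hf hn => ?_⟩
      · obtain ⟨u, hu, ht⟩ := List.mem_flatMap.1 ht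
        obtain ⟨t', ht', rfl⟩ := List.mem_map.1 ht
        have := (ih (h1 u hu).1).1 t' ht'
        exact ⟨this.1, this.2.trans (h1 u hu).2.le⟩
      · rw [h2 n f hf hn, SLin.eval_flatMap]
        refine SLin.eval_congr fun t ht => ?_
        have := (h1 t ht).2
        exact (ih (h1 t ht).1).2 n f hf (by omega)


/-! ### Comparison of symbolic webs up to the names of internal edges -/

/-- A bijection between two finite sets extends to a permutation that fixes everything else. -/
theorem exists_perm_extending {I : Finset ℕ} {σ τ : ℕ → ℕ} (hσ : Set.InjOn σ I)
    (hτ : Set.InjOn τ I) : ∃ π : Equiv.Perm ℕ, (∀ k ∈ I, π (σ k) = τ k) ∧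
      ∀ x, x ∉ I.image σ → x ∉ I.image τ → π x = x := by
  classical
  set U : Finset ℕ := I.image σ ∪ I.image τ with hU
  obtain ⟨e, he⟩ : ∃ e : {x // x ∈ I.image σ} ≃ {x // x ∈ I.image τ},
      ∀ k (hk : k ∈ I), (e ⟨σ k, Finset.mem_image_of_mem σ hk⟩ : ℕ) = τ k := by
    have b1 : Function.Bijective fun k : {x // x ∈ I} =>
        (⟨σ k, Finset.mem_image_of_mem σ k.2⟩ : {x // x ∈ I.image σ}) := by
      refine ⟨fun k l h => Subtype.ext (hσ k.2 l.2 (by simpa using h)), fun ⟨y, hy⟩ => ?_⟩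
      obtain ⟨k, hk, rfl⟩ := Finset.mem_image.1 hy
      exact ⟨⟨k, hk⟩, rfl⟩
    have b2 : Function.Bijective fun k : {x // x ∈ I} =>
        (⟨τ k, Finset.mem_image_of_mem τ k.2⟩ : {x // x ∈ I.image τ}) := by
      refine ⟨fun k l h => Subtype.ext (hτ k.2 l.2 (by simpa using h)), fun ⟨y, hy⟩ => ?_⟩
      obtain ⟨k, hk, rfl⟩ := Finset.mem_image.1 hy
      exact ⟨⟨k, hk⟩, rfl⟩
    refine ⟨(Equiv.ofBijective _ b1).symm.trans (Equiv.ofBijective _ b2), fun k hk => ?_⟩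
    have : (Equiv.ofBijective _ b1).symm ⟨σ k, Finset.mem_image_of_mem σ hk⟩ = ⟨k, hk⟩ :=
      (Equiv.symm_apply_eq _).2 rfl
    rw [Equiv.trans_apply, this]
    rfl
  -- Both images are subsets of the finite set `U`, so the bijection between them extends to a
  -- permutation of `U`, and by the identity to all of ℕ.
  let e' : {x : {x // x ∈ U} // (x : ℕ) ∈ I.image σ} ≃ {x : {x // x ∈ U} // (x : ℕ) ∈ I.image τ} :=
    ⟨fun x => ⟨⟨e ⟨x.1, x.2⟩, Finset.mem_union_right _ (e ⟨x.1, x.2⟩).2⟩, (e ⟨x.1, x.2⟩).2⟩,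
      fun x => ⟨⟨e.symm ⟨x.1, x.2⟩, Finset.mem_union_left _ (e.symm ⟨x.1, x.2⟩).2⟩,
        (e.symm ⟨x.1, x.2⟩).2⟩, fun x => by simp, fun x => by simp⟩
  refine ⟨Equiv.Perm.ofSubtype e'.extendSubtype, fun k hk => ?_, fun x h1 h2 => ?_⟩
  · have hm := Finset.mem_image_of_mem σ hk
    have hm' : σ k ∈ U := Finset.mem_union_left _ hm
    rw [Equiv.Perm.ofSubtype_apply_of_mem _ hm',
      Equiv.extendSubtype_apply_of_mem e' ⟨σ k, hm'⟩ hm]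
    exact he k hk
  · exact Equiv.Perm.ofSubtype_apply_of_not_mem _ (by simp only [hU, Finset.mem_union]; tauto)

/-- Every symbol from `100` on names an edge with both ends in the web. -/
def internalsClosed (L : List SNode) : Bool :=
  L.all fun n => (n.ins ++ n.outs).all fun x =>
    x < 100 || ((L.flatMap SNode.ins).contains x && (L.flatMap SNode.outs).contains x)

/-- The value of a web does not depend on the names of its internal edges. -/
theorem value_congr {n : ℕ} {f : Multiset WNode → GraphPoly} (hf : RespectsBelow n f)
    {N : Multiset WNode} {L : List SNode} {σ τ : ℕ → ℕ} (hL : internalsClosed L = true)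
    (hστ : ∀ k < 100, σ k = τ k) (hσ : IsWeb (N + toNodes σ L)) (hτ : IsWeb (N + toNodes τ L))
    (hn : N.card + L.length < n) : f (N + toNodes σ L) = f (N + toNodes τ L) := by
  have inj : ∀ {σ : ℕ → ℕ}, IsWeb (N + toNodes σ L) →
      (∀ x ∈ L.flatMap SNode.ins, ∀ y ∈ L.flatMap SNode.ins, σ x = σ y → x = y) ∧
      (∀ x ∈ L.flatMap SNode.outs, ∀ y ∈ L.flatMap SNode.outs, σ x = σ y → x = y) := by
    intro σ h
    have h1 := h.nodup
    have h2 := h.nodup_outs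
    rw [insOf, Multiset.add_bind, ← insOf, ← insOf, insOf_toNodes] at h1
    rw [outsOf, Multiset.add_bind, ← outsOf, ← outsOf, outsOf_toNodes] at h2
    have h1 := (Multiset.nodup_add.1 h1).2.1
    have h2 := (Multiset.nodup_add.1 h2).2.1
    exact ⟨fun x hx y hy e => Multiset.inj_on_of_nodup_map h1 x hx y hy e,
      fun x hx y hy e => Multiset.inj_on_of_nodup_map h2 x hx y hy e⟩
  have hmem : ∀ x, (x ∈ L.flatMap SNode.ins ∨ x ∈ L.flatMap SNode.outs) → 100 ≤ x →
      x ∈ L.flatMap SNode.ins ∧ x ∈ L.flatMap SNode.outs := by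
    intro x hx h100
    obtain ⟨m, hm, hxm⟩ : ∃ m ∈ L, x ∈ m.ins ++ m.outs := by
      rcases hx with hx | hx <;> obtain ⟨m, hm, h⟩ := List.mem_flatMap.1 hx <;>
        exact ⟨m, hm, by simp [h]⟩
    have := List.all_eq_true.1 (List.all_eq_true.1 hL m hm) x hxm
    simp only [Bool.or_eq_true, decide_eq_true_eq, Bool.and_eq_true, List.contains_iff_mem] at this
    exact this.resolve_left (by omega)
  set I : Finset ℕ := (L.flatMap SNode.ins).toFinset.filter (100 ≤ ·) with hI
  have hIin : ∀ k ∈ I, k ∈ L.flatMap SNode.ins ∧ k ∈ L.flatMap SNode.outs ∧ 100 ≤ k := by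
    intro k hk
    simp only [hI, Finset.mem_filter, List.mem_toFinset] at hk
    exact ⟨hk.1, (hmem k (Or.inl hk.1) hk.2).2, hk.2⟩
  obtain ⟨π, hπ, hfix⟩ := exists_perm_extending (I := I) (σ := σ) (τ := τ)
    (fun x hx y hy e => (inj hσ).1 x (hIin x hx).1 y (hIin y hy).1 e)
    (fun x hx y hy e => (inj hτ).1 x (hIin x hx).1 y (hIin y hy).1 e)
  -- Both ends of an internal edge lie in `L`, so its name does not occur in `N`, and `π` leaves `N`
  -- alone.
  have hNot : ∀ {σ : ℕ → ℕ}, IsWeb (N + toNodes σ L) → ∀ x, (x ∈ insOf N ∨ x ∈ outsOf N) →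
      x ∉ I.image σ := by
    intro σ h x hx hxI
    obtain ⟨k, hk, rfl⟩ := Finset.mem_image.1 hxI
    rcases hx with hx | hx
    · refine h.not_mem_ins_of_right ?_ hx
      rw [insOf_toNodes]
      exact Multiset.mem_map_of_mem σ (hIin k hk).1
    · refine h.not_mem_outs_of_right ?_ hx
      rw [outsOf_toNodes]
      exact Multiset.mem_map_of_mem σ (hIin k hk).2.1
  -- An internal symbol occurs both as an incoming and as an outgoing one, so injectivity on
  -- whichever list contains the boundary symbol keeps the two names apart.
  have hBd : ∀ {σ : ℕ → ℕ}, IsWeb (N + toNodes σ L) → ∀ x,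
      (x ∈ L.flatMap SNode.ins ∨ x ∈ L.flatMap SNode.outs) → x < 100 → σ x ∉ I.image σ := by
    intro σ h x hx h100 hxI
    obtain ⟨k, hk, e⟩ := Finset.mem_image.1 hxI
    have h3 := hIin k hk
    rcases hx with hx | hx
    · have := (inj h).1 k h3.1 x hx e
      omega
    · have := (inj h).2 k h3.2.1 x hx e
      omega
  have hmap : ∀ x, (x ∈ L.flatMap SNode.ins ∨ x ∈ L.flatMap SNode.outs) → π (σ x) = τ x := by
    intro x hx
    by_cases h : x < 100
    · rw [hfix (σ x) (hBd hσ x hx h) (by rw [hστ x h]; exact hBd hτ x hx h), hστ x h]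
    · have h := hmem x hx (by omega)
      exact hπ x (by simp only [hI, Finset.mem_filter, List.mem_toFinset]; exact ⟨h.1, by omega⟩)
  rw [← hf.iso _ hσ (by rw [Multiset.card_add, card_toNodes]; exact hn) π]
  congr 1
  rw [relabelAll, Multiset.map_add, ← relabelAll, relabelAll_eq_self
    (fun x hx => hfix x (hNot hσ x (Or.inl hx)) (hNot hτ x (Or.inl hx)))
    (fun x hx => hfix x (hNot hσ x (Or.inr hx)) (hNot hτ x (Or.inr hx)))]
  congr 1
  simp only [toNodes, Multiset.map_coe, List.map_map]
  congr 1
  refine List.map_congr_left fun m hm => ?_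
  rw [Function.comp_apply, SNode.relabel_toNode]
  exact SNode.toNode_congr (fun x hx => hmap x (Or.inl (List.mem_flatMap.2 ⟨m, hm, hx⟩)))
    (fun x hx => hmap x (Or.inr (List.mem_flatMap.2 ⟨m, hm, hx⟩)))

/-- The permutation that performs a list of exchanges of internal symbols. -/
def internalPerm : List (ℕ × ℕ) → Equiv.Perm ℕ
  | [] => 1
  | p :: l => if 100 ≤ p.1 ∧ 100 ≤ p.2 then (internalPerm l).trans (Equiv.swap p.1 p.2) else internalPerm l

/-- Whatever renaming is proposed, it acts as a permutation that fixes the boundary. The choice made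
in `internalNames` thus affects only the success of the comparison, never its soundness. -/
theorem internalPerm_symm_of_lt (l : List (ℕ × ℕ)) {k : ℕ} (hk : k < 100) :
    (internalPerm l).symm k = k := by
  rw [Equiv.symm_apply_eq]
  induction l with
  | nil => rfl
  | cons p l ih =>
    rw [internalPerm]
    split_ifs with h
    · rw [Equiv.trans_apply, ← ih, Equiv.swap_apply_of_ne_of_ne (by omega) (by omega)]
    · exact ih

/-- New names for the internal edges, determined by the neighbouring boundary edges. -/
def internalNames (L : List SNode) : List (ℕ × ℕ) :=
  (L.flatMap SNode.outs).filterMap fun x => if x < 100 then none else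
    -- The boundary legs at the end nodes of an edge, encoded by powers of two, serve as a name that
    -- does not depend on how the edge was called. The offset 1000 avoids the symbols used in the
    -- tangles.
    some (x, 1000 + (L.map fun n => if x ∈ n.ins ++ n.outs then n.boundaryCode else 0).sum)

/-- A symbolic web with standard names for the internal edges and with its nodes in order. -/
def canonical (L : List SNode) : List SNode :=
  ((L.map (SNode.rename (internalPerm (internalNames L)))).map SNode.normalize).insertionSort
    -- The code is only a sorting key; the result is a permutation of the nodes even if two codes
    -- should coincide.
    fun m n => m.code ≤ n.code

theorem toNodes_canonical (σ : ℕ → ℕ) (L : List SNode) :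
    toNodes (fun x => σ ((internalPerm (internalNames L)).symm x)) (canonical L) = toNodes σ L := by
  rw [canonical, toNodes_perm _ (List.perm_insertionSort _ _), toNodes_normalize]
  simp only [toNodes, List.map_map]
  congr 2
  funext n
  rw [Function.comp_apply, SNode.toNode_rename]
  simp

theorem length_canonical (L : List SNode) : (canonical L).length = L.length := by
  simp [canonical]

open Classical in
/-- The value of a symbolic web, independent of the values of the internal symbols. -/
noncomputable def boundaryValue (f : Multiset WNode → GraphPoly) (N : Multiset WNode) (σ : ℕ → ℕ)
    (L : List SNode) : GraphPoly :=
  if h : ∃ τ : ℕ → ℕ, (∀ k < 100, τ k = σ k) ∧ IsWeb (N + toNodes τ L) then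
    f (N + toNodes h.choose L) else 0

/-- By `value_congr` the chosen assignment of internal names is immaterial. The valid assignment `τ`
rules out the default value 0. -/
theorem boundaryValue_eq {n : ℕ} {f : Multiset WNode → GraphPoly} (hf : RespectsBelow n f)
    {N : Multiset WNode} {L : List SNode} {σ τ : ℕ → ℕ} (hL : internalsClosed L = true)
    (hτσ : ∀ k < 100, τ k = σ k) (hτ : IsWeb (N + toNodes τ L))
    (hn : N.card + L.length < n) : boundaryValue f N σ L = f (N + toNodes τ L) := by
  have h : ∃ τ : ℕ → ℕ, (∀ k < 100, τ k = σ k) ∧ IsWeb (N + toNodes τ L) := ⟨τ, hτσ, hτ⟩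
  rw [boundaryValue, dif_pos h]
  exact value_congr hf hL (fun k hk => (h.choose_spec.1 k hk).trans (hτσ k hk).symm)
    h.choose_spec.2 hτ hn

namespace SLin

/-- Reduction of all terms to a standard form. -/
def standardize (l : SLin) : SLin :=
  -- Every reduction removes a node, and the webs compared below have at most six nodes, so the fuel
  -- 20 is never exhausted.
  (l.flatMap fun t => scale t.1 t.2.1 (reduce 20 t.2.2)).map fun t =>
    (t.1, t.2.1, canonical t.2.2)

/-- A sufficient criterion for two linear combinations to have the same value. -/
def agree (l r : SLin) : Bool :=
  let m := l.standardize ++ scale (-1) 0 r.standardize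
  m.all (fun t => internalsClosed t.2.2) && (collect m).all fun t => t.1 = 0

/-- All terms of a linear combination are webs with fewer than `n` nodes. -/
def Valid (n : ℕ) (N : Multiset WNode) (σ : ℕ → ℕ) (l : SLin) : Prop :=
  ∀ t ∈ l, IsWeb (N + toNodes σ t.2.2) ∧ N.card + t.2.2.length < n

theorem eval_standardize {n : ℕ} {f : Multiset WNode → GraphPoly} (hf : RespectsBelow n f)
    {N : Multiset WNode} {l : SLin} {σ τ : ℕ → ℕ} (hτσ : ∀ k < 100, τ k = σ k)
    (hl : l.Valid n N τ) (hc : ∀ t ∈ l.standardize, internalsClosed t.2.2 = true) :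
    eval (boundaryValue f N σ) l.standardize = eval (fun L => f (N + toNodes τ L)) l := by
  have h1 : eval (fun L => f (N + toNodes τ L)) l = eval (fun L => f (N + toNodes τ L))
      (l.flatMap fun t => scale t.1 t.2.1 (reduce 20 t.2.2)) := by
    rw [eval_flatMap]
    exact eval_congr fun t ht => (reduce_sound 20 τ N (hl t ht).1).2 n f hf (hl t ht).2
  rw [h1, standardize, eval_map]
  refine eval_congr fun t ht => ?_
  have hcl := hc _ (List.mem_map_of_mem (f := fun t : ℤ × ℤ × List SNode =>
    (t.1, t.2.1, canonical t.2.2)) ht)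
  obtain ⟨u, hu, ht⟩ := List.mem_flatMap.1 ht
  obtain ⟨v, hv, rfl⟩ := List.mem_map.1 ht
  have hw := (reduce_sound 20 τ N (hl u hu).1).1 v hv
  have hu' := (hl u hu).2
  dsimp only at hcl ⊢
  rw [← toNodes_canonical τ v.2.2] at hw ⊢
  exact boundaryValue_eq hf hcl
    (fun k hk => by rw [internalPerm_symm_of_lt _ hk, hτσ k hk]) hw.1
    (by rw [length_canonical]; omega)

/-- The assignments `σ` and `τ` may disagree on internal symbols. Since `boundaryValue` looks only
at the boundary, it evaluates both sides by one common function, to which formal cancellation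
applies. -/
theorem eval_eq_of_agree {n : ℕ} {f : Multiset WNode → GraphPoly} (hf : RespectsBelow n f)
    {N : Multiset WNode} {l r : SLin} {σ τ : ℕ → ℕ} (h : agree l r = true)
    (hτσ : ∀ k < 100, τ k = σ k) (hl : l.Valid n N σ) (hr : r.Valid n N τ) :
    eval (fun L => f (N + toNodes σ L)) l = eval (fun L => f (N + toNodes τ L)) r := by
  obtain ⟨h1, h2⟩ := (Bool.and_eq_true _ _).mp h
  have h1 := List.all_eq_true.1 h1
  rw [← eval_standardize hf (σ := σ) (τ := σ) (fun _ _ => rfl) hl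
      (fun t ht => h1 t (List.mem_append_left _ ht)),
    ← eval_standardize hf hτσ hr (fun t ht => h1 (-1 * t.1, 0 + t.2.1, t.2.2)
      (List.mem_append_right _ (List.mem_map_of_mem (f := fun t : ℤ × ℤ × List SNode =>
        (-1 * t.1, 0 + t.2.1, t.2.2)) ht)))]
  have := eval_eq_zero (boundaryValue f N σ) _ h2
  rw [eval_append, eval_scale, A_zero, Int.cast_neg, Int.cast_one] at this
  linear_combination this

end SLin


/-! ### Local confluence of overlapping reductions -/

theorem pair_cases {a b c d : ℕ} (h : ({a, b} : Multiset ℕ) = {c, d}) :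
    (a = c ∧ b = d) ∨ (a = d ∧ b = c) := by
  have ha : a = c ∨ a = d := by
    have : a ∈ ({c, d} : Multiset ℕ) := h ▸ by simp
    simpa using this
  rcases ha with rfl | rfl
  · exact Or.inl ⟨rfl, by simpa [Multiset.insert_eq_cons] using h⟩
  · rw [Multiset.pair_comm c] at h
    exact Or.inr ⟨rfl, by simpa [Multiset.insert_eq_cons] using h⟩

/-- Pigeonhole at a trivalent vertex: two of three edges cannot avoid two others. Patterns with a
common vertex therefore have a common edge. -/
theorem pair_meet {a b c a' b' c' : ℕ} (h : ({a, b, c} : Multiset ℕ) = {a', b', c'})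
    (hab : a ≠ b) : ∃ x, (x = a ∨ x = b) ∧ (x = a' ∨ x = b') := by
  have ha : a ∈ ({a', b', c'} : Multiset ℕ) := h ▸ by simp
  have hb : b ∈ ({a', b', c'} : Multiset ℕ) := h ▸ by simp
  simp only [Multiset.insert_eq_cons, Multiset.mem_cons, Multiset.mem_singleton] at ha hb
  rcases ha with ha | ha | ha
  · exact ⟨a, by simp, by simp [ha]⟩
  · exact ⟨a, by simp, by simp [ha]⟩
  · rcases hb with hb | hb | hb
    · exact ⟨b, by simp, by simp [hb]⟩
    · exact ⟨b, by simp, by simp [hb]⟩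
    · exact absurd (ha.trans hb.symm) hab

theorem ne_of_nodup_triple {a b c : ℕ} (h : ({a, b, c} : Multiset ℕ).Nodup) :
    a ≠ b ∧ a ≠ c ∧ b ≠ c := by
  simpa [Multiset.insert_eq_cons, not_or, and_assoc] using h

theorem triple_swap_left (a b c : ℕ) : ({a, b, c} : Multiset ℕ) = {b, a, c} := by
  simp only [Multiset.insert_eq_cons, Multiset.cons_swap]

theorem triple_swap_right (a b c : ℕ) : ({a, b, c} : Multiset ℕ) = {a, c, b} := by
  rw [Multiset.insert_eq_cons, Multiset.pair_comm, ← Multiset.insert_eq_cons]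

theorem quad_eq_add (a b c d x₁ x₂ y₁ y₂ : ℕ) : quad a b c d x₁ x₂ y₁ y₂ =
    {WNode.source {a, b, x₁}} + {WNode.source {c, d, x₂}} + {WNode.sink {a, c, y₁}} +
      {WNode.sink {b, d, y₂}} := by
  simp only [quad, Multiset.insert_eq_cons, ← Multiset.singleton_add, add_assoc]

theorem bigon_eq_add (a b x y : ℕ) : bigon a b x y =
    {WNode.source {a, b, x}} + {WNode.sink {a, b, y}} := by
  simp only [bigon, Multiset.insert_eq_cons, ← Multiset.singleton_add]

/-- The two ways to continue the four legs of a quadrilateral. -/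
noncomputable def quadValue (f : Multiset WNode → GraphPoly) (N : Multiset WNode)
    (x₁ x₂ y₁ y₂ : ℕ) : GraphPoly :=
  f (N + {WNode.joint y₁ x₁, WNode.joint y₂ x₂}) + f (N + {WNode.joint y₁ x₂, WNode.joint y₂ x₁})

theorem quadValue_swap_source (f : Multiset WNode → GraphPoly) (N : Multiset WNode)
    (x₁ x₂ y₁ y₂ : ℕ) : quadValue f N x₁ x₂ y₁ y₂ = quadValue f N x₂ x₁ y₁ y₂ := by
  rw [quadValue, quadValue, add_comm]

theorem quadValue_swap_sink (f : Multiset WNode → GraphPoly) (N : Multiset WNode)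
    (x₁ x₂ y₁ y₂ : ℕ) : quadValue f N x₁ x₂ y₁ y₂ = quadValue f N x₁ x₂ y₂ y₁ := by
  rw [quadValue, quadValue, add_comm, Multiset.pair_comm (WNode.joint y₁ x₂),
    Multiset.pair_comm (WNode.joint y₁ x₁)]

theorem quad_swap_source (a b c d x₁ x₂ y₁ y₂ : ℕ) :
    quad a b c d x₁ x₂ y₁ y₂ = quad c d a b x₂ x₁ y₁ y₂ := by
  rw [quad_eq_add, quad_eq_add, triple_swap_left a c, triple_swap_left b d]
  abel

theorem quad_swap_sink (a b c d x₁ x₂ y₁ y₂ : ℕ) :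
    quad a b c d x₁ x₂ y₁ y₂ = quad b a d c x₁ x₂ y₂ y₁ := by
  rw [quad_eq_add, quad_eq_add, triple_swap_left a b, triple_swap_left c d]
  abel

theorem bigon_swap (e f x y : ℕ) : bigon e f x y = bigon f e x y := by
  rw [bigon, bigon, triple_swap_left e f, triple_swap_left e f]

/-- Any side of a quadrilateral can be taken as the first one. -/
theorem exists_quad_eq {a b c d x₁ x₂ y₁ y₂ e : ℕ} (he : e = a ∨ e = b ∨ e = c ∨ e = d) :
    ∃ p q g u₁ u₂ v₁ v₂, quad a b c d x₁ x₂ y₁ y₂ = quad e p q g u₁ u₂ v₁ v₂ ∧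
      ∀ f N, quadValue f N x₁ x₂ y₁ y₂ = quadValue f N u₁ u₂ v₁ v₂ := by
  rcases he with rfl | rfl | rfl | rfl
  · exact ⟨_, _, _, _, _, _, _, rfl, fun _ _ => rfl⟩
  · exact ⟨_, _, _, _, _, _, _, quad_swap_sink _ _ _ _ _ _ _ _,
      fun _ _ => quadValue_swap_sink _ _ _ _ _ _⟩
  · exact ⟨_, _, _, _, _, _, _, quad_swap_source _ _ _ _ _ _ _ _,
      fun _ _ => quadValue_swap_source _ _ _ _ _ _⟩
  · exact ⟨_, _, _, _, _, _, _, (quad_swap_source _ _ _ _ _ _ _ _).trans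
      (quad_swap_sink _ _ _ _ _ _ _ _), fun _ _ => (quadValue_swap_source _ _ _ _ _ _).trans
      (quadValue_swap_sink _ _ _ _ _ _)⟩

/-- The assignment of values to symbols below `100` and from `100` on that is given by two lists. -/
def lookup (bd int : List ℕ) (k : ℕ) : ℕ := if k < 100 then bd.getD k 0 else int.getD (k - 100) 0

/-- A multiple of a symbolic web in every term. -/
def SLin.attach (l : SLin) (rest : List SNode) : SLin :=
  l.map fun t => (t.1, t.2.1, rest ++ t.2.2)

theorem SRule.valid_attach (r : SRule) {n : ℕ} {M : Multiset WNode} {σ : ℕ → ℕ}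
    {rest : List SNode} (hw : IsWeb (M + toNodes σ rest + toNodes σ r.lhs))
    (hn : (M + toNodes σ rest + toNodes σ r.lhs).card ≤ n) :
    (r.rhs.attach rest).Valid n M σ := by
  intro t ht
  obtain ⟨u, hu, rfl⟩ := List.mem_map.1 ht
  have := (r.sound σ _ hw).1 u hu
  simp only [Multiset.card_add, card_toNodes] at hn
  rw [toNodes_append, ← add_assoc, List.length_append]
  exact ⟨this.1, by omega⟩

theorem SLin.eval_attach (f : Multiset WNode → GraphPoly) (M : Multiset WNode) (σ : ℕ → ℕ)
    (l : SLin) (rest : List SNode) : (l.attach rest).eval (fun L => f (M + toNodes σ L)) =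
      l.eval fun L => f (M + toNodes σ rest + toNodes σ L) := by
  rw [attach, eval_map (fun L => f (M + toNodes σ L)) (fun L => rest ++ L)]
  simp only [toNodes_append, add_assoc]

/-- Two reductions of one web have the same result if this holds symbolically. -/
theorem eval_eq_of_agree_attach {n : ℕ} {f : Multiset WNode → GraphPoly}
    (hf : RespectsBelow n f) (r r' : SRule) (rest rest' : List SNode)
    (h : SLin.agree (r.rhs.attach rest) (r'.rhs.attach rest') = true)
    (M : Multiset WNode) (σ : ℕ → ℕ) {s N N' : Multiset WNode} (hs : IsWeb s) (hn : s.card ≤ n)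
    (hN : N = M + toNodes σ rest) (hN' : N' = M + toNodes σ rest')
    (e : s = N + toNodes σ r.lhs) (e' : s = N' + toNodes σ r'.lhs) :
    SLin.eval (fun L => f (N + toNodes σ L)) r.rhs =
      SLin.eval (fun L => f (N' + toNodes σ L)) r'.rhs := by
  subst hN hN'
  have h1 := r.valid_attach (e ▸ hs) (e ▸ hn)
  have h2 := r'.valid_attach (e' ▸ hs) (e' ▸ hn)
  have := SLin.eval_eq_of_agree hf h (fun _ _ => rfl) h1 h2
  rwa [SLin.eval_attach, SLin.eval_attach] at this

theorem quadValue_eq_eval (f : Multiset WNode → GraphPoly) (N : Multiset WNode) (σ : ℕ → ℕ)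
    (a b c d x₁ x₂ y₁ y₂ : ℕ) : quadValue f N (σ x₁) (σ x₂) (σ y₁) (σ y₂) =
      SLin.eval (fun L => f (N + toNodes σ L)) (SRule.quad a b c d x₁ x₂ y₁ y₂).rhs := by
  have e' : ∀ a b c d, toNodes σ [SNode.joint a b, SNode.joint c d] =
    {WNode.joint (σ a) (σ b), WNode.joint (σ c) (σ d)} := fun _ _ _ _ => rfl
  simp [quadValue, SRule.rhs, SLin.eval, e', A_zero]

theorem bigonValue_eq_eval (f : Multiset WNode → GraphPoly) (N : Multiset WNode) (σ : ℕ → ℕ)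
    (a b x y : ℕ) : (A 3 + A (-3)) * f (N + {WNode.joint (σ y) (σ x)}) =
      SLin.eval (fun L => f (N + toNodes σ L)) (SRule.bigon a b x y).rhs := by
  have e' : ∀ a b, toNodes σ [SNode.joint a b] = {WNode.joint (σ a) (σ b)} := fun _ _ => rfl
  simp [SRule.rhs, SLin.eval, e']
  ring

/-! ### Overlaps that involve a bigon -/

section Overlap

variable {n : ℕ} {f : Multiset WNode → GraphPoly} {s N N' : Multiset WNode}

theorem quad_facts {a b c d x₁ x₂ y₁ y₂ : ℕ} (hs : IsWeb s)
    (h : s = N + quad a b c d x₁ x₂ y₁ y₂) :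
    (WNode.source {a, b, x₁} ∈ s ∧ WNode.source {c, d, x₂} ∈ s ∧ WNode.sink {a, c, y₁} ∈ s ∧
      WNode.sink {b, d, y₂} ∈ s) ∧
    WNode.source {a, b, x₁} ≠ WNode.source {c, d, x₂} ∧
    WNode.sink {a, c, y₁} ≠ WNode.sink {b, d, y₂} := by
  have hq : (quad a b c d x₁ x₂ y₁ y₂).Nodup := by
    have := hs.nodup_nodes
    rw [h] at this
    exact (Multiset.nodup_add.1 this).2.1
  subst h
  refine ⟨by simp [quad], ?_⟩
  simp only [quad, Multiset.insert_eq_cons, Multiset.nodup_cons, Multiset.mem_cons,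
    Multiset.mem_singleton, not_or] at hq
  exact ⟨hq.1.1, hq.2.2.1⟩

/-- The common edge `e` determines both vertices. If the bigons differ, the vertices are joined by
three parallel edges, and either bigon leaves a single circle. -/
theorem bigon_bigon_core (hf : RespectsBelow n f) (hs : IsWeb s) (hn : s.card ≤ n)
    {e p x y p' x' y' : ℕ} (h : s = N + bigon e p x y) (h' : s = N' + bigon e p' x' y') :
    f (N + {WNode.joint y x}) = f (N' + {WNode.joint y' x'}) := by
  have m1 : WNode.source {e, p, x} ∈ s := h ▸ by simp [bigon]
  have m2 : WNode.sink {e, p, y} ∈ s := h ▸ by simp [bigon]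
  have m1' : WNode.source {e, p', x'} ∈ s := h' ▸ by simp [bigon]
  have m2' : WNode.sink {e, p', y'} ∈ s := h' ▸ by simp [bigon]
  have e1 := WNode.source.inj (hs.eq_of_mem_outs m1 m1' (e := e) (by simp [WNode.outs])
    (by simp [WNode.outs]))
  have e2 := WNode.sink.inj (hs.eq_of_mem_ins m2 m2' (e := e) (by simp [WNode.ins])
    (by simp [WNode.ins]))
  have trivialCase : p = p' → x = x' → y = y' →
      f (N + {WNode.joint y x}) = f (N' + {WNode.joint y' x'}) := by
    rintro rfl rfl rfl
    rw [add_right_cancel (h.symm.trans h')]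
  rcases pair_cases ((Multiset.cons_inj_right _).1 e1) with ⟨a1, a2⟩ | ⟨a1, a2⟩ <;>
    rcases pair_cases ((Multiset.cons_inj_right _).1 e2) with ⟨b1, b2⟩ | ⟨b1, b2⟩
  · exact trivialCase a1 a2 b2
  · exact trivialCase a1 a2 (by omega)
  · exact trivialCase b1 (by omega) b2
  · subst a1 b1 a2
    obtain rfl : x = y := b2.symm
    have hb : bigon e p x x = bigon e x p p := by
      rw [bigon, bigon, triple_swap_right e p]
    obtain rfl : N = N' := by
      rw [hb] at h
      exact add_right_cancel (h.symm.trans h')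
    have hc : s.card = N.card + 2 := by rw [h]; simp [bigon]
    have hw : ∀ a b z, s = N + bigon a b z z → IsWeb (N + {WNode.joint z z}) := fun a b z hz =>
      (LocalRule.bigon a b z z).isWeb (hz ▸ hs) _ (List.mem_singleton_self _)
    rw [hf.rule (LocalRule.circle x) (hw _ _ _ h) (by simp; omega),
      hf.rule (LocalRule.circle p) (hw _ _ _ h') (by simp; omega)]

/-- The second edge of the bigon cannot be a side of the quadrilateral, whose sources and sinks are
distinct; so it is a leg that doubles the side `e`. Opening the bigon creates another one, with
factor (A^3 + A^(-3))^2 in total. Splitting the quadrilateral gives a circle beside an arc, plus the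
arc alone, which is δ + 1. -/
theorem bigon_quad_core (hf : RespectsBelow n f) (hs : IsWeb s) (hn : s.card ≤ n)
    {e i x y p q g x₁ x₂ y₁ y₂ : ℕ} (h : s = N + bigon e i x y)
    (h' : s = N' + quad e p q g x₁ x₂ y₁ y₂) :
    (A 3 + A (-3)) * f (N + {WNode.joint y x}) = quadValue f N' x₁ x₂ y₁ y₂ := by
  have m1 : WNode.source {e, i, x} ∈ s := h ▸ by simp [bigon]
  have m2 : WNode.sink {e, i, y} ∈ s := h ▸ by simp [bigon]
  obtain ⟨⟨k1, k2, k3, k4⟩, n1, n2⟩ := quad_facts hs h'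
  have e1 := hs.eq_of_mem_outs m1 k1 (e := e) (by simp [WNode.outs]) (by simp [WNode.outs])
  have e2 := hs.eq_of_mem_ins m2 k3 (e := e) (by simp [WNode.ins]) (by simp [WNode.ins])
  rcases pair_cases ((Multiset.cons_inj_right _).1 (WNode.source.inj e1)) with
    ⟨a1, a2⟩ | ⟨a1, a2⟩
  · refine absurd (e2.symm.trans (hs.eq_of_mem_ins m2 k4 (e := i) ?_ ?_)) n2 <;>
      simp [WNode.ins, a1]
  rcases pair_cases ((Multiset.cons_inj_right _).1 (WNode.sink.inj e2)) with ⟨b1, b2⟩ | ⟨b1, b2⟩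
  · refine absurd (e1.symm.trans (hs.eq_of_mem_outs m1 k2 (e := i) ?_ ?_)) n1 <;>
      simp [WNode.outs, b1]
  subst a1 a2 b1 b2
  have hN : N = N' + {WNode.source {y, g, x₂}, WNode.sink {x, g, y₂}} := by
    refine add_right_cancel (b := bigon e i x y) (h.symm.trans (h'.trans ?_))
    simp only [quad_eq_add, bigon_eq_add, triple_swap_right e i, Multiset.insert_eq_cons (WNode.source _),
      ← Multiset.singleton_add (WNode.source _)]
    abel
  exact (bigonValue_eq_eval f N (lookup [i, x₂, y₂, x, y, g, e] []) 6 0 3 4).trans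
    ((eval_eq_of_agree_attach hf (SRule.bigon 6 0 3 4) (SRule.quad 6 3 4 5 0 1 0 2)
      [SNode.source 4 5 1, SNode.sink 3 5 2] [] (by decide +kernel) N'
      (lookup [i, x₂, y₂, x, y, g, e] []) hs hn hN (add_zero _).symm h h').trans
    (quadValue_eq_eval f N' (lookup [i, x₂, y₂, x, y, g, e] []) 6 3 4 5 0 1 0 2).symm)

end Overlap


/-! ### Overlaps of two quadrilaterals -/

section QuadQuad

variable {n : ℕ} {f : Multiset WNode → GraphPoly} {s N N' : Multiset WNode}

/-- For patterns that differ in exactly one node: what remains after removing either contains the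
extra node of the other. -/
theorem exists_common_rest {N N' P : Multiset WNode} {u u' : WNode}
    (h : N + (P + {u}) = N' + (P + {u'})) (hne : u ≠ u') :
    ∃ M, N = M + {u'} ∧ N' = M + {u} := by
  have h0 : N + {u} = N' + {u'} := by
    rw [add_comm P, add_comm P, ← add_assoc, ← add_assoc] at h
    exact add_right_cancel h
  have hm : u' ∈ N := by
    have : u' ∈ N + {u} := h0 ▸ by simp
    rcases Multiset.mem_add.1 this with h | h
    · exact h
    · exact absurd (Multiset.mem_singleton.1 h).symm hne
  obtain ⟨M, rfl⟩ := Multiset.exists_cons_of_mem hm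
  refine ⟨M, by rw [← Multiset.singleton_add, add_comm], ?_⟩
  rw [Multiset.cons_add, add_comm N', Multiset.singleton_add u'] at h0
  exact ((Multiset.cons_inj_right _).1 h0).symm

/-- Two quadrilaterals with the same vertices that differ in one edge. -/
theorem quad_quad_three_edges (hf : RespectsBelow n f) (hs : IsWeb s) (hn : s.card ≤ n)
    {e p q g x h y : ℕ} (h₁ : s = N + quad e p q g x h y h)
    (h₂ : s = N' + quad e p q h x g y g) :
    quadValue f N x h y h = quadValue f N' x g y g := by
  -- The edges `g` and `h` are parallel, so the two quadrilaterals have the same nodes. Either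
  -- splitting gives δ + 1 times the web in which `y` continues as `x`.
  obtain rfl : N = N' := by
    refine add_right_cancel (h₁.symm.trans (h₂.trans ?_))
    rw [quad, quad, triple_swap_right q, triple_swap_right p]
  exact (quadValue_eq_eval f N (lookup [e, p, q, g, x, h, y] []) 0 1 2 3 4 5 6 5).trans
    ((eval_eq_of_agree_attach hf (SRule.quad 0 1 2 3 4 5 6 5) (SRule.quad 0 1 2 5 4 3 6 3)
      [] [] (by decide +kernel) N (lookup [e, p, q, g, x, h, y] []) hs hn (add_zero _).symm
      (add_zero _).symm h₁ h₂).trans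
    (quadValue_eq_eval f N (lookup [e, p, q, g, x, h, y] []) 0 1 2 5 4 3 6 3).symm)

/-- Two quadrilaterals with the same vertices that share two opposite edges. -/
theorem quad_quad_opposite_edges (hf : RespectsBelow n f) (hs : IsWeb s) (hn : s.card ≤ n)
    {e p q g x y : ℕ} (h₁ : s = N + quad e p q g x y y x)
    (h₂ : s = N' + quad e x y g p q q p) :
    quadValue f N x y y x = quadValue f N' p q q p := by
  -- The four vertices form a closed component in which two opposite sides are doubled. Either
  -- splitting yields one circle plus two circles, that is δ + δ^2.
  obtain rfl : N = N' := by
    refine add_right_cancel (h₁.symm.trans (h₂.trans ?_))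
    rw [quad, quad, triple_swap_right e x, triple_swap_right e y, triple_swap_left y g,
      triple_swap_right g, triple_swap_left g q, triple_swap_left x g, triple_swap_right g,
      triple_swap_left g p]
  exact (quadValue_eq_eval f N (lookup [e, p, q, g, x, y] []) 0 1 2 3 4 5 5 4).trans
    ((eval_eq_of_agree_attach hf (SRule.quad 0 1 2 3 4 5 5 4) (SRule.quad 0 4 5 3 1 2 2 1)
      [] [] (by decide +kernel) N (lookup [e, p, q, g, x, y] []) hs hn (add_zero _).symm
      (add_zero _).symm h₁ h₂).trans
    (quadValue_eq_eval f N (lookup [e, p, q, g, x, y] []) 0 4 5 3 1 2 2 1).symm)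

/-- Two quadrilaterals that share two edges at a source. -/
theorem quad_quad_source_path (hf : RespectsBelow n f) (hs : IsWeb s) (hn : s.card ≤ n)
    {e p q g x x₂ y₁ y₂ x₃ : ℕ} (h₁ : s = N + quad e p q g x x₂ y₁ y₂)
    (h₂ : s = N' + quad e p y₁ y₂ x x₃ q g)
    (hne : WNode.source {q, g, x₂} ≠ WNode.source {y₁, y₂, x₃}) :
    quadValue f N x x₂ y₁ y₂ = quadValue f N' x x₃ q g := by
  -- Three sources are attached to the same two sinks. Each of the four smoothings leaves one source
  -- with the legs `x`, `x₂`, `x₃`, so both sides are twice this web.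
  obtain ⟨M, hN, hN'⟩ := exists_common_rest (N := N) (N' := N') (P := {WNode.source {e, p, x}} +
    {WNode.sink {e, q, y₁}} + {WNode.sink {p, g, y₂}}) (by
      have := h₁.symm.trans h₂
      rw [quad_eq_add, quad_eq_add, triple_swap_right e y₁, triple_swap_right p y₂] at this
      convert this using 2 <;> abel) hne
  exact (quadValue_eq_eval f N (lookup [e, p, q, g, x, x₂, y₁, y₂, x₃] []) 0 1 2 3 4 5 6 7).trans
    ((eval_eq_of_agree_attach hf (SRule.quad 0 1 2 3 4 5 6 7) (SRule.quad 0 1 6 7 4 8 2 3)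
      [SNode.source 6 7 8] [SNode.source 2 3 5] (by decide +kernel) M
      (lookup [e, p, q, g, x, x₂, y₁, y₂, x₃] []) hs hn hN hN' h₁ h₂).trans
    (quadValue_eq_eval f N' (lookup [e, p, q, g, x, x₂, y₁, y₂, x₃] []) 0 1 6 7 4 8 2 3).symm)

/-- Two quadrilaterals that share two edges at a sink. -/
theorem quad_quad_sink_path (hf : RespectsBelow n f) (hs : IsWeb s) (hn : s.card ≤ n)
    {e p q g x₁ x₂ y y₂ y₃ : ℕ} (h₁ : s = N + quad e p q g x₁ x₂ y y₂)
    (h₂ : s = N' + quad e x₁ q x₂ p g y y₃)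
    (hne : WNode.sink {p, g, y₂} ≠ WNode.sink {x₁, x₂, y₃}) :
    quadValue f N x₁ x₂ y y₂ = quadValue f N' p g y y₃ := by
  obtain ⟨M, hN, hN'⟩ := exists_common_rest (N := N) (N' := N') (P := {WNode.sink {e, q, y}} +
    {WNode.source {e, p, x₁}} + {WNode.source {q, g, x₂}}) (by
      have := h₁.symm.trans h₂
      rw [quad_eq_add, quad_eq_add, triple_swap_right e x₁, triple_swap_right q x₂] at this
      convert this using 2 <;> abel) hne
  exact (quadValue_eq_eval f N (lookup [e, p, q, g, x₁, x₂, y, y₂, y₃] []) 0 1 2 3 4 5 6 7).trans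
    ((eval_eq_of_agree_attach hf (SRule.quad 0 1 2 3 4 5 6 7) (SRule.quad 0 4 2 5 1 3 6 8)
      [SNode.sink 4 5 8] [SNode.sink 1 3 7] (by decide +kernel) M
      (lookup [e, p, q, g, x₁, x₂, y, y₂, y₃] []) hs hn hN hN' h₁ h₂).trans
    (quadValue_eq_eval f N' (lookup [e, p, q, g, x₁, x₂, y, y₂, y₃] []) 0 4 2 5 1 3 6 8).symm)

/-- Two quadrilaterals that share one edge. -/
theorem quad_quad_one_edge (hf : RespectsBelow n f) (hs : IsWeb s) (hn : s.card ≤ n)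
    {e p q g x x₂ y y₂ g' x₃ y₃ : ℕ} (h₁ : s = N + quad e p q g x x₂ y y₂)
    (h₂ : s = N' + quad e x y g' p x₃ q y₃)
    (hne : WNode.source {q, g, x₂} ≠ WNode.source {y, g', x₃})
    (hne' : WNode.sink {p, g, y₂} ≠ WNode.sink {x, g', y₃}) :
    quadValue f N x x₂ y y₂ = quadValue f N' p x₃ q y₃ := by
  -- The patterns differ in a source and in a sink. The source is split off here, the sink
  -- afterwards.
  obtain ⟨M₀, hN, hN'⟩ := exists_common_rest (N := N + {WNode.sink {p, g, y₂}})
    (N' := N' + {WNode.sink {x, g', y₃}}) (P := {WNode.sink {e, q, y}} +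
    {WNode.source {e, p, x}}) (by
      have := h₁.symm.trans h₂
      rw [quad_eq_add, quad_eq_add, triple_swap_right e x, triple_swap_right e y] at this
      convert this using 1 <;> abel) hne
  obtain ⟨M, hM⟩ : ∃ M, M₀ = M + {WNode.sink {p, g, y₂}, WNode.sink {x, g', y₃}} := by
    have m1 : WNode.sink {x, g', y₃} ∈ M₀ := by
      have : WNode.sink {x, g', y₃} ∈ M₀ + {WNode.source {q, g, x₂}} := hN' ▸ by simp
      simpa using this
    have m2 : WNode.sink {p, g, y₂} ∈ M₀ := by
      have : WNode.sink {p, g, y₂} ∈ M₀ + {WNode.source {y, g', x₃}} := hN ▸ by simp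
      simpa using this
    obtain ⟨M₁, rfl⟩ := Multiset.exists_cons_of_mem m1
    obtain ⟨M₂, rfl⟩ := Multiset.exists_cons_of_mem ((Multiset.mem_cons.1 m2).resolve_left hne')
    refine ⟨M₂, ?_⟩
    simp only [Multiset.insert_eq_cons (WNode.sink _), ← Multiset.singleton_add (WNode.sink _)]
    abel
  have hN : N = M + {WNode.source {y, g', x₃}, WNode.sink {x, g', y₃}} := by
    refine add_right_cancel (hN.trans ?_)
    simp only [hM, Multiset.insert_eq_cons (WNode.sink _), Multiset.insert_eq_cons (WNode.source _),
      ← Multiset.singleton_add (WNode.sink _), ← Multiset.singleton_add (WNode.source _)]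
    abel
  have hN' : N' = M + {WNode.source {q, g, x₂}, WNode.sink {p, g, y₂}} := by
    refine add_right_cancel (hN'.trans ?_)
    simp only [hM, Multiset.insert_eq_cons (WNode.sink _), Multiset.insert_eq_cons (WNode.source _),
      ← Multiset.singleton_add (WNode.sink _), ← Multiset.singleton_add (WNode.source _)]
    abel
  -- On both sides one term is A^3 + A^(-3) times two arcs; the other is a source and a sink joined
  -- by `g'` on the left and by `g` on the right. Since only the name of that inner edge differs,
  -- these edges receive internal symbols.
  exact (quadValue_eq_eval f N (lookup [x₂, y₂, x₃, y₃] [e, p, q, g, x, y, g'])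
      100 101 102 103 104 0 105 1).trans
    ((eval_eq_of_agree_attach hf (SRule.quad 100 101 102 103 104 0 105 1)
      (SRule.quad 100 104 105 106 101 2 102 3)
      [SNode.source 105 106 2, SNode.sink 104 106 3] [SNode.source 102 103 0, SNode.sink 101 103 1]
      (by decide +kernel) M (lookup [x₂, y₂, x₃, y₃] [e, p, q, g, x, y, g'])
      hs hn hN hN' h₁ h₂).trans
    (quadValue_eq_eval f N' (lookup [x₂, y₂, x₃, y₃] [e, p, q, g, x, y, g'])
      100 104 105 106 101 2 102 3).symm)

/-- The common edge `e` fixes a source and a sink. The cases record whether the second quadrilateral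
continues along the same edge as the first at the source, and likewise at the sink; distinctness of
the vertices of each quadrilateral excludes the remaining coincidences. -/
theorem quad_quad_core (hf : RespectsBelow n f) (hs : IsWeb s) (hn : s.card ≤ n)
    {e p q g x₁ x₂ y₁ y₂ p' q' g' x₁' x₂' y₁' y₂' : ℕ} (h : s = N + quad e p q g x₁ x₂ y₁ y₂)
    (h' : s = N' + quad e p' q' g' x₁' x₂' y₁' y₂') :
    quadValue f N x₁ x₂ y₁ y₂ = quadValue f N' x₁' x₂' y₁' y₂' := by
  obtain ⟨⟨m1, m2, m3, m4⟩, n1, n2⟩ := quad_facts hs h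
  obtain ⟨⟨m1', m2', m3', m4'⟩, n1', n2'⟩ := quad_facts hs h'
  have e1 := hs.eq_of_mem_outs m1 m1' (e := e) (by simp [WNode.outs]) (by simp [WNode.outs])
  have e3 := hs.eq_of_mem_ins m3 m3' (e := e) (by simp [WNode.ins]) (by simp [WNode.ins])
  obtain ⟨d1, d2, d3⟩ := ne_of_nodup_triple (hs.nodup_outs_of_mem m1)
  obtain ⟨d4, d5, d6⟩ := ne_of_nodup_triple (hs.nodup_outs_of_mem m2)
  obtain ⟨d7, d8, d9⟩ := ne_of_nodup_triple (hs.nodup_ins_of_mem m3)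
  obtain ⟨d10, d11, d12⟩ := ne_of_nodup_triple (hs.nodup_ins_of_mem m4)
  have same : p = p' → q = q' → g = g' → x₁ = x₁' → x₂ = x₂' → y₁ = y₁' → y₂ = y₂' →
      quadValue f N x₁ x₂ y₁ y₂ = quadValue f N' x₁' x₂' y₁' y₂' := by
    rintro rfl rfl rfl rfl rfl rfl rfl
    rw [add_right_cancel (h.symm.trans h')]
  -- edges at different sources, or at different sinks, are different
  have so : ∀ u v, u ∈ ({e, p, x₁} : Multiset ℕ) → v ∈ ({q, g, x₂} : Multiset ℕ) → u ≠ v := by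
    rintro u _ hu hv rfl
    exact n1 (hs.eq_of_mem_outs m1 m2 hu hv)
  have si : ∀ u v, u ∈ ({e, q, y₁} : Multiset ℕ) → v ∈ ({p, g, y₂} : Multiset ℕ) → u ≠ v := by
    rintro u _ hu hv rfl
    exact n2 (hs.eq_of_mem_ins m3 m4 hu hv)
  have so' : ∀ u v, u ∈ ({e, p', x₁'} : Multiset ℕ) → v ∈ ({q', g', x₂'} : Multiset ℕ) →
      u ≠ v := by
    rintro u _ hu hv rfl
    exact n1' (hs.eq_of_mem_outs m1' m2' hu hv)
  have si' : ∀ u v, u ∈ ({e, q', y₁'} : Multiset ℕ) → v ∈ ({p', g', y₂'} : Multiset ℕ) →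
      u ≠ v := by
    rintro u _ hu hv rfl
    exact n2' (hs.eq_of_mem_ins m3' m4' hu hv)
  have src : ∀ u, u ∈ ({q, g, x₂} : Multiset ℕ) → u ∈ ({q', g', x₂'} : Multiset ℕ) →
      ({q, g, x₂} : Multiset ℕ) = {q', g', x₂'} := fun u hu hv =>
    WNode.source.inj (hs.eq_of_mem_outs m2 m2' hu hv)
  have snk : ∀ u, u ∈ ({p, g, y₂} : Multiset ℕ) → u ∈ ({p', g', y₂'} : Multiset ℕ) →
      ({p, g, y₂} : Multiset ℕ) = {p', g', y₂'} := fun u hu hv =>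
    WNode.sink.inj (hs.eq_of_mem_ins m4 m4' hu hv)
  rcases pair_cases ((Multiset.cons_inj_right _).1 (WNode.source.inj e1)) with
      ⟨rfl, rfl⟩ | ⟨rfl, rfl⟩ <;>
    rcases pair_cases ((Multiset.cons_inj_right _).1 (WNode.sink.inj e3)) with
      ⟨rfl, rfl⟩ | ⟨rfl, rfl⟩
  · rcases pair_cases ((Multiset.cons_inj_right _).1 (snk p (by simp) (by simp))) with
        ⟨b1, b2⟩ | ⟨b1, b2⟩ <;>
      rcases pair_cases ((Multiset.cons_inj_right _).1 (src q (by simp) (by simp))) with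
        ⟨c1, c2⟩ | ⟨c1, c2⟩
    · exact same rfl rfl b1 rfl c2 rfl b2
    · exact same rfl rfl b1 rfl (by omega) rfl b2
    · exact same rfl rfl c1 rfl c2 rfl (by omega)
    · subst b1 b2
      subst c1
      obtain rfl : y₂ = x₂ := c2.symm
      exact quad_quad_three_edges hf hs hn h h'
  -- The edges `e` and `p` at the common source are shared, hence both sinks. If `g` is shared too,
  -- three sides agree; otherwise the second sources differ.
  · rcases pair_cases ((Multiset.cons_inj_right _).1 (snk p (by simp) (by simp))) with
      ⟨rfl, rfl⟩ | ⟨rfl, rfl⟩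
    · have := src g (by simp) (by simp)
      rw [triple_swap_left q, triple_swap_left y₁] at this
      rcases pair_cases ((Multiset.cons_inj_right _).1 this) with ⟨c1, -⟩ | ⟨rfl, rfl⟩
      · exact absurd c1 d9
      · rw [quad_swap_sink] at h h'
        exact (quadValue_swap_sink _ _ _ _ _ _).trans ((quad_quad_three_edges hf hs hn h h').trans
          (quadValue_swap_sink _ _ _ _ _ _))
    · refine quad_quad_source_path hf hs hn h h' fun hh => ?_
      have hh := WNode.source.inj hh
      have hq : q ∈ ({y₁, y₂, x₂'} : Multiset ℕ) := by rw [← hh]; simp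
      have hg : g ∈ ({y₁, y₂, x₂'} : Multiset ℕ) := by rw [← hh]; simp
      have s1 := si q y₂ (by simp) (by simp)
      have s2 := si y₁ g (by simp) (by simp)
      simp only [Multiset.insert_eq_cons, Multiset.mem_cons, Multiset.mem_singleton] at hq hg
      omega
  · rcases pair_cases ((Multiset.cons_inj_right _).1 (src q (by simp) (by simp))) with
      ⟨rfl, rfl⟩ | ⟨rfl, rfl⟩
    · have := snk g (by simp) (by simp)
      rw [triple_swap_left p, triple_swap_left x₁] at this
      rcases pair_cases ((Multiset.cons_inj_right _).1 this) with ⟨c1, -⟩ | ⟨rfl, rfl⟩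
      · exact absurd c1 d3
      · rw [quad_swap_source] at h h'
        exact (quadValue_swap_source _ _ _ _ _ _).trans
          ((quad_quad_three_edges hf hs hn h h').trans (quadValue_swap_source _ _ _ _ _ _))
    · refine quad_quad_sink_path hf hs hn h h' fun hh => ?_
      have hh := WNode.sink.inj hh
      have hp : p ∈ ({x₁, x₂, y₂'} : Multiset ℕ) := by rw [← hh]; simp
      have hg : g ∈ ({x₁, x₂, y₂'} : Multiset ℕ) := by rw [← hh]; simp
      have s1 := so p x₂ (by simp) (by simp)
      have s2 := so x₁ g (by simp) (by simp)
      simp only [Multiset.insert_eq_cons, Multiset.mem_cons, Multiset.mem_singleton] at hp hg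
      omega
  -- At its two ends only `e` is shared. Either the other two vertices also coincide, and `g` is a
  -- second common side, or both of them differ.
  · have s1 := so x₁ g (by simp) (by simp)
    have s2 := si y₁ g (by simp) (by simp)
    have s3 := so' p g' (by simp) (by simp)
    have s4 := si' q g' (by simp) (by simp)
    by_cases ht : ({p, g, y₂} : Multiset ℕ) = {x₁, g', y₂'}
    · obtain rfl : x₁ = y₂ := by
        have : x₁ ∈ ({p, g, y₂} : Multiset ℕ) := by rw [ht]; simp
        simp only [Multiset.insert_eq_cons, Multiset.mem_cons, Multiset.mem_singleton] at this
        exact (this.resolve_left (Ne.symm d3)).resolve_left s1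
      rw [triple_swap_right p, triple_swap_left p] at ht
      rcases pair_cases ((Multiset.cons_inj_right _).1 ht) with ⟨c1, -⟩ | ⟨rfl, rfl⟩
      · exact absurd c1 s3
      · have := src g (by simp) (by simp)
        rw [triple_swap_left q, triple_swap_left y₁] at this
        rcases pair_cases ((Multiset.cons_inj_right _).1 this) with ⟨c1, -⟩ | ⟨rfl, rfl⟩
        · exact absurd c1 d9
        · exact quad_quad_opposite_edges hf hs hn h h'
    · refine quad_quad_one_edge hf hs hn h h' (fun hh => ?_) fun hh => ht (WNode.sink.inj hh)
      have hh := WNode.source.inj hh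
      obtain rfl : y₁ = x₂ := by
        have : y₁ ∈ ({q, g, x₂} : Multiset ℕ) := by rw [hh]; simp
        simp only [Multiset.insert_eq_cons, Multiset.mem_cons, Multiset.mem_singleton] at this
        exact (this.resolve_left (Ne.symm d9)).resolve_left s2
      rw [triple_swap_right q, triple_swap_left q] at hh
      rcases pair_cases ((Multiset.cons_inj_right _).1 hh) with ⟨c1, -⟩ | ⟨-, rfl⟩
      · exact absurd c1 s4
      · exact ht (snk g (by simp) (by simp))

end QuadQuad


/-! ### Local confluence of all reductions -/

section Confluence

variable {n : ℕ} {f : Multiset WNode → GraphPoly} {s N N' P P' : Multiset WNode}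
  {L L' : List (GraphPoly × Multiset WNode)}

theorem combination_quad (f : Multiset WNode → GraphPoly) (N : Multiset WNode) (x₁ x₂ y₁ y₂ : ℕ) :
    combination f N [(1, {WNode.joint y₁ x₁, WNode.joint y₂ x₂}),
      (1, {WNode.joint y₁ x₂, WNode.joint y₂ x₁})] = quadValue f N x₁ x₂ y₁ y₂ := by
  simp [combination, quadValue]

theorem combination_bigon (f : Multiset WNode → GraphPoly) (N : Multiset WNode) (x y : ℕ) :
    combination f N [(A 3 + A (-3), {WNode.joint y x})] =
      (A 3 + A (-3)) * f (N + {WNode.joint y x}) := by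
  simp [combination]

/-- A side of a quadrilateral at a vertex. -/
theorem eq_of_mem_quad {a b c d x₁ x₂ y₁ y₂ : ℕ} {m : WNode}
    (hm : m ∈ quad a b c d x₁ x₂ y₁ y₂) (hs : IsWeb (N + quad a b c d x₁ x₂ y₁ y₂)) :
    ∃ u v w, u ≠ v ∧ (u = a ∨ u = b ∨ u = c ∨ u = d) ∧ (v = a ∨ v = b ∨ v = c ∨ v = d) ∧
      (m = WNode.source {u, v, w} ∨ m = WNode.sink {u, v, w}) := by
  obtain ⟨⟨m1, m2, m3, m4⟩, -⟩ := quad_facts hs rfl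
  simp only [quad, Multiset.insert_eq_cons (WNode.source _), Multiset.insert_eq_cons (WNode.sink _),
    Multiset.mem_cons, Multiset.mem_singleton] at hm
  rcases hm with rfl | rfl | rfl | rfl
  · exact ⟨a, b, x₁, (ne_of_nodup_triple (hs.nodup_outs_of_mem m1)).1, by simp, by simp, Or.inl rfl⟩
  · exact ⟨c, d, x₂, (ne_of_nodup_triple (hs.nodup_outs_of_mem m2)).1, by simp, by simp, Or.inl rfl⟩
  · exact ⟨a, c, y₁, (ne_of_nodup_triple (hs.nodup_ins_of_mem m3)).1, by simp, by simp, Or.inr rfl⟩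
  · exact ⟨b, d, y₂, (ne_of_nodup_triple (hs.nodup_ins_of_mem m4)).1, by simp, by simp, Or.inr rfl⟩

/-- A side of a bigon at a vertex. -/
theorem eq_of_mem_bigon {e p x y : ℕ} {m : WNode}
    (hm : m ∈ bigon e p x y) (hs : IsWeb (N + bigon e p x y)) :
    ∃ w, e ≠ p ∧ (m = WNode.source {e, p, w} ∨ m = WNode.sink {e, p, w}) := by
  have m1 : WNode.source {e, p, x} ∈ N + bigon e p x y := by simp [bigon]
  have hne := (ne_of_nodup_triple (hs.nodup_outs_of_mem m1)).1
  simp only [bigon, Multiset.insert_eq_cons (WNode.source _), Multiset.mem_cons,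
    Multiset.mem_singleton] at hm
  rcases hm with rfl | rfl
  · exact ⟨x, hne, Or.inl rfl⟩
  · exact ⟨y, hne, Or.inr rfl⟩

theorem edge_meet {m : WNode} {u v w u' v' w' : ℕ} (huv : u ≠ v)
    (h : m = WNode.source {u, v, w} ∨ m = WNode.sink {u, v, w})
    (h' : m = WNode.source {u', v', w'} ∨ m = WNode.sink {u', v', w'}) :
    ∃ x, (x = u ∨ x = v) ∧ (x = u' ∨ x = v') := by
  rcases h with rfl | rfl <;> rcases h' with h' | h'
  · exact pair_meet (WNode.source.inj h') huv
  · cases h'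
  · cases h'
  · exact pair_meet (WNode.sink.inj h') huv

/-- A common vertex yields a common edge, and by the symmetries of the two patterns that edge may be
taken as the first in each. -/
theorem bigon_quad_overlap (hf : RespectsBelow n f) (hs : IsWeb s) (hn : s.card ≤ n)
    {e p x y a b c d x₁ x₂ y₁ y₂ : ℕ} (h : s = N + bigon e p x y)
    (h' : s = N' + quad a b c d x₁ x₂ y₁ y₂) {m : WNode} (hm : m ∈ bigon e p x y)
    (hm' : m ∈ quad a b c d x₁ x₂ y₁ y₂) :
    (A 3 + A (-3)) * f (N + {WNode.joint y x}) = quadValue f N' x₁ x₂ y₁ y₂ := by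
  obtain ⟨w, hne, hw⟩ := eq_of_mem_bigon hm (h ▸ hs)
  obtain ⟨u', v', w', hne', hu', hv', hw'⟩ := eq_of_mem_quad hm' (h' ▸ hs)
  obtain ⟨z, hz, hz'⟩ := edge_meet hne hw hw'
  have hz' : z = a ∨ z = b ∨ z = c ∨ z = d := by
    rcases hz' with rfl | rfl <;> assumption
  obtain ⟨p', q', g', u₁, u₂, v₁, v₂, hq, hv⟩ := exists_quad_eq (x₁ := x₁) (x₂ := x₂) (y₁ := y₁)
    (y₂ := y₂) hz'
  rw [hv]
  rw [hq] at h'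
  rcases hz with rfl | rfl
  · exact bigon_quad_core hf hs hn h h'
  · rw [bigon_swap] at h
    exact bigon_quad_core hf hs hn h h'

theorem bigon_bigon_overlap (hf : RespectsBelow n f) (hs : IsWeb s) (hn : s.card ≤ n)
    {e p x y e' p' x' y' : ℕ} (h : s = N + bigon e p x y) (h' : s = N' + bigon e' p' x' y')
    {m : WNode} (hm : m ∈ bigon e p x y) (hm' : m ∈ bigon e' p' x' y') :
    f (N + {WNode.joint y x}) = f (N' + {WNode.joint y' x'}) := by
  obtain ⟨w, hne, hw⟩ := eq_of_mem_bigon hm (h ▸ hs)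
  obtain ⟨w', hne', hw'⟩ := eq_of_mem_bigon hm' (h' ▸ hs)
  obtain ⟨z, hz, hz'⟩ := edge_meet hne hw hw'
  rcases hz with rfl | rfl <;> rcases hz' with rfl | rfl
  · exact bigon_bigon_core hf hs hn h h'
  · rw [bigon_swap e'] at h'
    exact bigon_bigon_core hf hs hn h h'
  · rw [bigon_swap e] at h
    exact bigon_bigon_core hf hs hn h h'
  · rw [bigon_swap e] at h
    rw [bigon_swap e'] at h'
    exact bigon_bigon_core hf hs hn h h'

theorem quad_quad_overlap (hf : RespectsBelow n f) (hs : IsWeb s) (hn : s.card ≤ n)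
    {a b c d x₁ x₂ y₁ y₂ a' b' c' d' x₁' x₂' y₁' y₂' : ℕ}
    (h : s = N + quad a b c d x₁ x₂ y₁ y₂) (h' : s = N' + quad a' b' c' d' x₁' x₂' y₁' y₂')
    {m : WNode} (hm : m ∈ quad a b c d x₁ x₂ y₁ y₂)
    (hm' : m ∈ quad a' b' c' d' x₁' x₂' y₁' y₂') :
    quadValue f N x₁ x₂ y₁ y₂ = quadValue f N' x₁' x₂' y₁' y₂' := by
  obtain ⟨u, v, w, hne, hu, hv, hw⟩ := eq_of_mem_quad hm (h ▸ hs)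
  obtain ⟨u', v', w', hne', hu', hv', hw'⟩ := eq_of_mem_quad hm' (h' ▸ hs)
  obtain ⟨z, hz, hz'⟩ := edge_meet hne hw hw'
  have hz' : z = a' ∨ z = b' ∨ z = c' ∨ z = d' := by
    rcases hz' with rfl | rfl <;> assumption
  have hz : z = a ∨ z = b ∨ z = c ∨ z = d := by
    rcases hz with rfl | rfl <;> assumption
  obtain ⟨_, _, _, _, _, _, _, hq, hv⟩ := exists_quad_eq (x₁ := x₁) (x₂ := x₂) (y₁ := y₁)
    (y₂ := y₂) hz
  obtain ⟨_, _, _, _, _, _, _, hq', hv'⟩ := exists_quad_eq (x₁ := x₁') (x₂ := x₂') (y₁ := y₁')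
    (y₂ := y₂') hz'
  rw [hv, hv']
  exact quad_quad_core hf hs hn (hq ▸ h) (hq' ▸ h')

/-- Reductions at disjoint places commute. -/
theorem rule_rule_disjoint (hf : RespectsBelow n f) {M : Multiset WNode}
    (hs : IsWeb (M + P + P')) (hn : (M + P + P').card ≤ n) (hr : LocalRule P L)
    (hr' : LocalRule P' L') : combination f (M + P) L' = combination f (M + P') L := by
  -- After one rule has been applied, every term has fewer nodes than the bound, so the other rule
  -- may be applied in each. The resulting double sum is symmetric in the two rules.
  have key : ∀ {M P P' : Multiset WNode} {L L' : List (GraphPoly × Multiset WNode)},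
      IsWeb (M + P + P') → (M + P + P').card ≤ n → LocalRule P L → LocalRule P' L' →
      combination f (M + P) L' = (L'.map fun p' => p'.1 * combination f (M + p'.2) L).sum := by
    intro M P P' L L' hs hn hr hr'
    rw [combination]
    congr 1
    refine List.map_congr_left fun p hp => ?_
    have h1 := hr'.isWeb hs p hp
    have h2 := hr'.card_lt p hp
    rw [add_right_comm] at h1 ⊢
    simp only [Multiset.card_add] at hn
    rw [hf.rule hr h1 (by simp only [Multiset.card_add]; omega)]
  rw [key hs hn hr hr', key (by rwa [add_right_comm] at hs) (by rwa [add_right_comm] at hn) hr' hr]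
  have swap : ∀ (L L' : List (GraphPoly × Multiset WNode))
      (F G : Multiset WNode → Multiset WNode → GraphPoly), (∀ Q Q', F Q Q' = G Q' Q) →
      (L'.map fun p' => p'.1 * (L.map fun p => p.1 * F p.2 p'.2).sum).sum =
        (L.map fun p => p.1 * (L'.map fun p' => p'.1 * G p'.2 p.2).sum).sum := by
    intro L L' F G hFG
    simp only [← List.sum_map_mul_left, hFG]
    induction L with
    | nil => simp
    | cons p L ih =>
      simp only [List.map_cons, List.sum_cons, List.sum_map_add, ih, mul_left_comm]
  exact swap L L' (fun Q Q' => f (M + Q' + Q)) (fun Q' Q => f (M + Q + Q'))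
    fun Q Q' => by rw [add_right_comm]

theorem rule_rule (hf : RespectsBelow n f) (hs : IsWeb s) (hn : s.card ≤ n)
    (h : s = N + P) (h' : s = N' + P') (hr : LocalRule P L) (hr' : LocalRule P' L') :
    combination f N L = combination f N' L' := by
  classical
  by_cases hd : ∃ m ∈ P, m ∈ P'
  · obtain ⟨m, hm, hm'⟩ := hd
    cases hr with
    | circle a =>
      obtain rfl := Multiset.mem_singleton.1 hm
      cases hr' with
      | circle b =>
        obtain rfl : a = b := by simpa using hm'
        rw [add_right_cancel (h.symm.trans h')]
      | bigon e p x y => simp [bigon] at hm'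
      | quad a b c d x₁ x₂ y₁ y₂ => simp [quad] at hm'
    | bigon e p x y =>
      cases hr' with
      | circle b =>
        obtain rfl := Multiset.mem_singleton.1 hm'
        simp [bigon] at hm
      | bigon e' p' x' y' =>
        rw [combination_bigon, combination_bigon, bigon_bigon_overlap hf hs hn h h' hm hm']
      | quad a b c d x₁ x₂ y₁ y₂ =>
        rw [combination_bigon, combination_quad, bigon_quad_overlap hf hs hn h h' hm hm']
    | quad a b c d x₁ x₂ y₁ y₂ =>
      cases hr' with
      | circle b =>
        obtain rfl := Multiset.mem_singleton.1 hm'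
        simp [quad] at hm
      | bigon e' p' x' y' =>
        rw [combination_bigon, combination_quad, bigon_quad_overlap hf hs hn h' h hm' hm]
      | quad a' b' c' d' x₁' x₂' y₁' y₂' =>
        rw [combination_quad, combination_quad, quad_quad_overlap hf hs hn h h' hm hm']
  -- Patterns without a common node are disjoint as multisets, so each survives the removal of the
  -- other.
  · have hle : P' ≤ N := by
      rw [Multiset.le_iff_count]
      intro m
      by_cases hm : m ∈ P'
      · have h1 : P'.count m ≤ s.count m := Multiset.count_le_of_le m (h' ▸ by simp)
        have h2 : P.count m = 0 := Multiset.count_eq_zero.2 fun hp => hd ⟨m, hp, hm⟩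
        rwa [h, Multiset.count_add, h2] at h1
      · rw [Multiset.count_eq_zero.2 hm]
        exact Nat.zero_le _
    obtain ⟨M, rfl⟩ := Multiset.le_iff_exists_add.1 hle
    obtain rfl : N' = M + P := by
      refine add_right_cancel (h'.symm.trans (h.trans ?_))
      rw [add_assoc, add_comm]
    subst h
    rw [add_comm P' M] at hs hn ⊢
    rw [add_right_comm] at hs hn
    exact (rule_rule_disjoint hf hs hn hr hr').symm

/-- The joint lies outside the pattern, and a pattern stays a pattern under any renaming of edges;
so the two reductions can be done in either order. -/
theorem joint_rule (hf : RespectsBelow n f) (hs : IsWeb s) (hn : s.card ≤ n)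
    {a b : ℕ} (hab : a ≠ b) (h : s = N + {WNode.joint a b}) (h' : s = N' + P)
    (hr : LocalRule P L) : f (relabelAll (Function.update id b a) N) = combination f N' L := by
  have hm : WNode.joint a b ∈ N' := by
    have : WNode.joint a b ∈ N' + P := h' ▸ h ▸ by simp
    exact (Multiset.mem_add.1 this).resolve_right fun hp => hab (hr.eq_of_joint_mem hp)
  obtain ⟨M, rfl⟩ := Multiset.exists_cons_of_mem hm
  rw [← Multiset.singleton_add, add_comm _ M] at h' ⊢
  obtain rfl : N = M + P := by
    refine add_right_cancel (h.symm.trans (h'.trans ?_))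
    rw [add_right_comm]
  have hw := (h ▸ hs).eraseJoint hab
  have hc : s.card = M.card + P.card + 1 := by rw [h]; simp
  rw [relabelAll, Multiset.map_add] at hw ⊢
  rw [hf.rule (hr.relabel _) hw (by simp; omega), combination, combination, List.map_map]
  congr 1
  refine List.map_congr_left fun p hp => ?_
  have h1 := hr.isWeb (h' ▸ hs) p hp
  have h2 := hr.card_lt p hp
  rw [add_right_comm] at h1 ⊢
  rw [hf.joint h1 (by simp; omega) hab, relabelAll, Multiset.map_add]
  rfl

theorem joint_joint (hf : RespectsBelow n f) (hs : IsWeb s) (hn : s.card ≤ n)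
    {a b c d : ℕ} (hab : a ≠ b) (hcd : c ≠ d) (h : s = N + {WNode.joint a b})
    (h' : s = N' + {WNode.joint c d}) :
    f (relabelAll (Function.update id b a) N) = f (relabelAll (Function.update id d c) N') := by
  by_cases he : WNode.joint c d = WNode.joint a b
  · injection he with h1 h2
    subst h1 h2
    rw [add_right_cancel (h.symm.trans h')]
  obtain ⟨M, rfl, rfl⟩ := exists_common_rest (N := N) (N' := N') (P := 0)
    (by simpa using h.symm.trans h') (Ne.symm he)
  have hw1 := (h ▸ hs).eraseJoint hab
  have hw2 := (h' ▸ hs).eraseJoint hcd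
  have hc : s.card = M.card + 2 := by rw [h]; simp
  have hac : a ≠ c := by
    rintro rfl
    exact (h ▸ hs).not_mem_ins_of_right (x := a) (by simp [insOf, WNode.ins])
      (by simp [insOf, WNode.ins])
  have hbd : b ≠ d := by
    rintro rfl
    exact (h ▸ hs).not_mem_outs_of_right (x := b) (by simp [outsOf, WNode.outs])
      (by simp [outsOf, WNode.outs])
  have e1 : relabelAll (Function.update id b a) (M + {WNode.joint c d}) =
      relabelAll (Function.update id b a) M + {WNode.joint (Function.update id b a c) d} := by
    simp [relabelAll, WNode.relabel, Function.update_of_ne hbd.symm]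
  have e2 : relabelAll (Function.update id d c) (M + {WNode.joint a b}) =
      relabelAll (Function.update id d c) M + {WNode.joint (Function.update id d c a) b} := by
    simp [relabelAll, WNode.relabel, Function.update_of_ne hbd]
  -- If the joints run from `a` to `b` and from `b` to `a`, they form a circle. The two erasures
  -- leave it with different names, which an exchange identifies.
  by_cases hcyc : b = c ∧ d = a
  · obtain ⟨rfl, rfl⟩ := hcyc
    rw [← hf.iso _ hw1 (by simp; omega) (Equiv.swap b d), relabelAll_relabelAll]
    simp only [relabelAll, Multiset.map_add, Multiset.map_singleton, WNode.relabel]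
    congr 2
    · congr 1
      congr 1
      funext x
      simp only [Function.update_apply, id]
      split_ifs <;> simp_all [Equiv.swap_apply_of_ne_of_ne]
    · simp [hcd, hab]
  -- Otherwise the second joint still connects different edges after the first erasure. Erasing both
  -- leads to the same composite renaming.
  · have n1 : Function.update id b a c ≠ d := by
      simp only [Function.update_apply, id]
      split_ifs with h
      · exact fun h' => hcyc ⟨h.symm, h'.symm⟩
      · exact hcd
    have n2 : Function.update id d c a ≠ b := by
      simp only [Function.update_apply, id]
      split_ifs with h
      · exact fun h' => hcyc ⟨h'.symm, h.symm⟩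
      · exact hab
    rw [e1] at hw1 ⊢
    rw [e2] at hw2 ⊢
    rw [hf.joint hw1 (by simp; omega) n1, hf.joint hw2 (by simp; omega) n2, relabelAll_relabelAll,
      relabelAll_relabelAll]
    congr 2
    funext x
    simp only [Function.update_apply, id]
    split_ifs <;> simp_all

/-- Any two reductions of a web have the same result. -/
theorem Step.unique (hf : RespectsBelow n f) (hs : IsWeb s) (hn : s.card ≤ n)
    {v w : GraphPoly} (hv : Step f s v) (hw : Step f s w) : v = w := by
  cases hv with
  | joint N a b hab h =>
    cases hw with
    | joint N' c d hcd h' => exact joint_joint hf hs hn hab hcd h h'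
    | rule N' P L hr h' => exact joint_rule hf hs hn hab h h' hr
  | rule N P L hr h =>
    cases hw with
    | joint N' c d hcd h' => exact (joint_rule hf hs hn hcd h' h hr).symm
    | rule N' P' L' hr' h' => exact rule_rule hf hs hn h h' hr hr'

end Confluence


/-! ### Existence and uniqueness of the evaluation -/

section Normal

variable {f g : Multiset WNode → GraphPoly} {s P Q : Multiset WNode} {v : GraphPoly}

/-- No reduction applies to the web. -/
def IsNormal (s : Multiset WNode) : Prop := ∀ f v, ¬ Step f s v

/-- The result of a reduction consults the evaluation only at webs with fewer nodes. -/
theorem Step.congr (hs : IsWeb s) (h : Step f s v)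
    (hfg : ∀ t, IsWeb t → t.card < s.card → f t = g t) : Step g s v := by
  cases h with
  | joint N a b hab h =>
    rw [hfg _ ((h ▸ hs).eraseJoint hab) (by rw [h]; simp)]
    exact Step.joint N a b hab h
  | rule N P L hr h =>
    have : combination f N L = combination g N L := by
      rw [combination, combination]
      congr 1
      refine List.map_congr_left fun p hp => ?_
      have := hr.card_lt p hp
      rw [hfg _ (hr.isWeb (h ▸ hs) p hp) (by rw [h]; simpa using this)]
    rw [this]
    exact Step.rule N P L hr h

theorem relabelAll_perm_symm (σ : Equiv.Perm ℕ) (s : Multiset WNode) :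
    relabelAll σ.symm (relabelAll σ s) = s := by
  rw [relabelAll_relabelAll]
  simp [relabelAll_id]

theorem relabelAll_symm_perm (σ : Equiv.Perm ℕ) (s : Multiset WNode) :
    relabelAll σ (relabelAll σ.symm s) = s := by
  rw [relabelAll_relabelAll]
  simp [relabelAll_id]

theorem Step.relabel (σ : Equiv.Perm ℕ) (h : Step f s v) :
    Step (fun t => f (relabelAll σ.symm t)) (relabelAll σ s) v := by
  cases h with
  | joint N a b hab h =>
    have e : f (relabelAll (Function.update id b a) N) = f (relabelAll σ.symm
        (relabelAll (Function.update id (σ b) (σ a)) (relabelAll σ N))) := by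
      rw [relabelAll_relabelAll, relabelAll_relabelAll]
      congr 2
      funext x
      by_cases hx : x = b
      · simp [hx]
      · have : σ x ≠ σ b := fun h => hx (σ.injective h)
        simp [Function.update_of_ne hx, Function.update_of_ne this]
    rw [e]
    refine Step.joint (f := fun t => f (relabelAll σ.symm t)) (relabelAll σ N) (σ a) (σ b)
      (fun h => hab (σ.injective h)) ?_
    simp [h, relabelAll, WNode.relabel]
  | rule N P L hr h =>
    have e : combination f N L = combination (fun t => f (relabelAll σ.symm t)) (relabelAll σ N)
        (L.map fun p => (p.1, relabelAll σ p.2)) := by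
      simp only [combination, List.map_map, ← Multiset.map_add, relabelAll_perm_symm,
        Function.comp_def]
    rw [e]
    refine Step.rule (relabelAll σ N) _ _ (hr.relabel σ) ?_
    simp [h, relabelAll]

theorem IsNormal.relabel (h : IsNormal s) (σ : Equiv.Perm ℕ) : IsNormal (relabelAll σ s) := by
  intro f v hv
  have := hv.relabel σ.symm
  rw [relabelAll_perm_symm] at this
  exact h _ _ this

theorem IsNormal.of_add_left (h : IsNormal (P + Q)) : IsNormal P := by
  intro f v hv
  cases hv with
  | joint N a b hab h' =>
    exact h f _ (Step.joint (N + Q) a b hab (by rw [h', add_right_comm]))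
  | rule N P' L hr h' =>
    exact h f _ (Step.rule (N + Q) P' L hr (by rw [h', add_right_comm]))

theorem IsNormal.of_add_right (h : IsNormal (P + Q)) : IsNormal Q :=
  IsNormal.of_add_left (add_comm P Q ▸ h)

theorem Web.Irreducible.isNormal {G : Web} (h : G.Irreducible) : IsNormal G.nodes := by
  intro f v hv
  cases hv with
  | joint N a b hab h' => exact h.noJoint a b (by simp [h'])
  | rule N P L hr h' =>
    cases hr with
    | circle a => exact h.noJoint a a (by simp [h'])
    | bigon e p x y => exact h.noBigon e p x y (by simp [h'])
    | quad a b c d x₁ x₂ y₁ y₂ => exact h.noQuad a b c d x₁ x₂ y₁ y₂ (by simp [h'])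

theorem IsNormal.irreducible {G : Web} (h : IsNormal G.nodes) (hc : G.Connected) :
    G.Irreducible where
  connected := hc
  noJoint a b hab := by
    obtain ⟨N, hN⟩ := Multiset.exists_cons_of_mem hab
    rw [← Multiset.singleton_add, add_comm] at hN
    by_cases e : a = b
    · subst e
      exact h (fun _ => 0) _ (Step.rule N _ _ (LocalRule.circle a) hN)
    · exact h (fun _ => 0) _ (Step.joint N a b e hN)
  noBigon e p x y hle := by
    obtain ⟨N, hN⟩ := Multiset.le_iff_exists_add.1 hle
    rw [add_comm] at hN
    exact h (fun _ => 0) _ (Step.rule N _ _ (LocalRule.bigon e p x y) hN)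
  noQuad a b c d x₁ x₂ y₁ y₂ hle := by
    obtain ⟨N, hN⟩ := Multiset.le_iff_exists_add.1 hle
    rw [add_comm] at hN
    exact h (fun _ => 0) _ (Step.rule N _ _ (LocalRule.quad a b c d x₁ x₂ y₁ y₂) hN)

theorem Web.Irreducible.relabel {G H : Web} (h : G.Irreducible) (σ : Equiv.Perm ℕ)
    (e : H.nodes = relabelAll σ G.nodes) : H.Irreducible := by
  refine IsNormal.irreducible (e ▸ h.isNormal.relabel σ) ⟨fun h0 => h.connected.1 ?_, ?_⟩
  · rw [h0] at e
    simpa using e.symm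
  · intro P Q hPQ
    have hG : G.nodes = relabelAll σ.symm P.nodes + relabelAll σ.symm Q.nodes := by
      rw [← relabelAll_perm_symm σ G.nodes, ← e, hPQ, relabelAll, Multiset.map_add]
    have := h.connected.2 (P.isWeb.relabelAll σ.symm).toWeb (Q.isWeb.relabelAll σ.symm).toWeb hG
    simpa [IsWeb.toWeb, relabelAll] using this

/-- A pattern of a local rule lies in one part of a disjoint union. -/
theorem le_or_le_of_localRule {P Q R : Multiset WNode} {L : List (GraphPoly × Multiset WNode)}
    (hr : LocalRule R L) (hPQ : IsWeb (P + Q)) (hP : IsWeb P) (hQ : IsWeb Q) (hR : R ≤ P + Q) :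
    R ≤ P ∨ R ≤ Q := by
  classical
  have hPle : P ≤ P + Q := by simp
  have hQle : Q ≤ P + Q := by simp
  have hnd : R.Nodup := Multiset.nodup_of_le hR hPQ.nodup_nodes
  have hmem : ∀ m ∈ R, m ∈ P + Q := fun m hm => Multiset.mem_of_le hR hm
  rw [Multiset.le_iff_subset hnd, Multiset.le_iff_subset hnd]
  cases hr with
  | circle a =>
    rcases Multiset.mem_add.1 (hmem (WNode.joint a a) (by simp)) with h | h
    · exact Or.inl fun m hm => by obtain rfl := Multiset.mem_singleton.1 hm; exact h
    · exact Or.inr fun m hm => by obtain rfl := Multiset.mem_singleton.1 hm; exact h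
  | bigon e p x y =>
    have m1 := hmem (WNode.source {e, p, x}) (by simp [bigon])
    have m2 := hmem (WNode.sink {e, p, y}) (by simp [bigon])
    have key : ∀ S, IsWeb S → S ≤ P + Q → WNode.source {e, p, x} ∈ S → bigon e p x y ⊆ S := by
      intro S hS hle h m hm
      have h2 : WNode.sink {e, p, y} ∈ S := hPQ.mem_of_mem_outs hS hle (e := e) h m2
        (by simp [WNode.outs]) (by simp [WNode.ins])
      simp only [bigon, Multiset.insert_eq_cons (WNode.source _), Multiset.mem_cons,
        Multiset.mem_singleton] at hm
      rcases hm with rfl | rfl <;> assumption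
    exact (Multiset.mem_add.1 m1).imp (key P hP hPle) (key Q hQ hQle)
  | quad a b c d x₁ x₂ y₁ y₂ =>
    have m1 := hmem (WNode.source {a, b, x₁}) (by simp [quad])
    have m2 := hmem (WNode.source {c, d, x₂}) (by simp [quad])
    have m3 := hmem (WNode.sink {a, c, y₁}) (by simp [quad])
    have m4 := hmem (WNode.sink {b, d, y₂}) (by simp [quad])
    have key : ∀ S, IsWeb S → S ≤ P + Q → WNode.source {a, b, x₁} ∈ S →
        quad a b c d x₁ x₂ y₁ y₂ ⊆ S := by
      intro S hS hle h m hm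
      have h3 : WNode.sink {a, c, y₁} ∈ S := hPQ.mem_of_mem_outs hS hle (e := a) h m3
        (by simp [WNode.outs]) (by simp [WNode.ins])
      have h4 : WNode.sink {b, d, y₂} ∈ S := hPQ.mem_of_mem_outs hS hle (e := b) h m4
        (by simp [WNode.outs]) (by simp [WNode.ins])
      have h2 : WNode.source {c, d, x₂} ∈ S := hPQ.mem_of_mem_ins hS hle (e := c) h3 m2
        (by simp [WNode.ins]) (by simp [WNode.outs])
      simp only [quad, Multiset.insert_eq_cons (WNode.source _),
        Multiset.insert_eq_cons (WNode.sink _), Multiset.mem_cons, Multiset.mem_singleton] at hm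
      rcases hm with rfl | rfl | rfl | rfl <;> assumption
    exact (Multiset.mem_add.1 m1).imp (key P hP hPle) (key Q hQ hQle)

/-- Patterns are connected, so disjoint union creates no new reduction. -/
theorem IsNormal.add (hPQ : IsWeb (P + Q)) (hP : IsWeb P) (hQ : IsWeb Q) (h : IsNormal P)
    (h' : IsNormal Q) : IsNormal (P + Q) := by
  intro f v hv
  cases hv with
  | joint N a b hab hN =>
    have : WNode.joint a b ∈ P + Q := hN ▸ by simp
    rcases Multiset.mem_add.1 this with hm | hm <;>
      obtain ⟨M, hM⟩ := Multiset.exists_cons_of_mem hm <;>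
      rw [← Multiset.singleton_add, add_comm] at hM
    · exact h f _ (Step.joint M a b hab hM)
    · exact h' f _ (Step.joint M a b hab hM)
  | rule N R L hr hN =>
    rcases le_or_le_of_localRule hr hPQ hP hQ (hN ▸ by simp) with hle | hle <;>
      obtain ⟨M, hM⟩ := Multiset.le_iff_exists_add.1 hle <;> rw [add_comm] at hM
    · exact h f _ (Step.rule M R L hr hM)
    · exact h' f _ (Step.rule M R L hr hM)

end Normal

/-- Two decompositions of a web have a common refinement. -/
theorem exists_common_refinement {P Q P' Q' : Multiset WNode} (hs : IsWeb (P + Q))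
    (hP : IsWeb P) (hP' : IsWeb P') (hQ' : IsWeb Q') (h : P + Q = P' + Q') :
    ∃ a b c d, IsWeb a ∧ IsWeb b ∧ IsWeb c ∧ IsWeb d ∧
      P = a + b ∧ Q = c + d ∧ P' = a + c ∧ Q' = b + d := by
  classical
  have e1 : P = P.filter (· ∈ P') + P.filter (· ∉ P') := (Multiset.filter_add_not _ _).symm
  have e2 : Q = Q.filter (· ∈ P') + Q.filter (· ∉ P') := (Multiset.filter_add_not _ _).symm
  have hdisj : ∀ m ∈ Q', m ∉ P' := fun m hm hm' => by
    have := hs.nodup_nodes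
    rw [h] at this
    exact Multiset.disjoint_left.1 (Multiset.nodup_add.1 this).2.2 hm' hm
  have e3 : P' = P.filter (· ∈ P') + Q.filter (· ∈ P') := by
    rw [← Multiset.filter_add, h, Multiset.filter_add, Multiset.filter_eq_self.2 (fun _ h => h),
      Multiset.filter_eq_nil.2 hdisj, add_zero]
  have e4 : Q' = P.filter (· ∉ P') + Q.filter (· ∉ P') := by
    rw [← Multiset.filter_add, h, Multiset.filter_add,
      Multiset.filter_eq_nil.2 (fun _ h h' => h' h), Multiset.filter_eq_self.2 hdisj, zero_add]
  have hPs : P ≤ P + Q := by simp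
  have hPs' : P' ≤ P + Q := by rw [h]; simp
  -- An edge with one end in both subwebs has its other end in both as well, so the intersection is
  -- a web. The other three parts are complements of webs in webs.
  have ha : IsWeb (P.filter (· ∈ P')) := by
    have hle : P.filter (· ∈ P') ≤ P := Multiset.filter_le _ _
    obtain ⟨R, hR⟩ := Multiset.le_iff_exists_add.1 hle
    have n1 : (insOf (P.filter (· ∈ P'))).Nodup := by
      have := hP.nodup
      rw [hR, insOf, Multiset.add_bind] at this
      exact (Multiset.nodup_add.1 this).1
    have n2 : (outsOf (P.filter (· ∈ P'))).Nodup := by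
      have := hP.nodup_outs
      rw [hR, outsOf, Multiset.add_bind] at this
      exact (Multiset.nodup_add.1 this).1
    refine ⟨n1, (Multiset.Nodup.ext n1 n2).2 fun e => ⟨fun he => ?_, fun he => ?_⟩,
      fun n hn => hP.trivalent n (Multiset.mem_of_le hle hn)⟩
    · obtain ⟨n, hn, hen⟩ := Multiset.mem_bind.1 he
      obtain ⟨hn1, hn2⟩ := Multiset.mem_filter.1 hn
      have : e ∈ outsOf P := hP.balanced ▸ Multiset.mem_bind.2 ⟨n, hn1, hen⟩
      obtain ⟨m, hm, hem⟩ := Multiset.mem_bind.1 this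
      exact Multiset.mem_bind.2 ⟨m, Multiset.mem_filter.2 ⟨hm, hs.mem_of_mem_ins hP' hPs' hn2
        (Multiset.mem_of_le hPs hm) hen hem⟩, hem⟩
    · obtain ⟨n, hn, hen⟩ := Multiset.mem_bind.1 he
      obtain ⟨hn1, hn2⟩ := Multiset.mem_filter.1 hn
      have : e ∈ insOf P := hP.balanced ▸ Multiset.mem_bind.2 ⟨n, hn1, hen⟩
      obtain ⟨m, hm, hem⟩ := Multiset.mem_bind.1 this
      exact Multiset.mem_bind.2 ⟨m, Multiset.mem_filter.2 ⟨hm, hs.mem_of_mem_outs hP' hPs' hn2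
        (Multiset.mem_of_le hPs hm) hen hem⟩, hem⟩
  have hb : IsWeb (P.filter (· ∉ P')) := by
    refine IsWeb.of_add_left (P := P.filter (· ∈ P')) ?_ ha
    rwa [add_comm, ← e1]
  have hc : IsWeb (Q.filter (· ∈ P')) := by
    refine IsWeb.of_add_left (P := P.filter (· ∈ P')) ?_ ha
    rwa [add_comm, ← e3]
  have hd : IsWeb (Q.filter (· ∉ P')) := by
    refine IsWeb.of_add_left (P := P.filter (· ∉ P')) ?_ hb
    rwa [add_comm, ← e4]
  exact ⟨_, _, _, _, ha, hb, hc, hd, e1, e2, e3, e4⟩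

/-- `Value s v` holds if reductions of the web `s` lead to `v`. -/
inductive Value : Multiset WNode → GraphPoly → Prop
  | empty : Value 0 1
  | irreducible (G : Web) (h : G.Irreducible) :
      Value G.nodes (MvPolynomial.X (Quotient.mk _ ⟨G, h⟩))
  -- Normality keeps this clause from competing with reductions; multiplicativity for all webs is
  -- proved afterwards as `value_add`.
  | union (P Q : Multiset WNode) (u v : GraphPoly) (hP : IsWeb P) (hQ : IsWeb Q) (hP0 : P ≠ 0)
      (hQ0 : Q ≠ 0) (hn : IsNormal (P + Q)) (hu : Value P u) (hv : Value Q v) :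
      Value (P + Q) (u * v)
  -- The function `g` assigns values to all smaller webs at once, so a single clause covers rules
  -- with one or several resulting webs.
  | step (s : Multiset WNode) (g : Multiset WNode → GraphPoly) (v : GraphPoly)
      (hg : ∀ t, IsWeb t → t.card < s.card → Value t (g t)) (h : Step g s v) : Value s v

theorem Value.relabel {s : Multiset WNode} {v : GraphPoly} (h : Value s v) (σ : Equiv.Perm ℕ) :
    Value (relabelAll σ s) v := by
  induction h with
  | empty => exact Value.empty
  | irreducible G h =>
    have h' := h.relabel (H := (G.isWeb.relabelAll σ).toWeb) σ rfl
    have e : (Quotient.mk irreducibleSetoid ⟨G, h⟩) =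
        Quotient.mk _ ⟨(G.isWeb.relabelAll σ).toWeb, h'⟩ := Quotient.sound ⟨σ, rfl⟩
    rw [e]
    exact Value.irreducible _ h'
  | union P Q u v hP hQ hP0 hQ0 hn _ _ ihu ihv =>
    have := hn.relabel σ
    rw [relabelAll, Multiset.map_add] at this ⊢
    exact Value.union _ _ u v (hP.relabelAll σ) (hQ.relabelAll σ) (by simpa using hP0)
      (by simpa using hQ0) this ihu ihv
  | step s g v _ hstep ih =>
    refine Value.step _ (fun t => g (relabelAll σ.symm t)) v (fun t ht hc => ?_) (hstep.relabel σ)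
    have := ih (relabelAll σ.symm t) (ht.relabelAll σ.symm) (by simpa using hc)
    rwa [relabelAll_symm_perm] at this

open Classical in
/-- The value of a web. -/
noncomputable def value (s : Multiset WNode) : GraphPoly :=
  if h : ∃ v, Value s v then h.choose else 0

/-- Webs with fewer than `n` nodes have exactly one value. -/
def UniqueBelow (n : ℕ) : Prop :=
  ∀ s, IsWeb s → s.card < n → (∃ v, Value s v) ∧ ∀ v w, Value s v → Value s w → v = w

namespace UniqueBelow

variable {n : ℕ} {s P Q : Multiset WNode} {v : GraphPoly}

theorem value_spec (hU : UniqueBelow n) (hs : IsWeb s) (hn : s.card < n) : Value s (value s) := by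
  have h := (hU s hs hn).1
  rw [value, dif_pos h]
  exact h.choose_spec

theorem eq_value (hU : UniqueBelow n) (hs : IsWeb s) (hn : s.card < n) (hv : Value s v) :
    value s = v :=
  (hU s hs hn).2 _ _ (hU.value_spec hs hn) hv

/-- This closes the induction: uniqueness of values below `n` supplies the hypothesis under which
reductions of webs with at most `n` nodes are confluent. -/
theorem respectsBelow (hU : UniqueBelow n) : RespectsBelow n value where
  iso s hs hn σ := hU.eq_value (hs.relabelAll σ) (by simpa using hn) ((hU.value_spec hs hn).relabel σ)
  step s hs hn v hv := hU.eq_value hs hn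
    (Value.step s value v (fun t ht hc => hU.value_spec ht (hc.trans hn)) hv)

theorem value_zero (hU : UniqueBelow n) (hn : 0 < n) : value 0 = 1 :=
  hU.eq_value isWeb_zero (by simpa using hn) Value.empty

theorem value_add_of_isNormal (hU : UniqueBelow n) (hs : IsWeb (P + Q)) (hP : IsWeb P)
    (hQ : IsWeb Q) (hn : (P + Q).card < n) (hN : IsNormal (P + Q)) :
    value (P + Q) = value P * value Q := by
  rcases eq_or_ne P 0 with rfl | hP0
  · rw [hU.value_zero (by omega), zero_add, one_mul]
  rcases eq_or_ne Q 0 with rfl | hQ0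
  · rw [hU.value_zero (by omega), add_zero, mul_one]
  have hc := Multiset.card_add P Q
  exact hU.eq_value hs hn (Value.union P Q _ _ hP hQ hP0 hQ0 hN
    (hU.value_spec hP (by omega)) (hU.value_spec hQ (by omega)))

/-- The last step of the evaluation of a web. -/
theorem cases_value (hU : UniqueBelow n) (hs : IsWeb s) (hn : s.card ≤ n) (h : Value s v) :
    Step value s v ∨ (IsNormal s ∧ ((s = 0 ∧ v = 1) ∨
      (∃ (G : Web) (h : G.Irreducible), s = G.nodes ∧ v = MvPolynomial.X (Quotient.mk _ ⟨G, h⟩)) ∨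
      ∃ P Q, IsWeb P ∧ IsWeb Q ∧ P ≠ 0 ∧ Q ≠ 0 ∧ s = P + Q ∧ v = value P * value Q)) := by
  cases h with
  | empty =>
    refine Or.inr ⟨fun f v hv => ?_, Or.inl ⟨rfl, rfl⟩⟩
    cases hv with
    | joint N a b hab h => simpa using congrArg Multiset.card h
    | rule N P L hr h =>
      have := congrArg Multiset.card h
      cases hr <;> simp [bigon, quad] at this
  | irreducible G h => exact Or.inr ⟨h.isNormal, Or.inr (Or.inl ⟨G, h, rfl, rfl⟩)⟩
  | union P Q u v hP hQ hP0 hQ0 hN hu hv =>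
    have h1 := Multiset.card_add P Q
    have h2 := Multiset.card_pos.2 hP0
    have h3 := Multiset.card_pos.2 hQ0
    exact Or.inr ⟨hN, Or.inr (Or.inr ⟨P, Q, hP, hQ, hP0, hQ0, rfl, by
      rw [hU.eq_value hP (by omega) hu, hU.eq_value hQ (by omega) hv]⟩)⟩
  | step _ g _ hg h =>
    exact Or.inl (h.congr hs fun t ht hc => (hU.eq_value ht (by omega) (hg t ht hc)).symm)

/-- In terms of the four parts of a common refinement both products are value a * value b * value c
* value d. -/
theorem union_unique (hU : UniqueBelow n) (hs : IsWeb s) (hn : s.card ≤ n) (hN : IsNormal s)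
    {P Q P' Q' : Multiset WNode} (hP : IsWeb P) (hQ : IsWeb Q) (hP' : IsWeb P') (hQ' : IsWeb Q')
    (hP0 : P ≠ 0) (hQ0 : Q ≠ 0) (hP0' : P' ≠ 0) (hQ0' : Q' ≠ 0) (h : s = P + Q)
    (h' : s = P' + Q') : value P * value Q = value P' * value Q' := by
  have h2 := Multiset.card_pos.2 hP0
  have h3 := Multiset.card_pos.2 hQ0
  have h4 := Multiset.card_pos.2 hP0'
  have h5 := Multiset.card_pos.2 hQ0'
  have c1 : s.card = P.card + Q.card := by rw [h, Multiset.card_add]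
  have c2 : s.card = P'.card + Q'.card := by rw [h', Multiset.card_add]
  have N1 : IsNormal P := (h ▸ hN).of_add_left
  have N2 : IsNormal Q := (h ▸ hN).of_add_right
  have N3 : IsNormal P' := (h' ▸ hN).of_add_left
  have N4 : IsNormal Q' := (h' ▸ hN).of_add_right
  obtain ⟨a, b, c, d, ha, hb, hc, hd, rfl, rfl, rfl, rfl⟩ :=
    exists_common_refinement (h ▸ hs) hP hP' hQ' (h.symm.trans h')
  rw [hU.value_add_of_isNormal hP ha hb (by omega) N1,
    hU.value_add_of_isNormal hQ hc hd (by omega) N2,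
    hU.value_add_of_isNormal hP' ha hc (by omega) N3,
    hU.value_add_of_isNormal hQ' hb hd (by omega) N4]
  ring

/-- A reducible web gets its value from any reduction, uniquely by `Step.unique`. A normal web is
empty, irreducible or a proper disjoint union; these cases exclude one another, and `union_unique`
settles the last. -/
theorem succ (hU : UniqueBelow n) : UniqueBelow (n + 1) := by
  intro s hs hn
  have hn : s.card ≤ n := by omega
  refine ⟨?_, fun v w hv hw => ?_⟩
  · by_cases hst : ∃ v, Step value s v
    · obtain ⟨v, hv⟩ := hst
      exact ⟨v, Value.step s value v (fun t ht hc => hU.value_spec ht (by omega)) hv⟩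
    · have hN : IsNormal s := by
        intro f v hv
        cases hv with
        | joint N a b hab h => exact hst ⟨_, Step.joint N a b hab h⟩
        | rule N P L hr h => exact hst ⟨_, Step.rule N P L hr h⟩
      rcases eq_or_ne s 0 with rfl | h0
      · exact ⟨1, Value.empty⟩
      · by_cases hc : hs.toWeb.Connected
        · exact ⟨_, Value.irreducible hs.toWeb (IsNormal.irreducible (G := hs.toWeb) hN hc)⟩
        · simp only [Web.Connected, not_and, not_forall, not_or] at hc
          obtain ⟨P, Q, h, hP0, hQ0⟩ := hc h0
          obtain rfl : s = P.nodes + Q.nodes := h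
          have h1 := Multiset.card_add P.nodes Q.nodes
          have h2 := Multiset.card_pos.2 hP0
          have h3 := Multiset.card_pos.2 hQ0
          exact ⟨_, Value.union _ _ _ _ P.isWeb Q.isWeb hP0 hQ0 hN
            (hU.value_spec P.isWeb (by omega)) (hU.value_spec Q.isWeb (by omega))⟩
  · rcases hU.cases_value hs hn hv with h1 | ⟨N1, h1⟩ <;>
      rcases hU.cases_value hs hn hw with h2 | ⟨N2, h2⟩
    · exact Step.unique hU.respectsBelow hs hn h1 h2
    · exact absurd h1 (N2 _ _)
    · exact absurd h2 (N1 _ _)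
    · rcases h1 with ⟨rfl, rfl⟩ | ⟨G, hG, rfl, rfl⟩ | ⟨P, Q, hP, hQ, hP0, hQ0, h, rfl⟩ <;>
        rcases h2 with ⟨e, rfl⟩ | ⟨G', hG', e, rfl⟩ | ⟨P', Q', hP', hQ', hP0', hQ0', h', rfl⟩
      · rfl
      · exact absurd e.symm hG'.connected.1
      · exact absurd (by simpa using h'.symm) (fun h : P' = 0 ∧ Q' = 0 => hP0' h.1)
      · exact absurd e hG.connected.1
      · obtain rfl : G = G' := Web.ext e
        rfl
      · rcases hG.connected.2 hP'.toWeb hQ'.toWeb h' with h | h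
        · exact absurd h hP0'
        · exact absurd h hQ0'
      · exact absurd (by simpa [e] using h.symm) (fun h : P = 0 ∧ Q = 0 => hP0 h.1)
      · rcases hG'.connected.2 hP.toWeb hQ.toWeb (e ▸ h) with h | h
        · exact absurd h hP0
        · exact absurd h hQ0
      · exact hU.union_unique hs hn N1 hP hQ hP' hQ' hP0 hQ0 hP0' hQ0' h h'

end UniqueBelow

theorem uniqueBelow (n : ℕ) : UniqueBelow n := by
  induction n with
  | zero => exact fun s _ h => absurd h (Nat.not_lt_zero _)
  | succ n ih => exact ih.succ

/-! ### The evaluation of webs and its characterization -/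

theorem value_respectsBelow (n : ℕ) : RespectsBelow n value := (uniqueBelow n).respectsBelow

theorem value_eq {s : Multiset WNode} {v : GraphPoly} (hs : IsWeb s) (h : Value s v) :
    value s = v := (uniqueBelow (s.card + 1)).eq_value hs (Nat.lt_succ_self _) h

theorem value_spec {s : Multiset WNode} (hs : IsWeb s) : Value s (value s) :=
  (uniqueBelow (s.card + 1)).value_spec hs (Nat.lt_succ_self _)

theorem value_relabelAll {s : Multiset WNode} (hs : IsWeb s) (σ : Equiv.Perm ℕ) :
    value (relabelAll σ s) = value s :=
  (value_respectsBelow (s.card + 1)).iso s hs (Nat.lt_succ_self _) σ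

theorem value_joint {N : Multiset WNode} {a b : ℕ} (hs : IsWeb (N + {WNode.joint a b}))
    (hab : a ≠ b) :
    value (N + {WNode.joint a b}) = value (relabelAll (Function.update id b a) N) :=
  (value_respectsBelow _).joint hs (Nat.lt_succ_self _) hab

theorem value_rule {N P : Multiset WNode} {L : List (GraphPoly × Multiset WNode)}
    (h : LocalRule P L) (hs : IsWeb (N + P)) : value (N + P) = combination value N L :=
  (value_respectsBelow _).rule h hs (Nat.lt_succ_self _)

/-- A reduction of one part is a reduction of the whole, and the number of nodes drops. When neither
part can be reduced, the union is normal and multiplicativity is built into `Value`. -/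
theorem value_add {P Q : Multiset WNode} (hPQ : IsWeb (P + Q)) (hP : IsWeb P) (hQ : IsWeb Q) :
    value (P + Q) = value P * value Q := by
  obtain ⟨n, hn⟩ : ∃ n, (P + Q).card = n := ⟨_, rfl⟩
  induction n using Nat.strong_induction_on generalizing P Q with
  | _ n ih =>
  have left : ∀ {P Q : Multiset WNode} {v : GraphPoly}, IsWeb (P + Q) → IsWeb P → IsWeb Q →
      (P + Q).card = n → Step value P v → value (P + Q) = value P * value Q := by
    intro P Q v hPQ hP hQ hn hst
    cases hst with
    | joint N a b hab h =>
      subst h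
      have e : N + {WNode.joint a b} + Q = N + Q + {WNode.joint a b} := add_right_comm _ _ _
      -- The edge `b` begins at the joint, hence outside `Q`, and so it does not end in `Q` either.
      have hQr : relabelAll (Function.update id b a) Q = Q := by
        have ho : b ∉ outsOf Q := by
          rw [add_comm] at hPQ
          exact hPQ.not_mem_outs_of_right (by simp [outsOf, WNode.outs])
        refine relabelAll_eq_self (fun x hx => ?_) fun x hx => ?_
        · rw [Function.update_of_ne, id]
          rintro rfl
          exact ho (hQ.balanced ▸ hx)
        · rw [Function.update_of_ne, id]
          rintro rfl
          exact ho hx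
      rw [e] at hPQ hn ⊢
      have hw := hPQ.eraseJoint hab
      rw [value_joint hPQ hab, value_joint hP hab]
      have hc : (relabelAll (Function.update id b a) N + Q).card < n := by
        rw [← hn]; simp
      rw [relabelAll, Multiset.map_add, ← relabelAll, ← relabelAll, hQr] at hw ⊢
      exact ih _ hc hw (hP.eraseJoint hab) hQ rfl
    | rule N R L hr h =>
      subst h
      have e : N + R + Q = N + Q + R := add_right_comm _ _ _
      rw [e] at hPQ hn ⊢
      rw [value_rule hr hPQ, value_rule hr hP, combination, combination, ← List.sum_map_mul_right]
      congr 1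
      refine List.map_congr_left fun p hp => ?_
      have h1 := hr.isWeb hPQ p hp
      have h2 := hr.card_lt p hp
      simp only [Multiset.card_add] at hn
      rw [add_right_comm] at h1 ⊢
      rw [ih _ (by simp only [Multiset.card_add]; omega) h1 (hr.isWeb hP p hp) hQ rfl, mul_assoc]
  by_cases h1 : ∃ v, Step value P v
  · exact left hPQ hP hQ hn h1.choose_spec
  by_cases h2 : ∃ v, Step value Q v
  · rw [add_comm P, mul_comm]
    rw [add_comm P] at hPQ hn
    exact left hPQ hQ hP hn h2.choose_spec
  have normal : ∀ {s}, (¬ ∃ v, Step value s v) → IsNormal s := by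
    intro s hs f v hv
    cases hv with
    | joint N a b hab h => exact hs ⟨_, Step.joint N a b hab h⟩
    | rule N P L hr h => exact hs ⟨_, Step.rule N P L hr h⟩
  exact (uniqueBelow (n + 1)).value_add_of_isNormal hPQ hP hQ (by omega)
    ((normal h1).add hPQ hP hQ (normal h2))

theorem isKuperbergEvaluation_value : IsKuperbergEvaluation fun G => value G.nodes where
  iso G H h := by
    obtain ⟨σ, h⟩ := h
    rw [h]
    exact value_relabelAll G.isWeb σ
  eraseJoint G H h := by
    obtain ⟨N, a, b, hab, h1, h2⟩ := h
    rw [h1, h2, value_joint (h1 ▸ G.isWeb) hab]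
  empty G h := by
    rw [h, value_eq isWeb_zero Value.empty]
  disjointUnion G P Q h := by
    rw [h, value_add (h ▸ G.isWeb) P.isWeb Q.isWeb]
  irreducible G h := value_eq G.isWeb (Value.irreducible G h)
  circle G a h := by
    have hw := G.isWeb
    rw [h, ← zero_add ({_} : Multiset WNode)] at hw ⊢
    rw [value_rule (LocalRule.circle a) hw]
    simp [combination, value_eq isWeb_zero Value.empty]
  bigon G H N e p x y h h' := by
    rw [h, h', value_rule (LocalRule.bigon e p x y) (h ▸ G.isWeb), combination_bigon]
  quad G H H' N a b c d x₁ x₂ y₁ y₂ h h1 h2 := by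
    rw [h, h1, h2, value_rule (LocalRule.quad a b c d x₁ x₂ y₁ y₂) (h ▸ G.isWeb), combination_quad,
      quadValue]

/-- Induction over the derivation of the value: each clause corresponds to axioms that any
evaluation satisfies. -/
theorem IsKuperbergEvaluation.eq_of_value {f : Web → GraphPoly} (hf : IsKuperbergEvaluation f)
    {s : Multiset WNode} {v : GraphPoly} (h : Value s v) : ∀ G : Web, G.nodes = s → f G = v := by
  induction h with
  | empty => exact hf.empty
  | irreducible G h =>
    intro G' hG
    obtain rfl : G' = G := Web.ext hG
    exact hf.irreducible G' h
  | union P Q u v hP hQ _ _ _ _ _ ihu ihv =>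
    intro G hG
    rw [hf.disjointUnion G hP.toWeb hQ.toWeb hG, ihu _ rfl, ihv _ rfl]
  | step s g v _ hst ih =>
    rintro G rfl
    have ih : ∀ H : Web, H.nodes.card < G.nodes.card → f H = g H.nodes := fun H hc =>
      ih H.nodes H.isWeb hc H rfl
    cases hst with
    | joint N a b hab h =>
      have hw := (h ▸ G.isWeb).eraseJoint hab
      rw [hf.eraseJoint G hw.toWeb ⟨N, a, b, hab, h, rfl⟩, ih _ (by rw [h]; simp [IsWeb.toWeb])]
      rfl
    | rule N P L hr h =>
      have hw := hr.isWeb (h ▸ G.isWeb)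
      have hc := hr.card_lt
      have hG : G.nodes.card = N.card + P.card := by rw [h, Multiset.card_add]
      cases hr with
      | circle a =>
        -- The circle axiom speaks of a lone circle, so it has to be combined with multiplicativity.
        have hN : IsWeb N := by simpa using hw _ (List.mem_singleton_self _)
        have ha : IsWeb {WNode.joint a a} := ⟨by simp [insOf, WNode.ins],
          by simp [insOf, outsOf, WNode.ins, WNode.outs], by simp [WNode.Trivalent]⟩
        rw [hf.disjointUnion G hN.toWeb ha.toWeb h, hf.circle ha.toWeb a rfl,
          ih _ (by simp [IsWeb.toWeb, hG])]
        simp [combination, IsWeb.toWeb, mul_comm]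
      | bigon e p x y =>
        have h1 := hw _ (List.mem_singleton_self _)
        rw [combination_bigon, hf.bigon G h1.toWeb N e p x y h rfl,
          ih _ (by rw [hG]; simp [IsWeb.toWeb, KuperbergBracket.bigon])]
        rfl
      | quad a b c d x₁ x₂ y₁ y₂ =>
        have h1 := hw _ List.mem_cons_self
        have h2 := hw _ (List.mem_cons_of_mem _ (List.mem_singleton_self _))
        rw [combination_quad, hf.quad G h1.toWeb h2.toWeb N a b c d x₁ x₂ y₁ y₂ h rfl rfl,
          ih _ (by rw [hG]; simp [IsWeb.toWeb, KuperbergBracket.quad]), ih h2.toWeb (by rw [hG]; simp [IsWeb.toWeb, KuperbergBracket.quad])]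
        rfl

theorem IsKuperbergEvaluation.eq_value {f : Web → GraphPoly} (hf : IsKuperbergEvaluation f)
    (G : Web) : f G = value G.nodes := hf.eq_of_value (value_spec G.isWeb) G rfl

theorem existsUnique_isKuperbergEvaluation : ∃! f : Web → GraphPoly, IsKuperbergEvaluation f :=
  ⟨_, isKuperbergEvaluation_value, fun _ hf => funext hf.eq_value⟩


/-! ### State sums -/

theorem A_sum {ι : Type*} (s : Finset ι) (g : ι → ℤ) : A (∑ i ∈ s, g i) = ∏ i ∈ s, A (g i) := by
  classical
  induction s using Finset.induction_on with
  | empty => simp [A_zero]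
  | insert i s hi ih => rw [Finset.sum_insert hi, Finset.prod_insert hi, A_add, ih]

/-- The normalized state sum of a list of diagram nodes, next to the part `W` of a web. -/
noncomputable def stateSum : List DNode → Multiset WNode → GraphPoly
  | [], W => value W
  | n :: l, W =>
    if n.sign = 0 then stateSum l (W + n.resolve true)
    -- The share A^(-8ε) of the writhe factor is included: -8ε + 2ε = -6ε and -8ε - ε = -9ε.
    else A (-6 * n.sign) * stateSum l (W + n.resolve true) +
      -A (-9 * n.sign) * stateSum l (W + n.resolve false)

/-- All states of a list of diagram nodes, together with `W`, are webs. -/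
def StatesValid : List DNode → Multiset WNode → Prop
  | [], W => IsWeb W
  | n :: l, W => ∀ o, StatesValid l (W + n.resolve o)

theorem DNode.resolve_eq_of_sign_eq_zero {n : DNode} (h : n.sign = 0) (o : Bool) :
    n.resolve o = n.resolve true := by
  rcases n with ⟨k, a, b, c, d⟩ | ⟨a, b⟩
  · cases k
    · simp [DNode.sign, Kind.sign] at h
    · simp [DNode.sign, Kind.sign] at h
    · rfl
  · rfl

/-- The classical crossings in a list of nodes. -/
def classicalOf (l : List DNode) : Finset DNode := l.toFinset.filter (fun n => n.sign ≠ 0)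

/-- The sum over subsets is split by membership of the first classical crossing. Absence of
repetitions makes the choices at different nodes independent. -/
theorem eq_sum_of_expansion {R : Type*} [CommSemiring R] (u v : DNode → R) (F : Multiset WNode → R)
    {Φ : List DNode → Multiset WNode → R} (hnil : ∀ W, Φ [] W = F W)
    (hcons : ∀ n l W, Φ (n :: l) W = if n.sign = 0 then Φ l (W + n.resolve true)
      else u n * Φ l (W + n.resolve true) + v n * Φ l (W + n.resolve false))
    {l : List DNode} (hl : l.Nodup) (W : Multiset WNode) :
    Φ l W = ∑ S ∈ (classicalOf l).powerset,
      (∏ n ∈ classicalOf l, if n ∈ S then u n else v n) *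
        F (W + (l : Multiset DNode).bind fun n => n.resolve (n ∈ S)) := by
  induction l generalizing W with
  | nil => simp [classicalOf, hnil]
  | cons n l ih =>
    obtain ⟨hn, hl⟩ := List.nodup_cons.1 hl
    rw [hcons]
    split_ifs with h
    · have hc : classicalOf (n :: l) = classicalOf l := by
        simp [classicalOf, List.toFinset_cons, Finset.filter_insert, h]
      rw [ih hl, hc]
      refine Finset.sum_congr rfl fun S _ => ?_
      rw [← Multiset.cons_coe, Multiset.cons_bind, DNode.resolve_eq_of_sign_eq_zero h (n ∈ S),
        add_assoc]
    · have hc : classicalOf (n :: l) = insert n (classicalOf l) := by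
        simp [classicalOf, List.toFinset_cons, Finset.filter_insert, h]
      have hnc : n ∉ classicalOf l := by simp [classicalOf, hn]
      rw [hc, Finset.sum_powerset_insert hnc, ih hl, ih hl, Finset.mul_sum, Finset.mul_sum, add_comm]
      congr 1
      · refine Finset.sum_congr rfl fun S hS => ?_
        have hnS : n ∉ S := fun h => hnc (Finset.mem_powerset.1 hS h)
        rw [Finset.prod_insert hnc, if_neg hnS, ← Multiset.cons_coe, Multiset.cons_bind,
          mul_assoc, add_assoc]
        simp [hnS]
      · refine Finset.sum_congr rfl fun S hS => ?_
        rw [Finset.prod_insert hnc, if_pos (Finset.mem_insert_self _ _), ← Multiset.cons_coe,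
          Multiset.cons_bind, mul_assoc, add_assoc]
        have e2 : (l : Multiset DNode).bind (fun m => m.resolve (m ∈ insert n S)) =
            (l : Multiset DNode).bind fun m => m.resolve (m ∈ S) := by
          refine Multiset.bind_congr fun m hm => ?_
          have : m ≠ n := fun h => hn (h ▸ Multiset.mem_coe.1 hm)
          simp [this]
        have e1 : (∏ m ∈ classicalOf l, if m ∈ insert n S then u m else v m) =
            ∏ m ∈ classicalOf l, if m ∈ S then u m else v m := by
          refine Finset.prod_congr rfl fun m hm => ?_
          have : m ≠ n := fun h => hnc (h ▸ hm)
          simp [this]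
        rw [e1, e2]
        simp

theorem stateSum_eq_sum {l : List DNode} (hl : l.Nodup) (W : Multiset WNode) :
    stateSum l W = ∑ S ∈ (classicalOf l).powerset,
      (∏ n ∈ classicalOf l, if n ∈ S then A (-6 * n.sign) else -A (-9 * n.sign)) *
        value (W + (l : Multiset DNode).bind fun n => n.resolve (n ∈ S)) :=
  eq_sum_of_expansion _ _ value (fun _ => rfl) (fun _ _ _ => rfl) hl W

namespace Diagram

theorem nodup_nodes (K : Diagram) : K.nodes.Nodup := by
  rw [Multiset.nodup_iff_le]
  intro n hn
  obtain ⟨t, ht⟩ := Multiset.le_iff_exists_add.1 hn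
  have h1 := K.nodup
  rw [ht] at h1
  simp only [Multiset.add_bind, Multiset.cons_bind] at h1
  have h1 := (Multiset.nodup_add.1 (Multiset.nodup_add.1 h1).1).2.2
  obtain ⟨x, hx⟩ : ∃ x, x ∈ n.ins := by
    rcases n with ⟨k, a, b, c, d⟩ | ⟨a, b⟩ <;> exact ⟨a, by simp [DNode.ins]⟩
  exact Multiset.disjoint_left.1 h1 hx (Multiset.mem_add.2 (Or.inl hx))

/-- The list may enumerate the nodes in any order, so the nodes affected by a move can be placed
where the recursion needs them. -/
theorem normalizedBracket_eq_stateSum (K : Diagram) {l : List DNode}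
    (hl : K.nodes = (l : Multiset DNode)) :
    K.normalizedBracket (fun G => value G.nodes) = stateSum l 0 := by
  have hnd : l.Nodup := Multiset.coe_nodup.1 (hl ▸ K.nodup_nodes)
  have hc : K.classical = classicalOf l := by
    simp only [classical, classicalOf, hl, List.toFinset_coe]
  rw [stateSum_eq_sum hnd, normalizedBracket, bracket, Finset.mul_sum, hc]
  refine Finset.sum_congr rfl fun S _ => ?_
  rw [← mul_assoc, weight, writhe, hc, Finset.mul_sum, A_sum, ← Finset.prod_mul_distrib, zero_add,
    ← hl]
  congr 1
  refine Finset.prod_congr rfl fun n _ => ?_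
  split_ifs
  · rw [← A_add]
    congr 1
    ring
  · have h : A (-8 * n.sign) * A (-n.sign) = A (-9 * n.sign) := by
      rw [← A_add]
      congr 1
      ring
    rw [← h]
    ring

theorem statesValid (K : Diagram) {l : List DNode} (hl : K.nodes = (l : Multiset DNode)) :
    StatesValid l 0 := by
  have hnd : l.Nodup := Multiset.coe_nodup.1 (hl ▸ K.nodup_nodes)
  have key : ∀ (l : List DNode) (W : Multiset WNode), l.Nodup →
      (∀ c : DNode → Bool, IsWeb (W + (l : Multiset DNode).bind fun n => n.resolve (c n))) →
      StatesValid l W := by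
    intro l
    induction l with
    | nil => exact fun W _ h => by simpa [StatesValid] using h fun _ => true
    | cons n l ih =>
      intro W hnd h o
      obtain ⟨hn, hl⟩ := List.nodup_cons.1 hnd
      refine ih _ hl fun c => ?_
      have := h (Function.update c n o)
      rw [← Multiset.cons_coe, Multiset.cons_bind, Function.update_self, ← add_assoc] at this
      convert this using 2
      refine Multiset.bind_congr fun m hm => ?_
      rw [Function.update_of_ne]
      rintro rfl
      exact hn (Multiset.mem_coe.1 hm)
  refine key l 0 hnd fun c => ?_
  have := (K.state (l.toFinset.filter fun n => c n = true)).isWeb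
  rw [zero_add]
  convert this using 1
  change _ = K.nodes.bind _
  rw [hl]
  refine Multiset.bind_congr fun m hm => ?_
  have : m ∈ l := Multiset.mem_coe.1 hm
  simp [this]

end Diagram

/-- Locality of the state sum: the unchanged nodes are resolved first and only enlarge the
surrounding web `W`. -/
theorem stateSum_append_congr {P Q : List DNode}
    (h : ∀ W, StatesValid P W → StatesValid Q W → stateSum P W = stateSum Q W) (l : List DNode)
    (W : Multiset WNode) (hP : StatesValid (l ++ P) W) (hQ : StatesValid (l ++ Q) W) :
    stateSum (l ++ P) W = stateSum (l ++ Q) W := by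
  induction l generalizing W with
  | nil => exact h W hP hQ
  | cons n l ih =>
    rw [List.cons_append, List.cons_append, stateSum, stateSum, ih _ (hP true) (hQ true),
      ih _ (hP false) (hQ false)]

/-! ### Symbolic state sums -/

namespace DNode

/-- The local states of a symbolic node; the edge added at a crossing with first incoming edge `a`
has the symbol `200 + a`. -/
def symbolicResolve (oriented : Bool) : DNode → List SNode
  | joint a b => [SNode.joint a b]
  | crossing Kind.virtual a b c d => [SNode.joint a c, SNode.joint b d]
  | crossing _ a b c d =>
      if oriented then [SNode.joint a d, SNode.joint b c]
      else [SNode.source c d (200 + a), SNode.sink a b (200 + a)]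

/-- All symbols are below `200`. -/
def small : DNode → Bool
  | joint a b => a < 200 && b < 200
  | crossing _ a b c d => (a < 200 && b < 200) && (c < 200 && d < 200)

end DNode

/-- The value in a state of the symbols of a diagram and of its added edges. -/
def stateSymbols (δ : ℕ → ℕ) (k : ℕ) : ℕ := if k < 200 then 2 * δ k else 2 * δ (k - 200) + 1

theorem toNodes_symbolicResolve (δ : ℕ → ℕ) (o : Bool) {n : DNode} (hn : n.small = true) :
    toNodes (stateSymbols δ) (n.symbolicResolve o) = (n.relabel δ).resolve o := by
  rcases n with ⟨k, a, b, c, d⟩ | ⟨a, b⟩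
  · simp only [DNode.small, Bool.and_eq_true, decide_eq_true_eq] at hn
    obtain ⟨⟨h1, h2⟩, h3, h4⟩ := hn
    cases k <;> cases o <;> simp [DNode.symbolicResolve, DNode.relabel, DNode.resolve, toNodes,
      SNode.toNode, stateSymbols, h1, h2, h3, h4] <;> rfl
  · simp only [DNode.small, Bool.and_eq_true, decide_eq_true_eq] at hn
    simp [DNode.symbolicResolve, DNode.relabel, DNode.resolve, toNodes,
      SNode.toNode, stateSymbols, hn.1, hn.2]

/-- The normalized state sum of a list of symbolic nodes. -/
def symbolicStates : List DNode → SLin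
  | [] => [(1, 0, [])]
  | n :: l =>
    if n.sign = 0 then (symbolicStates l).attach (n.symbolicResolve true)
    else SLin.scale 1 (-6 * n.sign) ((symbolicStates l).attach (n.symbolicResolve true)) ++
      SLin.scale (-1) (-9 * n.sign) ((symbolicStates l).attach (n.symbolicResolve false))

theorem stateSum_eq_eval (δ : ℕ → ℕ) {P : List DNode} (hP : P.all DNode.small = true)
    (W : Multiset WNode) : stateSum (P.map (DNode.relabel δ)) W =
      (symbolicStates P).eval fun L => value (W + toNodes (stateSymbols δ) L) := by
  induction P generalizing W with
  | nil => simp [stateSum, symbolicStates, SLin.eval, toNodes_nil, A_zero]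
  | cons n P ih =>
    rw [List.all_cons, Bool.and_eq_true] at hP
    have hs : (n.relabel δ).sign = n.sign := by cases n <;> rfl
    rw [List.map_cons, stateSum, symbolicStates, hs]
    split_ifs
    · rw [ih hP.2, SLin.eval_attach value, toNodes_symbolicResolve δ _ hP.1]
    · rw [ih hP.2, ih hP.2, SLin.eval_append, SLin.eval_scale, SLin.eval_scale,
        SLin.eval_attach value, SLin.eval_attach value, toNodes_symbolicResolve δ _ hP.1,
        toNodes_symbolicResolve δ _ hP.1]
      simp only [Int.cast_one, Int.cast_neg]
      ring

theorem valid_symbolicStates (δ : ℕ → ℕ) {P : List DNode} (hP : P.all DNode.small = true)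
    (W : Multiset WNode) (h : StatesValid (P.map (DNode.relabel δ)) W) :
    ∀ t ∈ symbolicStates P, IsWeb (W + toNodes (stateSymbols δ) t.2.2) ∧
      t.2.2.length ≤ 2 * P.length := by
  induction P generalizing W with
  | nil =>
    intro t ht
    obtain rfl := List.mem_singleton.1 ht
    exact ⟨by simpa [toNodes_nil, StatesValid] using h, by simp⟩
  | cons n P ih =>
    rw [List.all_cons, Bool.and_eq_true] at hP
    have hlen : ∀ o, (n.symbolicResolve o).length ≤ 2 := by
      intro o
      rcases n with ⟨k, a, b, c, d⟩ | ⟨a, b⟩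
      · cases k <;> cases o <;> simp [DNode.symbolicResolve]
      · simp [DNode.symbolicResolve]
    have key : ∀ o, ∀ t ∈ (symbolicStates P).attach (n.symbolicResolve o),
        IsWeb (W + toNodes (stateSymbols δ) t.2.2) ∧ t.2.2.length ≤ 2 * (n :: P).length := by
      intro o t ht
      obtain ⟨u, hu, rfl⟩ := List.mem_map.1 ht
      have h1 := ih hP.2 _ (h o) u hu
      have h2 := hlen o
      rw [toNodes_append, toNodes_symbolicResolve δ _ hP.1, ← add_assoc, List.length_append,
        List.length_cons]
      exact ⟨h1.1, by omega⟩
    intro t ht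
    rw [symbolicStates] at ht
    split_ifs at ht
    · exact key _ t ht
    · rcases List.mem_append.1 ht with ht | ht <;> obtain ⟨u, hu, rfl⟩ := List.mem_map.1 ht <;>
        exact key _ u hu

/-- A sufficient criterion for two symbolic tangles to have the same state sum. -/
def sameStates (P Q : List DNode) : Bool :=
  (P.all DNode.small && Q.all DNode.small) && SLin.agree (symbolicStates P) (symbolicStates Q)

theorem stateSum_eq_of_sameStates {P Q : List DNode} (h : sameStates P Q = true) {δ ε : ℕ → ℕ}
    (hδε : ∀ k < 100, ε k = δ k) (W : Multiset WNode)
    (hP : StatesValid (P.map (DNode.relabel δ)) W) (hQ : StatesValid (Q.map (DNode.relabel ε)) W) :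
    stateSum (P.map (DNode.relabel δ)) W = stateSum (Q.map (DNode.relabel ε)) W := by
  simp only [sameStates, Bool.and_eq_true] at h
  obtain ⟨⟨h1, h2⟩, h3⟩ := h
  rw [stateSum_eq_eval δ h1, stateSum_eq_eval ε h2]
  -- Every diagram node becomes at most two web nodes, so this bound exceeds the size of all states
  -- on both sides; `value` respects reductions below any bound.
  refine SLin.eval_eq_of_agree
    (value_respectsBelow (W.card + 2 * P.length + 2 * Q.length + 1)) h3 (fun k hk => ?_)
    (fun t ht => ?_) fun t ht => ?_
  · simp only [stateSymbols, if_pos (show k < 200 by omega), hδε k hk]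
  · have := valid_symbolicStates δ h1 W hP t ht
    exact ⟨this.1, by omega⟩
  · have := valid_symbolicStates ε h2 W hQ t ht
    exact ⟨this.1, by omega⟩

/-! ### Invariance -/

theorem lookup_eq_lookup (bd i i' : List ℕ) : ∀ k < 100, lookup bd i' k = lookup bd i k := by
  intro k hk
  simp only [lookup, if_pos hk]

theorem ofHeights_cases {p q : ℕ} (h : p ≠ q) :
    (q < p ∧ Kind.ofHeights p q = Kind.positive) ∨ (p < q ∧ Kind.ofHeights p q = Kind.negative) := by
  rcases lt_or_gt_of_ne h with h | h
  · exact Or.inr ⟨h, if_neg (by omega)⟩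
  · exact Or.inl ⟨h, if_pos h⟩

-- Of the eight sign patterns two contradict transitivity of the order of heights. The other six,
-- and the three kinds for each position of the virtual strand, are checked by expanding and
-- reducing all states.
open DNode in
theorem sameStates_triangle {k₁₂ k₁₃ k₂₃ : Kind} (h : TriangleKinds k₁₂ k₁₃ k₂₃) :
    sameStates [crossing k₁₂ 0 1 100 101, crossing k₁₃ 100 2 3 102, crossing k₂₃ 101 102 4 5]
      [crossing k₂₃ 1 2 101 102, crossing k₁₃ 0 102 100 5, crossing k₁₂ 100 101 3 4] = true := by
  cases h with
  | heights p₁ p₂ p₃ h₁₂ h₁₃ h₂₃ =>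
    rcases ofHeights_cases h₁₂ with ⟨l1, e1⟩ | ⟨l1, e1⟩ <;>
      rcases ofHeights_cases h₁₃ with ⟨l2, e2⟩ | ⟨l2, e2⟩ <;>
      rcases ofHeights_cases h₂₃ with ⟨l3, e3⟩ | ⟨l3, e3⟩ <;>
      first
        | omega
        | (rw [e1, e2, e3]; decide +kernel)
  | virtual₁ => cases k₂₃ <;> decide +kernel
  | virtual₂ => cases k₁₃ <;> decide +kernel
  | virtual₃ => cases k₁₂ <;> decide +kernel

open DNode in
theorem sameStates_cyclicTriangle {k₁₂ k₁₃ k₂₃ : Kind} (h : TriangleKinds k₁₂ k₁₃ k₂₃) :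
    sameStates
      [crossing k₁₂ 100 1 3 101, crossing k₂₃ 101 2 4 102, crossing k₁₃.mirror 102 0 5 100]
      [crossing k₁₂ 0 101 100 4, crossing k₂₃ 1 102 101 5, crossing k₁₃.mirror 2 100 102 3] =
        true := by
  cases h with
  | heights p₁ p₂ p₃ h₁₂ h₁₃ h₂₃ =>
    rcases ofHeights_cases h₁₂ with ⟨l1, e1⟩ | ⟨l1, e1⟩ <;>
      rcases ofHeights_cases h₁₃ with ⟨l2, e2⟩ | ⟨l2, e2⟩ <;>
      rcases ofHeights_cases h₂₃ with ⟨l3, e3⟩ | ⟨l3, e3⟩ <;>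
      first
        | omega
        | (rw [e1, e2, e3]; decide +kernel)
  | virtual₁ => cases k₂₃ <;> decide +kernel
  | virtual₂ => cases k₁₃ <;> decide +kernel
  | virtual₃ => cases k₁₂ <;> decide +kernel

open DNode in
/-- Every local move is an instance of a symbolic identity between state sums. -/
theorem LocalMove.exists_sameStates {P Q : Multiset DNode} (h : LocalMove P Q) :
    ∃ (P' Q' : List DNode) (δ ε : ℕ → ℕ), P = ↑(P'.map (DNode.relabel δ)) ∧
      Q = ↑(Q'.map (DNode.relabel ε)) ∧ (∀ k < 100, ε k = δ k) ∧ sameStates P' Q' = true := by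
  cases h with
  | kink k a b i =>
    -- Symbols below 100 stand for the ends of the tangle, common to both sides; symbols from 100 on
    -- stand for arcs inside one side.
    exact ⟨[crossing k 0 100 100 1], [joint 0 1], lookup [a, b] [i], lookup [a, b] [], rfl, rfl,
      lookup_eq_lookup _ _ _, by cases k <;> decide +kernel⟩
  | kink' k a b i =>
    exact ⟨[crossing k 100 0 1 100], [joint 0 1], lookup [a, b] [i], lookup [a, b] [], rfl, rfl,
      lookup_eq_lookup _ _ _, by cases k <;> decide +kernel⟩
  | parallel k a b c d i j =>
    exact ⟨[crossing k 0 2 100 101, crossing k.mirror 101 100 3 1], [joint 0 1, joint 2 3],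
      lookup [a, b, c, d] [i, j], lookup [a, b, c, d] [], rfl, rfl, lookup_eq_lookup _ _ _,
      by cases k <;> decide +kernel⟩
  | antiparallel k a b c d i j =>
    exact ⟨[crossing k 0 101 100 3, crossing k.mirror 2 100 101 1], [joint 0 1, joint 2 3],
      lookup [a, b, c, d] [i, j], lookup [a, b, c, d] [], rfl, rfl, lookup_eq_lookup _ _ _,
      by cases k <;> decide +kernel⟩
  | antiparallel' k a b c d i j =>
    exact ⟨[crossing k 101 0 3 100, crossing k.mirror 100 2 1 101], [joint 0 1, joint 2 3],
      lookup [a, b, c, d] [i, j], lookup [a, b, c, d] [], rfl, rfl, lookup_eq_lookup _ _ _,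
      by cases k <;> decide +kernel⟩
  | triangle k₁₂ k₁₃ k₂₃ h a₁ a₂ a₃ b₁ b₂ b₃ i₁ i₂ i₃ j₁ j₂ j₃ =>
    exact ⟨_, _, lookup [a₁, a₂, a₃, b₁, b₂, b₃] [i₁, i₂, i₃],
      lookup [a₁, a₂, a₃, b₁, b₂, b₃] [j₁, j₂, j₃], rfl, rfl, lookup_eq_lookup _ _ _,
      sameStates_triangle h⟩
  | cyclicTriangle k₁₂ k₁₃ k₂₃ h a₁ a₂ a₃ b₁ b₂ b₃ i₁ i₂ i₃ j₁ j₂ j₃ =>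
    exact ⟨_, _, lookup [a₁, a₂, a₃, b₁, b₂, b₃] [i₁, i₂, i₃],
      lookup [a₁, a₂, a₃, b₁, b₂, b₃] [j₁, j₂, j₃], rfl, rfl, lookup_eq_lookup _ _ _,
      sameStates_cyclicTriangle h⟩
  | zParallel k a b c d i j i' j' =>
    exact ⟨[crossing k 0 2 100 101, crossing Kind.virtual 101 100 3 1],
      [crossing Kind.virtual 0 2 100 101, crossing k 101 100 3 1],
      lookup [a, b, c, d] [i, j], lookup [a, b, c, d] [i', j'], rfl, rfl, lookup_eq_lookup _ _ _,
      by cases k <;> decide +kernel⟩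
  | zAntiparallel k a b c d i j i' j' =>
    exact ⟨[crossing k 0 101 100 3, crossing Kind.virtual 2 100 101 1],
      [crossing Kind.virtual 0 101 100 3, crossing k 2 100 101 1],
      lookup [a, b, c, d] [i, j], lookup [a, b, c, d] [i', j'], rfl, rfl, lookup_eq_lookup _ _ _,
      by cases k <;> decide +kernel⟩
  | zAntiparallel' k a b c d i j i' j' =>
    exact ⟨[crossing k 101 0 3 100, crossing Kind.virtual 100 2 1 101],
      [crossing Kind.virtual 101 0 3 100, crossing k 100 2 1 101],
      lookup [a, b, c, d] [i, j], lookup [a, b, c, d] [i', j'], rfl, rfl, lookup_eq_lookup _ _ _,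
      by cases k <;> decide +kernel⟩

/-! ### State sums under renaming and erasure of joints -/

/-- The renaming of the edges of the states that belongs to a renaming of the edges of a diagram. -/
def double (τ : ℕ → ℕ) (x : ℕ) : ℕ := 2 * τ (x / 2) + x % 2

theorem double_even (τ : ℕ → ℕ) (x : ℕ) : double τ (2 * x) = 2 * τ x := by
  simp [double]

theorem double_odd (τ : ℕ → ℕ) (x : ℕ) : double τ (2 * x + 1) = 2 * τ x + 1 := by
  rw [double, show (2 * x + 1) / 2 = x by omega, show (2 * x + 1) % 2 = 1 by omega]

theorem DNode.resolve_relabel (τ : ℕ → ℕ) (o : Bool) (n : DNode) :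
    (n.relabel τ).resolve o = relabelAll (double τ) (n.resolve o) := by
  rcases n with ⟨k, a, b, c, d⟩ | ⟨a, b⟩
  · cases k <;> cases o <;> simp [DNode.relabel, DNode.resolve, relabelAll, WNode.relabel,
      double_even, double_odd]
  · simp [DNode.relabel, DNode.resolve, relabelAll, WNode.relabel, double_even]

theorem DNode.sign_relabel (τ : ℕ → ℕ) (n : DNode) : (n.relabel τ).sign = n.sign := by
  cases n <;> rfl

/-- The permutation of the edges of the states that belongs to a permutation of the edges. -/
def doublePerm (σ : Equiv.Perm ℕ) : Equiv.Perm ℕ where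
  toFun := double σ
  invFun := double σ.symm
  left_inv x := by
    simp only [double]
    rw [show (2 * σ (x / 2) + x % 2) / 2 = σ (x / 2) by omega, Equiv.symm_apply_apply]
    omega
  right_inv x := by
    simp only [double]
    rw [show (2 * σ.symm (x / 2) + x % 2) / 2 = σ.symm (x / 2) by omega, Equiv.apply_symm_apply]
    omega

theorem stateSum_relabel (σ : Equiv.Perm ℕ) (l : List DNode) (W : Multiset WNode)
    (h : StatesValid l W) :
    stateSum (l.map (DNode.relabel σ)) (relabelAll (doublePerm σ) W) = stateSum l W := by
  induction l generalizing W with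
  | nil => exact value_relabelAll h (doublePerm σ)
  | cons n l ih =>
    have e : ∀ o, relabelAll (doublePerm σ) W + (n.relabel σ).resolve o =
        relabelAll (doublePerm σ) (W + n.resolve o) := fun o => by
      rw [DNode.resolve_relabel, relabelAll, relabelAll, relabelAll, Multiset.map_add]
      rfl
    rw [List.map_cons, stateSum, stateSum, DNode.sign_relabel, e, e, ih _ (h true), ih _ (h false)]

/-- Erasing the joint in the diagram also turns the added edge `2 * b + 1` into `2 * a + 1`, while
erasing it in the web renames only `2 * b`. As `a` ends at no node of `l`, the name `2 * a + 1` is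
free, and an exchange of the two odd names reconciles both. -/
theorem stateSum_eraseJoint {a b : ℕ} (hab : a ≠ b) (l : List DNode)
    (hl : ∀ n ∈ l, a ∉ n.ins) (W : Multiset WNode) (hi : 2 * a + 1 ∉ insOf W)
    (ho : 2 * a + 1 ∉ outsOf W) (h : StatesValid l (W + {WNode.joint (2 * a) (2 * b)})) :
    stateSum l (W + {WNode.joint (2 * a) (2 * b)}) =
      stateSum (l.map (DNode.relabel (Function.update id b a)))
        (relabelAll (double (Function.update id b a)) W) := by
  induction l generalizing W with
  | nil =>
    have hne : 2 * a ≠ 2 * b := by omega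
    rw [List.map_nil, stateSum, stateSum, value_joint h hne,
      ← value_relabelAll (IsWeb.eraseJoint hne h) (Equiv.swap (2 * a + 1) (2 * b + 1)),
      relabelAll_relabelAll]
    congr 1
    have key : ∀ x, x ≠ 2 * a + 1 → (Equiv.swap (2 * a + 1) (2 * b + 1))
        (Function.update id (2 * b) (2 * a) x) = double (Function.update id b a) x := by
      intro x hx
      obtain ⟨y, rfl | rfl⟩ : ∃ y, x = 2 * y ∨ x = 2 * y + 1 := ⟨x / 2, by omega⟩
      · rw [double_even]
        by_cases hy : y = b
        · subst hy
          rw [Function.update_self, Function.update_self,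
            Equiv.swap_apply_of_ne_of_ne (by omega) (by omega)]
        · rw [Function.update_of_ne hy, Function.update_of_ne (by omega), id, id,
            Equiv.swap_apply_of_ne_of_ne (by omega) (by omega)]
      · rw [double_odd, Function.update_of_ne (by omega), id]
        by_cases hy : y = b
        · subst hy
          rw [Function.update_self, Equiv.swap_apply_right]
        · rw [Function.update_of_ne hy, id, Equiv.swap_apply_of_ne_of_ne hx (by omega)]
    exact relabelAll_congr (fun x hx => key x fun e => hi (e ▸ hx))
      fun x hx => key x fun e => ho (e ▸ hx)
  | cons n l ih =>
    have hn : a ∉ n.ins := hl n (by simp)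
    have hadd : ∀ o, 2 * a + 1 ∉ n.added o := fun o hm => by
      obtain ⟨x, hx, e⟩ := Multiset.mem_map.1 (Multiset.mem_of_le (n.added_le o) hm)
      obtain rfl : x = a := by omega
      exact hn hx
    have hres : ∀ o, 2 * a + 1 ∉ insOf (W + n.resolve o) ∧
        2 * a + 1 ∉ outsOf (W + n.resolve o) := by
      intro o
      rw [insOf, outsOf, Multiset.add_bind, Multiset.add_bind, DNode.bind_ins_resolve,
        DNode.bind_outs_resolve]
      simp only [Multiset.mem_add, Multiset.mem_map, not_or, not_exists, not_and]
      exact ⟨⟨hi, fun x _ => by omega, hadd o⟩, ho, fun x _ => by omega, hadd o⟩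
    have e : ∀ o, relabelAll (double (Function.update id b a)) W +
        (n.relabel (Function.update id b a)).resolve o =
        relabelAll (double (Function.update id b a)) (W + n.resolve o) := fun o => by
      rw [DNode.resolve_relabel, relabelAll, relabelAll, relabelAll, Multiset.map_add]
    have ih : ∀ o, stateSum l (W + {WNode.joint (2 * a) (2 * b)} + n.resolve o) =
        stateSum (l.map (DNode.relabel (Function.update id b a)))
          (relabelAll (double (Function.update id b a)) (W + n.resolve o)) := fun o => by
      have := h o
      rw [add_right_comm] at this ⊢
      exact ih (fun m hm => hl m (by simp [hm])) _ (hres o).1 (hres o).2 this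
    rw [List.map_cons, stateSum, stateSum, DNode.sign_relabel, e, e, ih, ih]

namespace Diagram

theorem Move.normalizedBracket_eq {K L : Diagram} (h : Move K L) :
    K.normalizedBracket (fun G => value G.nodes) = L.normalizedBracket fun G => value G.nodes := by
  cases h with
  | relabel σ h =>
    have hK : K.nodes = (K.nodes.toList : Multiset DNode) := (Multiset.coe_toList _).symm
    have hL : L.nodes = (K.nodes.toList.map (DNode.relabel σ) : List DNode) := by
      rw [h, ← Multiset.map_coe, Multiset.coe_toList]
    rw [K.normalizedBracket_eq_stateSum hK, L.normalizedBracket_eq_stateSum hL,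
      ← stateSum_relabel σ _ _ (K.statesValid hK)]
    simp
  | eraseJoint N a b hab hK hL =>
    -- The joint is listed first, so that it passes into the surrounding web before any crossing is
    -- resolved.
    have hK' : K.nodes = ((DNode.joint a b :: N.toList : List DNode) : Multiset DNode) := by
      rw [hK, ← Multiset.cons_coe, Multiset.coe_toList, ← Multiset.singleton_add, add_comm]
    have hL' : L.nodes = (N.toList.map (DNode.relabel (Function.update id b a)) : List DNode) := by
      rw [hL, ← Multiset.map_coe, Multiset.coe_toList]
    have hnd := K.nodup
    have hv := K.statesValid hK' true
    rw [hK, Multiset.add_bind, Multiset.singleton_bind] at hnd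
    rw [K.normalizedBracket_eq_stateSum hK', L.normalizedBracket_eq_stateSum hL', stateSum,
      if_pos (show (DNode.joint a b).sign = 0 from rfl)]
    refine (stateSum_eraseJoint hab N.toList (fun n hn han => ?_) 0 (by simp) (by simp) hv).trans
      (by simp)
    exact Multiset.disjoint_left.1 (Multiset.nodup_add.1 hnd).2.2
      (Multiset.mem_bind.2 ⟨n, Multiset.mem_toList.1 hn, han⟩) (by simp [DNode.ins])
  | replace N P Q h hK hL =>
    obtain ⟨P', Q', δ, ε, rfl, rfl, hδε, hs⟩ := h.exists_sameStates
    -- The replaced tangle is listed last, behind the part that both diagrams share.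
    have hK' : K.nodes = ((N.toList ++ P'.map (DNode.relabel δ) : List DNode) : Multiset DNode) := by
      rw [hK, ← Multiset.coe_add, Multiset.coe_toList]
    have hL' : L.nodes = ((N.toList ++ Q'.map (DNode.relabel ε) : List DNode) : Multiset DNode) := by
      rw [hL, ← Multiset.coe_add, Multiset.coe_toList]
    rw [K.normalizedBracket_eq_stateSum hK', L.normalizedBracket_eq_stateSum hL']
    exact stateSum_append_congr (fun W hP hQ => stateSum_eq_of_sameStates hs hδε W hP hQ) _ _
      (K.statesValid hK') (L.statesValid hL')

theorem ZEquiv.normalizedBracket_eq {K L : Diagram} (h : ZEquiv K L) :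
    K.normalizedBracket (fun G => value G.nodes) = L.normalizedBracket fun G => value G.nodes := by
  induction h with
  | rel _ _ h => exact h.normalizedBracket_eq
  | refl _ => rfl
  | symm _ _ _ ih => exact ih.symm
  | trans _ _ _ _ _ ih ih' => exact ih.trans ih'

end Diagram

/-! ### The circle and the skein relation -/

theorem stateSum_circle (a : ℕ) (h : StatesValid [DNode.joint a a] 0) :
    stateSum [DNode.joint a a] 0 = A 6 + 1 + A (-6) := by
  have hw : IsWeb (0 + {WNode.joint (2 * a) (2 * a)}) := h true
  rw [stateSum, if_pos (show (DNode.joint a a).sign = 0 from rfl), stateSum, DNode.resolve, value_rule (LocalRule.circle _) hw]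
  simp [combination, value_eq isWeb_zero Value.empty]

/-- Both unoriented terms have coefficient -1 after multiplication by A^(±9) and cancel; the
oriented ones leave A^3 - A^(-3). The crossings in `l` enter linearly. -/
theorem stateSum_skein (a b c d : ℕ) (l : List DNode) (W : Multiset WNode) :
    A 9 * stateSum (l ++ [DNode.crossing Kind.positive a b c d]) W -
      A (-9) * stateSum (l ++ [DNode.crossing Kind.negative a b c d]) W =
      (A 3 - A (-3)) * stateSum (l ++ [DNode.joint a d, DNode.joint b c]) W := by
  induction l generalizing W with
  | nil =>
    have e : ∀ p q : WNode, W + {p} + {q} = p ::ₘ (W + {q}) := fun p q => by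
      rw [add_right_comm, ← Multiset.singleton_add, add_comm]
    have h1 : A 9 * A (-6) = A 3 := by rw [← A_add]; norm_num
    have h2 : A (-9) * A 6 = A (-3) := by rw [← A_add]; norm_num
    simp [stateSum, DNode.sign, Kind.sign, DNode.resolve, e]
    linear_combination value (WNode.joint (2 * a) (2 * d) ::ₘ (W + {WNode.joint (2 * b) (2 * c)})) *
      (h1 - h2)
  | cons n l ih =>
    have h1 := ih (W + n.resolve true)
    have h2 := ih (W + n.resolve false)
    simp only [List.cons_append, stateSum]
    split_ifs
    · exact h1
    · linear_combination A (-6 * n.sign) * h1 - A (-9 * n.sign) * h2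

end KuperbergBracket

open KuperbergBracket in
theorem mainTheorem2 :
    (∃! f : Web → GraphPoly, IsKuperbergEvaluation f) ∧
    ∀ f : Web → GraphPoly, IsKuperbergEvaluation f →
      (∀ K L : Diagram, K.ZEquiv L → K.normalizedBracket f = L.normalizedBracket f) ∧
      (∀ (O : Diagram) (a : ℕ), O.nodes = {DNode.joint a a} →
        O.normalizedBracket f = A 6 + 1 + A (-6)) ∧
      (∀ (Kp Km Ko : Diagram) (N : Multiset DNode) (a b c d : ℕ),
        Kp.nodes = N + {DNode.crossing Kind.positive a b c d} →
        Km.nodes = N + {DNode.crossing Kind.negative a b c d} →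
        Ko.nodes = N + {DNode.joint a d, DNode.joint b c} →
        A 9 * Kp.normalizedBracket f - A (-9) * Km.normalizedBracket f =
          (A 3 - A (-3)) * Ko.normalizedBracket f) := by
  refine ⟨existsUnique_isKuperbergEvaluation, fun f hf => ?_⟩
  obtain rfl : f = fun G => value G.nodes := funext hf.eq_value
  refine ⟨fun K L h => h.normalizedBracket_eq, fun O a hO => ?_,
    fun Kp Km Ko N a b c d hp hm ho => ?_⟩
  · have h : O.nodes = ([DNode.joint a a] : List DNode) := hO
    rw [O.normalizedBracket_eq_stateSum h, stateSum_circle a (O.statesValid h)]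
  · have e : ∀ l : List DNode, N + (l : Multiset DNode) = (N.toList ++ l : List DNode) := fun l => by
      rw [← Multiset.coe_add, Multiset.coe_toList]
    rw [Kp.normalizedBracket_eq_stateSum (hp.trans (e [DNode.crossing Kind.positive a b c d])),
      Km.normalizedBracket_eq_stateSum (hm.trans (e [DNode.crossing Kind.negative a b c d])),
      Ko.normalizedBracket_eq_stateSum (ho.trans (e [DNode.joint a d, DNode.joint b c]))]
    exact stateSum_skein a b c d _ _
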